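/- Let $B$ be a connected smooth manifold of dimension $g$ and $\Lambda\subset T^*B$ a Lagrangian covering, i.e. a family of lattices $\Lambda_b\subset T^*_bB$ such that around every point of $B$ there are smooth coordinates $(x^1,\dots,x^g)$ (action coordinates) with $\Lambda_b=\bigoplus_j\mathbb Z\,(dx^j)_b$. Let $f\colon X=T^*B/\Lambda\to B$ be the associated Lagrangian torus fibration, with symplectic form $\omega=\sum_j dx^j\wedge dy_j$ in action-angle coordinates $(x,y)$, where $y$ denotes the class of the covector $\sum_j y_j\,dx^j$ (up to isomorphism these are the fibrations in Lagrangian tori that have a Lagrangian section). Let $\hat f\colon\hat X=R^1f_*\mathbb R/R^1f_*\mathbb Z=TB/\Lambda^\vee\to B$ be the dual family, where $\Lambda_b^\vee=\{v\in T_bB:\lambda(v)\in\mathbb Z\ \forall\lambda\in\Lambda_b\}$, with the complex structure for which $z^j=x^j+iw^j$ are holomorphic coordinates, $(x,w)$ being the class of the vector $\sum_j w^j\,\partial/\partial x^j$. The Gauss–Manin connection is the flat connection on $T^*B\simeq\mathrm{Vert}\,TX$ for which the $dx^j$ are parallel. Let $\mathcal P$ be the Poincaré bundle on $X\times_B\hat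 X$, with connection form $2\pi i\sum_j w^j\,dy_j$. Let $S\subset X$ be a closed embedded submanifold such that (C1) $S$ is Lagrangian; (C2) for every $b\in B$ the intersection $S_b=S\cap X_b$, when nonempty, is an affine subtorus of $X_b=T_b^*B/\Lambda_b$, i.e. a translate of $W/(W\cap\Lambda_b)$ for a linear subspace $W\subset T^*_bB$ such that $W\cap\Lambda_b$ has rank $\dim W$, and its dimension $m$ does not depend on $b$; and such that $f|_S\colon S\to f(S)$ is a submersion, in the sense that $T_sS\cap\ker d_sf=T_sS_{f(s)}$ for every $s\in S$. Let $(\mathcal L,\nabla)$ be a $U(1)$ local system on $S$ (a line bundle with a flat unitary connection), let $p_S,\hat p_S$ be the projections of $Z_S=S\times_B\hat X$ to $S$ and $\hat X$, let $\mathcal P_S=\mathcal P|_{Z_S}$, and let $\nabla_r$ be the part of the connection of $p_S^*\mathcal L\otimes\mathcal P_S$ along the fibres of $\hat p_S$. Let $\hat{\mathcal L}=R^m\hat p_{S,*}\ker\nabla_r$, the $m$-th cohomology sheaf of the complex $\hat p_{S,*}(p_S^*\mathcal L\otimes\mathcal P_S\otimes\Omega^\bullet_{\rm rel})$ of relative forms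 with differential $\nabla_r$, and let $\hat S=\{\xi\in\hat X:\hat{\mathcal L}_\xi\neq0\}$ be its support. Then the condition (C3) the vertical tangent spaces of the family of subtori $\{S_b\}_{b\in f(S)}$ are carried into each other by Gauss–Manin parallel transport along paths in $f(S)$ holds if and only if $\hat S$ is a complex submanifold of $\hat X$. -/

import Mathlib

open Set Filter Topology
open scoped Manifold ContDiff

noncomputable section

namespace TorusFibration

/-! ### Submanifolds of a vector space -/

section Submanifold

/-- Velocities at `p` of curves contained in `M`. For a submanifold `M` this is `T_p M`. -/
def tangentVectors {V : Type*} [AddCommGroup V] [Module ℝ V] [TopologicalSpace V]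
    [ContinuousSMul ℝ V] (M : Set V) (p : V) : Set V :=
  {v | ∃ γ : ℝ → V, γ 0 = p ∧ (∀ᶠ t in 𝓝 (0 : ℝ), γ t ∈ M) ∧ HasDerivAt γ v 0}

/-- `M` is an embedded `d`-dimensional submanifold of class `C^n` over `𝕜` of the vector space `V`:
around each of its points there is a `C^n` chart of `V` that straightens `M` into a linear
subspace of dimension `d`. For `𝕜 = ℂ` these are the complex submanifolds. -/
def IsSubmanifold (𝕜 : Type*) [NontriviallyNormedField 𝕜] {V : Type*} [NormedAddCommGroup V]
    [NormedSpace 𝕜 V] (n : WithTop ℕ∞) (d : ℕ) (M : Set V) : Prop :=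
  ∀ p ∈ M, ∃ (Φ : OpenPartialHomeomorph V V) (F : Submodule 𝕜 V),
    p ∈ Φ.source ∧ ContDiffOn 𝕜 n Φ Φ.source ∧ ContDiffOn 𝕜 n Φ.symm Φ.target ∧
    Module.finrank 𝕜 F = d ∧ Φ '' (M ∩ Φ.source) = Φ.target ∩ (F : Set V)

end Submanifold

/-! ### Unitary local systems of rank one -/

/-- A `U(1)` local system (a line bundle with flat unitary connection) on a subset `S` of a
topological space, presented by local flat unitary frames over an open cover: the frames over two
members of the cover differ by a locally constant function with values in `U(1)`. -/
structure LocalSystem {Y : Type*} [TopologicalSpace Y] (S : Set Y) where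
  /-- the index set of the cover -/
  ι : Type*
  /-- the open cover of `S` -/
  cover : ι → Set Y
  isOpen_cover : ∀ i, IsOpen (cover i)
  subset_cover : S ⊆ ⋃ i, cover i
  /-- the transition functions -/
  trans : ι → ι → Y → Circle
  locallyConstant : ∀ i j, ∀ p ∈ S ∩ (cover i ∩ cover j),
    ∀ᶠ q in 𝓝[S] p, trans i j q = trans i j p
  cocycle : ∀ i j k, ∀ p ∈ S ∩ (cover i ∩ cover j ∩ cover k),
    trans i j p * trans j k p = trans i k p

/-! ### Lagrangian torus fibrations and their duals -/

section Fibration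

/-- The coordinate space `ℝ^g`. -/
abbrev Coord (g : ℕ) : Type := EuclideanSpace ℝ (Fin g)

variable {g : ℕ} {B : Type*} [TopologicalSpace B] [ChartedSpace (Coord g) B]

variable (g) in
/-- The tangent space `T_b B`. -/
abbrev Tan (b : B) : Type := TangentSpace (𝓡 g) b

variable (g) in
/-- The cotangent space `T*_b B`. -/
abbrev Cot (b : B) : Type := Tan g b →L[ℝ] ℝ

/-- The covector `∑ y_j dx^j` at `b`, where `(x^1, …, x^g)` are the components of `φ`. -/
def cot (φ : OpenPartialHomeomorph B (Coord g)) (b : B) (y : Coord g) : Cot g b :=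
  ContinuousLinearMap.comp (innerSL ℝ y : Coord g →L[ℝ] ℝ)
    (mfderiv (𝓡 g) 𝓘(ℝ, Coord g) φ b : Tan g b →L[ℝ] Coord g)

/-- The vector `∑ w^j ∂/∂x^j` at the point with coordinates `x`. -/
def tan (φ : OpenPartialHomeomorph B (Coord g)) (x w : Coord g) : Tan g (φ.symm x) :=
  mfderiv 𝓘(ℝ, Coord g) (𝓡 g) φ.symm x w

/-- Action coordinates: smooth coordinates `(x^1, …, x^g)` on `B` such that
`Λ_b = ⨁ ℤ (dx^j)_b` at each point `b` of the domain. -/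
def IsActionChart (Λ : ∀ b : B, AddSubgroup (Cot g b)) (φ : OpenPartialHomeomorph B (Coord g)) :
    Prop :=
  φ ∈ IsManifold.maximalAtlas (𝓡 g) ∞ B ∧
  ∀ b ∈ φ.source, ∀ α : Cot g b,
    α ∈ Λ b ↔ ∃ n : Fin g → ℤ, α = cot φ b (WithLp.toLp 2 fun j => (n j : ℝ))

variable (g B) in
/-- A Lagrangian covering `Λ ⊂ T*B`: a family of lattices in the cotangent spaces of `B`, locally
spanned over `ℤ` by the differentials of a system of coordinates. -/
structure LagrangianCovering where
  /-- the lattice in `T*_b B` -/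
  lattice : ∀ b : B, AddSubgroup (Cot g b)
  exists_actionChart : ∀ b : B, ∃ φ, IsActionChart lattice φ ∧ b ∈ φ.source

variable (Λ : LagrangianCovering g B)

/-- The action charts on the base. -/
abbrev ActionChart : Type _ := {φ : OpenPartialHomeomorph B (Coord g) // IsActionChart Λ.lattice φ}

/-- The dual lattice `{v ∈ T_b B | λ(v) ∈ ℤ for all λ ∈ Λ_b} = H^1(X_b, ℤ)` in
`T_b B = Hom(Λ_b, ℝ) = H^1(X_b, ℝ)`. -/
def dualLattice (b : B) : AddSubgroup (Tan g b) where
  carrier := {v | ∀ l ∈ Λ.lattice b, ∃ n : ℤ, l v = n}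
  zero_mem' := fun l _ => ⟨0, by simp⟩
  add_mem' := by
    rintro v w hv hw l hl
    obtain ⟨a, ha⟩ := hv l hl
    obtain ⟨c, hc⟩ := hw l hl
    exact ⟨a + c, by simp [ha, hc]⟩
  neg_mem' := by
    rintro v hv l hl
    obtain ⟨a, ha⟩ := hv l hl
    exact ⟨-a, by simp [ha]⟩

/-- The Lagrangian torus fibration `X = T*B / Λ`, with projection `f = Sigma.fst`. -/
def X : Type _ := Σ b : B, Cot g b ⧸ Λ.lattice b

/-- The dual family `X̂ = TB / Λ^∨ = R¹f_*ℝ / R¹f_*ℤ`, with projection `Sigma.fst`. -/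
def XHat : Type _ := Σ b : B, Tan g b ⧸ dualLattice Λ b

variable {Λ}

/-- The point of `X` defined by a covector. -/
def X.mk {b : B} (α : Cot g b) : X Λ := ⟨b, QuotientAddGroup.mk α⟩

/-- The point of `X̂` defined by a vector. -/
def XHat.mk {b : B} (v : Tan g b) : XHat Λ := ⟨b, QuotientAddGroup.mk v⟩

/-- The projection `f : X → B`. -/
def X.proj (p : X Λ) : B := p.1

/-- The point of `X` with action-angle coordinates `(x, y)`; it is of interest for `x ∈ φ.target`,
and the `y`'s are defined modulo integers. -/
def X.param (φ : ActionChart Λ) (p : Coord g × Coord g) : X Λ :=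
  X.mk (cot φ.1 (φ.1.symm p.1) p.2)

/-- The point of `X̂` with coordinates `(x, w)`, the `w`'s being dual to the `y`'s. -/
def XHat.param (φ : ActionChart Λ) (p : Coord g × Coord g) : XHat Λ :=
  XHat.mk (tan φ.1 p.1 p.2)

/-- The quotient topology, i.e. the final topology for the action-angle parametrizations. -/
instance : TopologicalSpace (X Λ) :=
  ⨆ φ : ActionChart Λ, TopologicalSpace.coinduced
    (fun p : {p : Coord g × Coord g // p.1 ∈ φ.1.target} => X.param φ p.1) inferInstance

/-- The quotient topology, i.e. the final topology for the parametrizations by `(x, w)`. -/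
instance : TopologicalSpace (XHat Λ) :=
  ⨆ φ : ActionChart Λ, TopologicalSpace.coinduced
    (fun p : {p : Coord g × Coord g // p.1 ∈ φ.1.target} => XHat.param φ p.1) inferInstance

/-! ### Conditions on a subset of `X` -/

/-- The part of `S` in an action-angle chart, as a subset of `ℝ^g × ℝ^g` (periodic in `y`). -/
def inChart (S : Set (X Λ)) (φ : ActionChart Λ) : Set (Coord g × Coord g) :=
  {p | p.1 ∈ φ.1.target ∧ X.param φ p ∈ S}

/-- The symplectic form `∑ dx^j ∧ dy_j`. -/
def symplecticForm (u v : Coord g × Coord g) : ℝ :=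
  inner ℝ u.1 v.2 - inner ℝ v.1 u.2

/-- `S` is a closed (embedded) Lagrangian submanifold of `X`. -/
structure IsClosedLagrangian (S : Set (X Λ)) : Prop where
  isClosed : IsClosed S
  isSubmanifold : ∀ φ : ActionChart Λ, IsSubmanifold ℝ ∞ g (inChart S φ)
  isotropic : ∀ φ : ActionChart Λ, ∀ p ∈ inChart S φ,
    ∀ u ∈ tangentVectors (inChart S φ) p, ∀ v ∈ tangentVectors (inChart S φ) p,
      symplecticForm u v = 0

/-- `f` restricts to a submersion `S → f(S)`, in the sense that `ker d(f|_S)` at a point `s` of `S`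
consists of vectors tangent to the fibre `S_b` through `s`. -/
def IsFibrewiseClean (S : Set (X Λ)) : Prop :=
  ∀ φ : ActionChart Λ, ∀ p ∈ inChart S φ, ∀ u ∈ tangentVectors (inChart S φ) p,
    u.1 = 0 → u ∈ tangentVectors (inChart S φ ∩ {q | q.1 = p.1}) p

/-- The preimage in `T*_b B` of the fibre `S_b ⊂ X_b = T*_b B / Λ_b`. -/
def fibre (S : Set (X Λ)) (b : B) : Set (Cot g b) := {α | (X.mk α : X Λ) ∈ S}

/-- A subset of a fibre `X_b = T*_b B / Λ_b` is an affine subtorus of dimension `m` if it is a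
translate of `W / (W ∩ Λ_b)`, where `W` is an `m`-dimensional subspace in which `W ∩ Λ_b` has
full rank. -/
def IsAffineSubtorus {b : B} (m : ℕ) (T : Set (Cot g b ⧸ Λ.lattice b)) : Prop :=
  ∃ (α₀ : Cot g b) (W : Submodule ℝ (Cot g b)), Module.finrank ℝ W = m ∧
    Submodule.span ℝ ((W : Set (Cot g b)) ∩ (Λ.lattice b : Set (Cot g b))) = W ∧
    T = (fun α : Cot g b => (QuotientAddGroup.mk (α₀ + α) : Cot g b ⧸ Λ.lattice b)) '' W

/-- Each nonempty intersection of `S` with a fibre of `X` is an affine subtorus of dimension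
`m`. -/
def FibresAreSubtori (S : Set (X Λ)) (m : ℕ) : Prop :=
  ∀ b : B, (fibre S b).Nonempty →
    IsAffineSubtorus m {q : Cot g b ⧸ Λ.lattice b | (⟨b, q⟩ : X Λ) ∈ S}

/-- The tangent space of `S_b` at `[α]`, as a subset of `Vert T_[α] X = T*_b B`. -/
def vertTangent (S : Set (X Λ)) {b : B} (α : Cot g b) : Set (Cot g b) :=
  tangentVectors (fibre S b) α

variable (Λ) in
/-- A section `α` of `T*B = Vert TX` along the path `c : [0, 1] → B` is parallel for the Gauss-Manin
connection: it has constant components in the frames `dx^1, …, dx^g` given by action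
coordinates. -/
def IsParallelAlong (c : ℝ → B) (α : ∀ t, Cot g (c t)) : Prop :=
  ∀ φ : ActionChart Λ, ∀ t₀ ∈ Icc (0 : ℝ) 1, c t₀ ∈ φ.1.source →
    ∃ y : Coord g, ∀ᶠ t in 𝓝[Icc 0 1] t₀, α t = cot φ.1 (c t) y

/-- The vertical tangent spaces of the family `S_b`, `b ∈ f(S)`, are carried into each other by
parallel transport along paths in `f(S)`. -/
def VerticalTangentsParallel (S : Set (X Λ)) : Prop :=
  ∀ c : ℝ → B, ContMDiffOn 𝓘(ℝ, ℝ) (𝓡 g) ∞ c (Icc 0 1) → (∀ t ∈ Icc (0 : ℝ) 1, c t ∈ X.proj '' S) →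
    ∀ α : ∀ t, Cot g (c t), IsParallelAlong Λ c α →
      ∀ β₀ ∈ fibre S (c 0), ∀ β₁ ∈ fibre S (c 1),
        α 0 ∈ vertTangent S β₀ → α 1 ∈ vertTangent S β₁

/-! ### The Fourier-Mukai transform -/

section Transform

variable {S : Set (X Λ)} (L : LocalSystem S)

/-- Data for a relative `q`-form on `Z_S = S ×_B X̂` over `X̂` with values in
`p_S^* L ⊗ P_S`: for each local frame `i` of `L`, for each `b` and each pair `(α, v)` which lifts a
point of the fibre of `Z_S` over `b`, an alternating form on `Vert T_[α] X = T*_b B`. Only its values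
on vectors tangent to `S_b` matter. -/
abbrev FormData (q : ℕ) : Type _ :=
  L.ι → ∀ b : B, Cot g b → Tan g b → Cot g b [⋀^Fin q]→ₗ[ℝ] ℂ

/-- `τ` is a (smooth) section of `p_S^* L ⊗ P_S ⊗ Ω^q_rel` over the preimage of `U ⊂ X̂` in `Z_S`.
Sections of the Poincaré bundle `P` are functions `s` of `(α, v)` satisfying
`s(α + λ, v + μ) = exp(-2πi μ(α)) s(α, v)` for `λ ∈ Λ_b` and `μ ∈ Λ_b^∨`; this is the gauge in which
its connection form is `2πi ∑ w^j dy_j`. -/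
structure IsRelForm {q : ℕ} (U : Set (XHat Λ)) (τ : FormData L q) : Prop where
  smooth : ∀ (i : L.ι) (φ : ActionChart Λ) (u : Fin q → Coord g),
    ContDiffOn ℝ ∞
      (fun p : Coord g × Coord g × Coord g =>
        τ i (φ.1.symm p.1) (cot φ.1 (φ.1.symm p.1) p.2.1) (tan φ.1 p.1 p.2.2)
          (fun j => cot φ.1 (φ.1.symm p.1) (u j)))
      {p | p.1 ∈ φ.1.target ∧ X.param φ (p.1, p.2.1) ∈ S ∩ L.cover i ∧
        XHat.param φ (p.1, p.2.2) ∈ U}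
  glue : ∀ (i j : L.ι) (b : B) (α : Cot g b) (v : Tan g b),
    X.mk α ∈ S ∩ (L.cover i ∩ L.cover j) → XHat.mk v ∈ U →
    ∀ u : Fin q → Cot g b, (∀ a, u a ∈ vertTangent S α) →
      τ i b α v u = (L.trans i j (X.mk α) : ℂ) * τ j b α v u
  automorphy : ∀ (i : L.ι) (b : B) (α : Cot g b) (v : Tan g b),
    X.mk α ∈ S ∩ L.cover i → XHat.mk v ∈ U →
    ∀ l ∈ Λ.lattice b, ∀ μ ∈ dualLattice Λ b,
    ∀ u : Fin q → Cot g b, (∀ a, u a ∈ vertTangent S α) →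
      τ i b (α + l) (v + μ) u =
        Complex.exp (-(2 * Real.pi * Complex.I * (α μ : ℂ))) * τ i b α v u

variable {L}

/-- The value of `∇_r τ` on the vectors `u 0, …, u q` tangent to `S_b`, where `∇_r` is the relative
part of the connection of `p_S^* L ⊗ P_S`: exterior derivative along `S_b` (with respect to constant
vector fields), plus exterior product with the connection form `2πi ∑ w^j dy_j` of `P`. -/
def relD {q : ℕ} (τ : FormData L q) (i : L.ι) (b : B) (α : Cot g b) (v : Tan g b)
    (u : Fin (q + 1) → Cot g b) : ℂ :=
  ∑ a : Fin (q + 1), (-1 : ℂ) ^ (a : ℕ) *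
    (deriv (fun t : ℝ => τ i b (α + t • u a) v (fun c => u (a.succAbove c))) 0 +
      2 * Real.pi * Complex.I * (u a v : ℂ) * τ i b α v (fun c => u (a.succAbove c)))

/-- `∇_r τ = 0` over `U`. -/
def IsRelClosed {q : ℕ} (U : Set (XHat Λ)) (τ : FormData L q) : Prop :=
  ∀ (i : L.ι) (b : B) (α : Cot g b) (v : Tan g b), X.mk α ∈ S ∩ L.cover i → XHat.mk v ∈ U →
    ∀ u : Fin (q + 1) → Cot g b, (∀ a, u a ∈ vertTangent S α) → relD τ i b α v u = 0

/-- The class of `τ` vanishes over `U`: `τ = 0` in degree `0`, and `τ = ∇_r σ` for a section `σ` of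
`p_S^* L ⊗ P_S ⊗ Ω^{q-1}_rel` over `U` in degree `q ≥ 1`. -/
def IsRelExact : {q : ℕ} → (U : Set (XHat Λ)) → (τ : FormData L q) → Prop
  | 0, U, τ => ∀ (i : L.ι) (b : B) (α : Cot g b) (v : Tan g b),
      X.mk α ∈ S ∩ L.cover i → XHat.mk v ∈ U → ∀ u : Fin 0 → Cot g b, τ i b α v u = 0
  | q + 1, U, τ => ∃ σ : FormData L q, IsRelForm L U σ ∧
      ∀ (i : L.ι) (b : B) (α : Cot g b) (v : Tan g b), X.mk α ∈ S ∩ L.cover i → XHat.mk v ∈ U →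
        ∀ u : Fin (q + 1) → Cot g b, (∀ a, u a ∈ vertTangent S α) →
          τ i b α v u = relD σ i b α v u

variable (L) in
/-- The support of `R^q p̂_{S,*} ker ∇_r`, the `q`-th cohomology sheaf of the complex
`p̂_{S,*}(p_S^* L ⊗ P_S ⊗ Ω^•_rel)` on `X̂`: the set of the points `ξ` at which the stalk is not zero,
i.e. some closed section near `ξ` is not exact on any neighbourhood of `ξ`. -/
def transformSupport (q : ℕ) : Set (XHat Λ) :=
  {ξ | ∃ U : Set (XHat Λ), IsOpen U ∧ ξ ∈ U ∧
    ∃ τ : FormData L q, IsRelForm L U τ ∧ IsRelClosed U τ ∧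
      ∀ U' ⊆ U, IsOpen U' → ξ ∈ U' → ¬ IsRelExact U' τ}

end Transform

/-! ### Complex submanifolds of `X̂` -/

/-- The part of `T ⊂ X̂` in the holomorphic coordinates `z^j = x^j + i w^j`. -/
def inComplexChart (T : Set (XHat Λ)) (φ : ActionChart Λ) : Set (Fin g → ℂ) :=
  {z | WithLp.toLp 2 (fun j => (z j).re) ∈ φ.1.target ∧
    XHat.param φ (WithLp.toLp 2 (fun j => (z j).re), WithLp.toLp 2 (fun j => (z j).im)) ∈ T}

/-- `T` is a complex submanifold of `X̂`. -/
def IsComplexSubmanifold (T : Set (XHat Λ)) : Prop :=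
  ∃ d : ℕ, ∀ φ : ActionChart Λ, IsSubmanifold ℂ ω d (inComplexChart T φ)

end Fibration

end TorusFibration

end

open TorusFibration

open Set Filter Topology
open scoped Manifold ContDiff

noncomputable section

namespace TorusFibration

section Coordinates

variable {g : ℕ} {B : Type*} [TopologicalSpace B] [ChartedSpace (Coord g) B]

variable (g) in
/-- The standard lattice `ℤ^g` in `ℝ^g`. -/
def intLattice : AddSubgroup (Coord g) where
  carrier := {y | ∃ n : Fin g → ℤ, y = WithLp.toLp 2 fun j => (n j : ℝ)}
  zero_mem' := ⟨0, by ext j; simp⟩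
  add_mem' := by
    rintro _ _ ⟨a, rfl⟩ ⟨c, rfl⟩
    exact ⟨a + c, by ext j; simp⟩
  neg_mem' := by
    rintro _ ⟨a, rfl⟩
    exact ⟨-a, by ext j; simp⟩

theorem mem_intLattice {y : Coord g} : y ∈ intLattice g ↔ ∀ j, ∃ n : ℤ, y j = n := by
  constructor
  · rintro ⟨n, rfl⟩ j
    exact ⟨n j, rfl⟩
  · intro h
    choose n hn using h
    exact ⟨n, by ext j; simp [hn]⟩

theorem single_mem_intLattice (j : Fin g) : EuclideanSpace.single j (1 : ℝ) ∈ intLattice g := by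
  rw [mem_intLattice]
  intro k
  by_cases h : k = j
  · exact ⟨1, by simp [h]⟩
  · exact ⟨0, by simp [h]⟩

theorem exists_int_inner_eq {l n : Coord g} (hl : l ∈ intLattice g) (hn : n ∈ intLattice g) :
    ∃ k : ℤ, inner ℝ l n = k := by
  obtain ⟨a, rfl⟩ := hl
  obtain ⟨c, rfl⟩ := hn
  exact ⟨∑ j, c j * a j, by simp [PiLp.inner_apply]⟩

theorem mem_intLattice_of_inner {w : Coord g}
    (h : ∀ l ∈ intLattice g, ∃ k : ℤ, inner ℝ l w = k) : w ∈ intLattice g := by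
  rw [mem_intLattice]
  intro j
  obtain ⟨k, hk⟩ := h _ (single_mem_intLattice j)
  exact ⟨k, by simpa [PiLp.inner_apply] using hk⟩

/-- The components of a covector in the frame `dx^1, …, dx^g`. -/
def ycoord (φ : OpenPartialHomeomorph B (Coord g)) (b : B) (α : Cot g b) : Coord g :=
  WithLp.toLp 2 fun j => α ((mfderiv (𝓡 g) 𝓘(ℝ, Coord g) φ b : Tan g b →L[ℝ] Coord g).inverse
    (EuclideanSpace.single j 1))

/-- The components of a vector in the frame `∂/∂x^1, …, ∂/∂x^g`. -/
def wcoord (φ : OpenPartialHomeomorph B (Coord g)) (b : B) (v : Tan g b) : Coord g :=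
  (mfderiv (𝓡 g) 𝓘(ℝ, Coord g) φ b : Tan g b →L[ℝ] Coord g) v

variable {φ : OpenPartialHomeomorph B (Coord g)}

theorem mdifferentiable_of_mem_maximalAtlas [IsManifold (𝓡 g) ∞ B]
    (hφ : φ ∈ IsManifold.maximalAtlas (𝓡 g) ∞ B) :
    φ.MDifferentiable (𝓡 g) 𝓘(ℝ, Coord g) :=
  ⟨(contMDiffOn_of_mem_maximalAtlas hφ).mdifferentiableOn (by simp),
    (contMDiffOn_symm_of_mem_maximalAtlas hφ).mdifferentiableOn (by simp)⟩

theorem mfderiv_chart_invertible [IsManifold (𝓡 g) ∞ B]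
    (hφ : φ ∈ IsManifold.maximalAtlas (𝓡 g) ∞ B) {b : B} (hb : b ∈ φ.source) :
    (mfderiv (𝓡 g) 𝓘(ℝ, Coord g) φ b : Tan g b →L[ℝ] Coord g).IsInvertible :=
  ⟨(mdifferentiable_of_mem_maximalAtlas hφ).mfderiv hb, rfl⟩

theorem wcoord_tan [IsManifold (𝓡 g) ∞ B]
    (hφ : φ ∈ IsManifold.maximalAtlas (𝓡 g) ∞ B) {x : Coord g} (hx : x ∈ φ.target) (w : Coord g) :
    wcoord φ (φ.symm x) (tan φ x w) = w := by
  have := (mdifferentiable_of_mem_maximalAtlas hφ).comp_symm_deriv hx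
  exact congrArg (fun f => f w) this

theorem tan_wcoord [IsManifold (𝓡 g) ∞ B]
    (hφ : φ ∈ IsManifold.maximalAtlas (𝓡 g) ∞ B) {x : Coord g} (hx : x ∈ φ.target)
    (v : Tan g (φ.symm x)) : tan φ x (wcoord φ (φ.symm x) v) = v := by
  have := (mdifferentiable_of_mem_maximalAtlas hφ).symm_comp_deriv (φ.map_target hx)
  rw [φ.right_inv hx] at this
  exact congrArg (fun f => f v) this

theorem inner_ycoord [IsManifold (𝓡 g) ∞ B]
    (hφ : φ ∈ IsManifold.maximalAtlas (𝓡 g) ∞ B) {b : B} (hb : b ∈ φ.source) (α : Cot g b)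
    (v : Tan g b) : inner ℝ (ycoord φ b α) (wcoord φ b v) = α v := by
  obtain ⟨e, he⟩ := mfderiv_chart_invertible hφ hb
  have hw : wcoord φ b v = e v := by rw [wcoord, ← he]; rfl
  have h1 : ∀ u : Coord g, (mfderiv (𝓡 g) 𝓘(ℝ, Coord g) φ b : Tan g b →L[ℝ] Coord g).inverse u =
      e.symm u := by
    intro u
    rw [← he]
    exact congrArg (fun f => f u) (ContinuousLinearMap.inverse_equiv e)
  let a : Coord g →ₗ[ℝ] ℝ :=
    { toFun := fun u => α (e.symm u)
      map_add' := fun u u' => (congrArg α (map_add e.symm u u')).trans (map_add α _ _)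
      map_smul' := fun c u => (congrArg α (map_smul e.symm c u)).trans (map_smul α _ _) }
  have h2 : ∀ u : Coord g, a u = ∑ j, u j * a (EuclideanSpace.single j 1) := by
    intro u
    conv_lhs => rw [← (EuclideanSpace.basisFun (Fin g) ℝ).sum_repr u]
    simp
  have h3 : a (wcoord φ b v) = α v := (congrArg a hw).trans (congrArg α (e.symm_apply_apply v))
  rw [← h3, h2, PiLp.inner_apply]
  refine Finset.sum_congr rfl fun j _ => ?_
  simp only [ycoord, h1]
  rfl

theorem cot_apply {b : B} (y : Coord g) (v : Tan g b) :
    cot φ b y v = inner ℝ y (wcoord φ b v) := rfl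

theorem cot_ycoord [IsManifold (𝓡 g) ∞ B]
    (hφ : φ ∈ IsManifold.maximalAtlas (𝓡 g) ∞ B) {b : B} (hb : b ∈ φ.source) (α : Cot g b) :
    cot φ b (ycoord φ b α) = α := by
  ext v
  rw [cot_apply, inner_ycoord hφ hb]

theorem ycoord_cot [IsManifold (𝓡 g) ∞ B]
    (hφ : φ ∈ IsManifold.maximalAtlas (𝓡 g) ∞ B) {b : B} (hb : b ∈ φ.source) (y : Coord g) :
    ycoord φ b (cot φ b y) = y := by
  obtain ⟨e, he⟩ := mfderiv_chart_invertible hφ hb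
  refine ext_inner_right ℝ fun w => ?_
  obtain ⟨v, rfl⟩ := e.surjective w
  have : e v = wcoord φ b v := by rw [wcoord, ← he]; rfl
  rw [this, inner_ycoord hφ hb, cot_apply]

theorem cot_add (b : B) (y y' : Coord g) : cot φ b (y + y') = cot φ b y + cot φ b y' := by
  ext v
  simp [cot_apply, inner_add_left]

theorem cot_smul (b : B) (c : ℝ) (y : Coord g) : cot φ b (c • y) = c • cot φ b y := by
  ext v
  simp [cot_apply, inner_smul_left]

theorem ycoord_add (b : B) (α α' : Cot g b) :
    ycoord φ b (α + α') = ycoord φ b α + ycoord φ b α' := by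
  ext j
  simp [ycoord]

theorem ycoord_smul (b : B) (c : ℝ) (α : Cot g b) :
    ycoord φ b (c • α) = c • ycoord φ b α := by
  ext j
  simp [ycoord]

theorem wcoord_add (b : B) (v v' : Tan g b) :
    wcoord φ b (v + v') = wcoord φ b v + wcoord φ b v' :=
  map_add _ _ _

theorem wcoord_sub (b : B) (v v' : Tan g b) :
    wcoord φ b (v - v') = wcoord φ b v - wcoord φ b v' :=
  map_sub _ _ _

variable (φ) in
/-- `ycoord` as a linear map. -/
def ycoordₗ (b : B) : Cot g b →ₗ[ℝ] Coord g where
  toFun := ycoord φ b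
  map_add' := ycoord_add b
  map_smul' := ycoord_smul b

variable (φ) in
/-- `cot` as a linear map. -/
def cotₗ (b : B) : Coord g →ₗ[ℝ] Cot g b where
  toFun := cot φ b
  map_add' := cot_add b
  map_smul' := cot_smul b

theorem ycoord_sub (b : B) (α α' : Cot g b) :
    ycoord φ b (α - α') = ycoord φ b α - ycoord φ b α' :=
  map_sub (ycoordₗ φ b) _ _

theorem hasDerivAt_linear_to_dual (f : Coord g →ₗ[ℝ] Coord g →L[ℝ] ℝ) {γ : ℝ → Coord g}
    {v : Coord g} {t : ℝ} (h : HasDerivAt γ v t) : HasDerivAt (fun s => f (γ s)) (f v) t :=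
  (LinearMap.toContinuousLinearMap f).hasFDerivAt.comp_hasDerivAt t h

theorem hasDerivAt_linear_of_dual (f : (Coord g →L[ℝ] ℝ) →ₗ[ℝ] Coord g)
    {γ : ℝ → Coord g →L[ℝ] ℝ} {v : Coord g →L[ℝ] ℝ} {t : ℝ} (h : HasDerivAt γ v t) :
    HasDerivAt (fun s => f (γ s)) (f v) t :=
  (LinearMap.toContinuousLinearMap f).hasFDerivAt.comp_hasDerivAt t h

theorem hasDerivAt_ycoord {b : B} {γ : ℝ → Cot g b} {v : Cot g b} {t : ℝ}
    (h : HasDerivAt γ v t) : HasDerivAt (fun s => ycoord φ b (γ s)) (ycoord φ b v) t :=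
  hasDerivAt_linear_of_dual (ycoordₗ φ b) h

theorem hasDerivAt_cot {b : B} {γ : ℝ → Coord g} {v : Coord g} {t : ℝ}
    (h : HasDerivAt γ v t) : HasDerivAt (fun s => cot φ b (γ s)) (cot φ b v) t :=
  hasDerivAt_linear_to_dual (cotₗ φ b) h

end Coordinates

section Fibration

variable {g : ℕ} {B : Type*} [TopologicalSpace B] [ChartedSpace (Coord g) B]
  {Λ : LagrangianCovering g B}

theorem X.mk_eq_mk {b : B} {α α' : Cot g b} :
    (X.mk α : X Λ) = X.mk α' ↔ α' - α ∈ Λ.lattice b := by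
  refine (Sigma.mk.inj_iff (β := fun b => Cot g b ⧸ Λ.lattice b)).trans ?_
  simp [QuotientAddGroup.eq, sub_eq_neg_add]

theorem XHat.mk_eq_mk {b : B} {v v' : Tan g b} :
    (XHat.mk v : XHat Λ) = XHat.mk v' ↔ v' - v ∈ dualLattice Λ b := by
  refine (Sigma.mk.inj_iff (β := fun b => Tan g b ⧸ dualLattice Λ b)).trans ?_
  simp [QuotientAddGroup.eq, sub_eq_neg_add]

variable [IsManifold (𝓡 g) ∞ B]

theorem cot_mem_lattice (φ : ActionChart Λ) {b : B} (hb : b ∈ φ.1.source) {y : Coord g} :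
    cot φ.1 b y ∈ Λ.lattice b ↔ y ∈ intLattice g := by
  rw [φ.2.2 b hb]
  constructor
  · rintro ⟨n, hn⟩
    exact ⟨n, by simpa [ycoord_cot φ.2.1 hb] using congrArg (ycoord φ.1 b) hn⟩
  · rintro ⟨n, rfl⟩
    exact ⟨n, rfl⟩

theorem mem_lattice_iff (φ : ActionChart Λ) {b : B} (hb : b ∈ φ.1.source) {α : Cot g b} :
    α ∈ Λ.lattice b ↔ ycoord φ.1 b α ∈ intLattice g := by
  rw [← cot_mem_lattice φ hb, cot_ycoord φ.2.1 hb]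

theorem mem_dualLattice_iff (φ : ActionChart Λ) {b : B} (hb : b ∈ φ.1.source) {v : Tan g b} :
    v ∈ dualLattice Λ b ↔ wcoord φ.1 b v ∈ intLattice g := by
  constructor
  · intro h
    refine mem_intLattice_of_inner fun l hl => ?_
    exact h (cot φ.1 b l) ((cot_mem_lattice φ hb).2 hl)
  · intro h l hl
    rw [← inner_ycoord φ.2.1 hb]
    exact exists_int_inner_eq ((mem_lattice_iff φ hb).1 hl) h

theorem X.mk_eq_param (φ : ActionChart Λ) {b : B} (hb : b ∈ φ.1.source) (α : Cot g b) :
    (X.mk α : X Λ) = X.param φ (φ.1 b, ycoord φ.1 b α) := by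
  obtain ⟨x, hx, rfl⟩ : ∃ x ∈ φ.1.target, b = φ.1.symm x :=
    ⟨φ.1 b, φ.1.map_source hb, (φ.1.left_inv hb).symm⟩
  simp only [X.param]
  rw [φ.1.right_inv hx, cot_ycoord φ.2.1 hb]

theorem XHat.mk_eq_param (φ : ActionChart Λ) {b : B} (hb : b ∈ φ.1.source) (v : Tan g b) :
    (XHat.mk v : XHat Λ) = XHat.param φ (φ.1 b, wcoord φ.1 b v) := by
  obtain ⟨x, hx, rfl⟩ : ∃ x ∈ φ.1.target, b = φ.1.symm x :=
    ⟨φ.1 b, φ.1.map_source hb, (φ.1.left_inv hb).symm⟩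
  simp only [XHat.param]
  rw [φ.1.right_inv hx, tan_wcoord φ.2.1 hx]

theorem X.param_eq_param (φ : ActionChart Λ) {p q : Coord g × Coord g} (hp : p.1 ∈ φ.1.target)
    (hq : q.1 ∈ φ.1.target) :
    X.param φ p = X.param φ q ↔ p.1 = q.1 ∧ q.2 - p.2 ∈ intLattice g := by
  obtain ⟨x, y⟩ := p
  obtain ⟨x', y'⟩ := q
  have key : X.param φ (x, y) = X.param φ (x, y') ↔ y' - y ∈ intLattice g := by
    simp only [X.param]
    rw [X.mk_eq_mk, mem_lattice_iff φ (φ.1.map_target hp), ycoord_sub,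
      ycoord_cot φ.2.1 (φ.1.map_target hp), ycoord_cot φ.2.1 (φ.1.map_target hp)]
  constructor
  · intro h
    have hx : x = x' := by
      have h1 : φ.1.symm x = φ.1.symm x' := congrArg Sigma.fst h
      simpa [φ.1.right_inv hp, φ.1.right_inv hq] using congrArg φ.1 h1
    subst hx
    exact ⟨rfl, key.1 h⟩
  · rintro ⟨h1, h2⟩
    obtain rfl : x = x' := h1
    exact key.2 h2

theorem XHat.param_eq_param (φ : ActionChart Λ) {p q : Coord g × Coord g}
    (hp : p.1 ∈ φ.1.target) (hq : q.1 ∈ φ.1.target) :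
    XHat.param φ p = XHat.param φ q ↔ p.1 = q.1 ∧ q.2 - p.2 ∈ intLattice g := by
  obtain ⟨x, y⟩ := p
  obtain ⟨x', y'⟩ := q
  have key : XHat.param φ (x, y) = XHat.param φ (x, y') ↔ y' - y ∈ intLattice g := by
    simp only [XHat.param]
    rw [XHat.mk_eq_mk, mem_dualLattice_iff φ (φ.1.map_target hp), wcoord_sub,
      wcoord_tan φ.2.1 hp, wcoord_tan φ.2.1 hp]
  constructor
  · intro h
    have hx : x = x' := by
      have h1 : φ.1.symm x = φ.1.symm x' := congrArg Sigma.fst h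
      simpa [φ.1.right_inv hp, φ.1.right_inv hq] using congrArg φ.1 h1
    subst hx
    exact ⟨rfl, key.1 h⟩
  · rintro ⟨h1, h2⟩
    obtain rfl : x = x' := h1
    exact key.2 h2

end Fibration

section Transition

variable {g : ℕ} {B : Type*} [TopologicalSpace B] 
  {φ ψ : OpenPartialHomeomorph B (Coord g)}

theorem isOpen_transition_domain (ψ φ : OpenPartialHomeomorph B (Coord g)) :
    IsOpen {x | x ∈ ψ.target ∧ ψ.symm x ∈ φ.source} :=
  ψ.symm.continuousOn.isOpen_inter_preimage ψ.open_target φ.open_source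

variable [ChartedSpace (Coord g) B]

theorem contDiffOn_transition (hψ : ψ ∈ IsManifold.maximalAtlas (𝓡 g) ∞ B)
    (hφ : φ ∈ IsManifold.maximalAtlas (𝓡 g) ∞ B) :
    ContDiffOn ℝ ∞ (fun x => φ (ψ.symm x)) {x | x ∈ ψ.target ∧ ψ.symm x ∈ φ.source} := by
  rw [← contMDiffOn_iff_contDiffOn]
  refine (contMDiffOn_of_mem_maximalAtlas hφ).comp
    ((contMDiffOn_symm_of_mem_maximalAtlas hψ).mono fun x hx => hx.1) fun x hx => hx.2

theorem contDiffOn_fderiv_transition (hψ : ψ ∈ IsManifold.maximalAtlas (𝓡 g) ∞ B)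
    (hφ : φ ∈ IsManifold.maximalAtlas (𝓡 g) ∞ B) :
    ContDiffOn ℝ ∞ (fderiv ℝ (fun x => φ (ψ.symm x))) {x | x ∈ ψ.target ∧ ψ.symm x ∈ φ.source} :=
  (contDiffOn_transition hψ hφ).fderiv_of_isOpen (isOpen_transition_domain ψ φ) (by simp)

variable [IsManifold (𝓡 g) ∞ B]

theorem wcoord_tan_eq_fderiv (hψ : ψ ∈ IsManifold.maximalAtlas (𝓡 g) ∞ B)
    (hφ : φ ∈ IsManifold.maximalAtlas (𝓡 g) ∞ B) {x : Coord g} (hx : x ∈ ψ.target)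
    (hx' : ψ.symm x ∈ φ.source) (w : Coord g) :
    wcoord φ (ψ.symm x) (tan ψ x w) = fderiv ℝ (fun x => φ (ψ.symm x)) x w := by
  have h1 : MDifferentiableAt (𝓡 g) 𝓘(ℝ, Coord g) φ (ψ.symm x) :=
    (mdifferentiable_of_mem_maximalAtlas hφ).mdifferentiableAt hx'
  have h2 : MDifferentiableAt 𝓘(ℝ, Coord g) (𝓡 g) ψ.symm x :=
    (mdifferentiable_of_mem_maximalAtlas hψ).mdifferentiableAt_symm hx
  have h3 := mfderiv_comp x h1 h2
  rw [mfderiv_eq_fderiv] at h3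
  exact (congrArg (fun f => f w) h3).symm

theorem ycoord_cot_eq (hψ : ψ ∈ IsManifold.maximalAtlas (𝓡 g) ∞ B)
    (hφ : φ ∈ IsManifold.maximalAtlas (𝓡 g) ∞ B) {b : B} (hb : b ∈ φ.source) (hb' : b ∈ ψ.source)
    (y : Coord g) (j : Fin g) :
    ycoord φ b (cot ψ b y) j = inner ℝ y
      (fderiv ℝ (fun x => ψ (φ.symm x)) (φ b) (EuclideanSpace.single j 1)) := by
  obtain ⟨x, hx, rfl⟩ : ∃ x ∈ φ.target, b = φ.symm x :=
    ⟨φ b, φ.map_source hb, (φ.left_inv hb).symm⟩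
  rw [φ.right_inv hx, ← wcoord_tan_eq_fderiv hφ hψ hx hb', ← cot_apply,
    ← inner_ycoord hφ hb, wcoord_tan hφ hx]
  simp [PiLp.inner_apply]

theorem contDiffOn_wcoord_tan (hψ : ψ ∈ IsManifold.maximalAtlas (𝓡 g) ∞ B)
    (hφ : φ ∈ IsManifold.maximalAtlas (𝓡 g) ∞ B) :
    ContDiffOn ℝ ∞ (fun p : Coord g × Coord g => wcoord φ (ψ.symm p.1) (tan ψ p.1 p.2))
      {p | p.1 ∈ ψ.target ∧ ψ.symm p.1 ∈ φ.source} := by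
  have h1 : ContDiffOn ℝ ∞ (fun p : Coord g × Coord g =>
      fderiv ℝ (fun x => φ (ψ.symm x)) p.1 p.2)
      {p | p.1 ∈ ψ.target ∧ ψ.symm p.1 ∈ φ.source} :=
    ((contDiffOn_fderiv_transition hψ hφ).comp contDiffOn_fst fun p hp => hp).clm_apply
      contDiffOn_snd
  exact h1.congr fun p hp => wcoord_tan_eq_fderiv hψ hφ hp.1 hp.2 p.2

theorem contDiffOn_ycoord_cot (hψ : ψ ∈ IsManifold.maximalAtlas (𝓡 g) ∞ B)
    (hφ : φ ∈ IsManifold.maximalAtlas (𝓡 g) ∞ B) :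
    ContDiffOn ℝ ∞ (fun p : Coord g × Coord g => ycoord φ (ψ.symm p.1) (cot ψ (ψ.symm p.1) p.2))
      {p | p.1 ∈ ψ.target ∧ ψ.symm p.1 ∈ φ.source} := by
  rw [contDiffOn_euclidean]
  intro j
  have h0 : ContDiffOn ℝ ∞ (fun p : Coord g × Coord g => φ (ψ.symm p.1))
      {p | p.1 ∈ ψ.target ∧ ψ.symm p.1 ∈ φ.source} :=
    (contDiffOn_transition hψ hφ).comp contDiffOn_fst fun p hp => hp
  have h1 : ContDiffOn ℝ ∞ (fun p : Coord g × Coord g => inner ℝ p.2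
      (fderiv ℝ (fun x => ψ (φ.symm x)) (φ (ψ.symm p.1)) (EuclideanSpace.single j 1)))
      {p | p.1 ∈ ψ.target ∧ ψ.symm p.1 ∈ φ.source} := by
    refine contDiffOn_snd.inner ℝ (((contDiffOn_fderiv_transition hφ hψ).comp h0 ?_).clm_apply
      contDiffOn_const)
    intro p hp
    refine ⟨φ.map_source hp.2, ?_⟩
    rw [φ.left_inv hp.2]
    exact ψ.map_target hp.1
  exact h1.congr fun p hp => ycoord_cot_eq hψ hφ hp.2 (ψ.map_target hp.1) p.2 j

end Transition

section Topology

variable {g : ℕ} {B : Type*} [TopologicalSpace B]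

theorem isOpen_subtype_target (φ : OpenPartialHomeomorph B (Coord g))
    {O : Set (Coord g × Coord g)} :
    IsOpen ((fun p : {p : Coord g × Coord g // p.1 ∈ φ.target} => p.1) ⁻¹' O) ↔
      IsOpen {p | p.1 ∈ φ.target ∧ p ∈ O} := by
  have ho : IsOpen {p : Coord g × Coord g | p.1 ∈ φ.target} :=
    φ.open_target.preimage continuous_fst
  rw [ho.isOpenEmbedding_subtypeVal.isOpen_iff_image_isOpen]
  have : {p : Coord g × Coord g | p.1 ∈ φ.target ∧ p ∈ O} = Subtype.val ''
      ((fun p : {p : Coord g × Coord g // p.1 ∈ φ.target} => p.1) ⁻¹' O) := by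
    ext p
    simp [and_comm]
  rw [this]
  rfl

variable [ChartedSpace (Coord g) B] {Λ : LagrangianCovering g B}

theorem X.isOpen_iff {U : Set (X Λ)} :
    IsOpen U ↔ ∀ φ : ActionChart Λ, IsOpen {p | p.1 ∈ φ.1.target ∧ X.param φ p ∈ U} := by
  simp only [isOpen_iSup_iff, isOpen_coinduced]
  exact forall_congr' fun φ => isOpen_subtype_target φ.1 (O := X.param φ ⁻¹' U)

theorem XHat.isOpen_iff {U : Set (XHat Λ)} :
    IsOpen U ↔ ∀ φ : ActionChart Λ, IsOpen {p | p.1 ∈ φ.1.target ∧ XHat.param φ p ∈ U} := by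
  simp only [isOpen_iSup_iff, isOpen_coinduced]
  exact forall_congr' fun φ => isOpen_subtype_target φ.1 (O := XHat.param φ ⁻¹' U)

theorem X.continuousOn_param (φ : ActionChart Λ) :
    ContinuousOn (X.param φ) {p | p.1 ∈ φ.1.target} :=
  (continuousOn_open_iff (φ.1.open_target.preimage continuous_fst)).2 fun _ hU =>
    X.isOpen_iff.1 hU φ

theorem XHat.continuousOn_param (φ : ActionChart Λ) :
    ContinuousOn (XHat.param φ) {p | p.1 ∈ φ.1.target} :=
  (continuousOn_open_iff (φ.1.open_target.preimage continuous_fst)).2 fun _ hU =>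
    XHat.isOpen_iff.1 hU φ

theorem XHat.continuous_proj : Continuous (fun ξ : XHat Λ => ξ.1) := by
  refine ⟨fun O hO => XHat.isOpen_iff.2 fun φ => ?_⟩
  exact (φ.1.symm.continuousOn.isOpen_inter_preimage φ.1.open_target hO).preimage continuous_fst

theorem XHat.isOpen_image_param [IsManifold (𝓡 g) ∞ B] (φ : ActionChart Λ)
    {O : Set (Coord g × Coord g)} (hO : IsOpen O) (hO' : ∀ p ∈ O, p.1 ∈ φ.1.target) :
    IsOpen (XHat.param φ '' O) := by
  refine XHat.isOpen_iff.2 fun ψ => ?_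
  have ho : IsOpen {p : Coord g × Coord g | p.1 ∈ ψ.1.target ∧ ψ.1.symm p.1 ∈ φ.1.source} :=
    (isOpen_transition_domain ψ.1 φ.1).preimage continuous_fst
  have key : {p : Coord g × Coord g | p.1 ∈ ψ.1.target ∧ XHat.param ψ p ∈ XHat.param φ '' O} =
      ⋃ n ∈ intLattice g, {p | (p.1 ∈ ψ.1.target ∧ ψ.1.symm p.1 ∈ φ.1.source) ∧
        (φ.1 (ψ.1.symm p.1), wcoord φ.1 (ψ.1.symm p.1) (tan ψ.1 p.1 p.2) + n) ∈ O} := by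
    ext p
    simp only [mem_iUnion, mem_ofPred_eq, mem_image, exists_prop]
    constructor
    · rintro ⟨hp, q, hq, hqp⟩
      have hb : φ.1.symm q.1 = ψ.1.symm p.1 := congrArg Sigma.fst hqp
      have hbs : ψ.1.symm p.1 ∈ φ.1.source := hb ▸ φ.1.map_target (hO' q hq)
      have h1 : XHat.param φ q = XHat.param φ
          (φ.1 (ψ.1.symm p.1), wcoord φ.1 (ψ.1.symm p.1) (tan ψ.1 p.1 p.2)) := by
        rw [hqp, ← XHat.mk_eq_param φ hbs]
        rfl
      rw [XHat.param_eq_param φ (hO' q hq) (φ.1.map_source hbs)] at h1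
      refine ⟨_, neg_mem h1.2, ⟨hp, hbs⟩, ?_⟩
      convert hq using 1
      refine Prod.ext h1.1.symm ?_
      simp
    · rintro ⟨n, hn, ⟨hp, hbs⟩, hO1⟩
      refine ⟨hp, _, hO1, ?_⟩
      have h1 : XHat.param ψ p = XHat.param φ
          (φ.1 (ψ.1.symm p.1), wcoord φ.1 (ψ.1.symm p.1) (tan ψ.1 p.1 p.2)) := by
        rw [← XHat.mk_eq_param φ hbs]
        rfl
      rw [h1, XHat.param_eq_param φ (φ.1.map_source hbs) (φ.1.map_source hbs)]
      refine ⟨rfl, ?_⟩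
      simpa using hn
  rw [key]
  refine isOpen_biUnion fun n _ => ?_
  refine ContinuousOn.isOpen_inter_preimage (f := fun p : Coord g × Coord g =>
    (φ.1 (ψ.1.symm p.1), wcoord φ.1 (ψ.1.symm p.1) (tan ψ.1 p.1 p.2) + n)) ?_ ho hO
  refine ContinuousOn.prodMk ?_ ?_
  · exact (contDiffOn_transition ψ.2.1 φ.2.1).continuousOn.comp continuous_fst.continuousOn
      fun p hp => hp
  · exact (contDiffOn_wcoord_tan ψ.2.1 φ.2.1).continuousOn.add continuousOn_const

end Topology

section Rational

variable {g : ℕ}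

/-- A subspace of `ℝ^g` is rational if it is spanned by integral vectors. -/
def IsRational (W : Submodule ℝ (Coord g)) : Prop :=
  Submodule.span ℝ ((W : Set (Coord g)) ∩ (intLattice g : Set (Coord g))) = W

theorem countable_intLattice : (intLattice g : Set (Coord g)).Countable :=
  (countable_range fun n : Fin g → ℤ => (WithLp.toLp 2 fun j => (n j : ℝ) : Coord g)).mono
    fun _ h => h.imp fun _ hn => hn.symm

theorem finite_intLattice_inter_closedBall (R : ℝ) :
    ((intLattice g : Set (Coord g)) ∩ Metric.closedBall 0 R).Finite := by
  have hf : (Set.pi univ fun _ : Fin g => Set.Icc (-⌈R⌉) ⌈R⌉ : Set (Fin g → ℤ)).Finite :=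
    Set.Finite.pi fun _ => Set.finite_Icc _ _
  refine (hf.image fun n : Fin g → ℤ => (WithLp.toLp 2 fun j => (n j : ℝ) : Coord g)).subset ?_
  rintro _ ⟨⟨n, rfl⟩, hn⟩
  refine ⟨n, fun j _ => ?_, rfl⟩
  have h1 : |(n j : ℝ)| ≤ R := by
    have := (PiLp.norm_apply_le (WithLp.toLp 2 fun j => (n j : ℝ) : Coord g) j).trans
      (mem_closedBall_zero_iff.1 hn)
    simpa using this
  have h2 := (abs_le.1 h1)
  constructor
  · have : (-(n j) : ℝ) ≤ ⌈R⌉ := by linarith [Int.le_ceil R]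
    have : -(n j) ≤ ⌈R⌉ := by exact_mod_cast this
    linarith
  · have : (n j : ℝ) ≤ ⌈R⌉ := by linarith [Int.le_ceil R]
    exact_mod_cast this

theorem IsRational.exists_basis {W : Submodule ℝ (Coord g)} (hW : IsRational W) {m : ℕ}
    (hm : Module.finrank ℝ W = m) : ∃ l : Fin m → Coord g, (∀ j, l j ∈ W) ∧
      (∀ j, l j ∈ intLattice g) ∧ LinearIndependent ℝ l ∧ Submodule.span ℝ (range l) = W := by
  obtain ⟨b, hb, hspan, hli⟩ :=
    exists_linearIndependent ℝ ((W : Set (Coord g)) ∩ (intLattice g : Set (Coord g)))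
  rw [hW] at hspan
  have hfin : b.Finite := hli.setFinite
  have := hfin.fintype
  have hcard : Fintype.card b = m := by
    rw [← hm, ← hspan, finrank_span_set_eq_card hli, Set.toFinset_card]
  let e := (Fintype.equivFinOfCardEq hcard).symm
  refine ⟨fun j => (e j : Coord g), fun j => (hb (e j).2).1, fun j => (hb (e j).2).2,
    hli.comp e e.injective, ?_⟩
  have : range (fun j => (e j : Coord g)) = b := by
    rw [show (fun j => (e j : Coord g)) = Subtype.val ∘ e from rfl, e.surjective.range_comp,
      Subtype.range_coe]
  rw [this, hspan]

theorem countable_isRational : {W : Submodule ℝ (Coord g) | IsRational W}.Countable := by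
  have : Countable (intLattice g) := countable_intLattice.to_subtype
  refine (countable_iUnion fun m : ℕ => countable_range fun l : Fin m → intLattice g =>
    Submodule.span ℝ (range fun j => (l j : Coord g))).mono ?_
  intro W hW
  obtain ⟨l, -, hl, -, hspan⟩ := hW.exists_basis rfl
  exact mem_iUnion.2 ⟨_, fun j => ⟨l j, hl j⟩, hspan⟩

theorem mem_of_starProjection_orthogonal_eq_zero {W : Submodule ℝ (Coord g)} {x : Coord g}
    (h : Wᗮ.starProjection x = 0) : x ∈ W := by
  rw [Submodule.starProjection_apply_eq_zero_iff, Submodule.orthogonal_orthogonal] at h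
  exact h

theorem starProjection_orthogonal_of_mem {W : Submodule ℝ (Coord g)} {x : Coord g}
    (h : x ∈ W) : Wᗮ.starProjection x = 0 := by
  rwa [Submodule.starProjection_apply_eq_zero_iff, Submodule.orthogonal_orthogonal]

theorem IsRational.exists_norm_lt_imp_mem {W : Submodule ℝ (Coord g)} (hW : IsRational W) :
    ∃ ε > 0, ∀ n ∈ intLattice g, ‖Wᗮ.starProjection n‖ < ε → n ∈ W := by
  obtain ⟨l, hlW, hl, -, hspan⟩ := hW.exists_basis rfl
  set R : ℝ := ∑ j, ‖l j‖ + 1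
  have hfin := (finite_intLattice_inter_closedBall (g := g) R).subset
    (inter_subset_left (t := {n : Coord g | n ∉ W}))
  have h1 : ∀ᶠ ε in 𝓝[>] (0 : ℝ), ∀ n ∈ (intLattice g : Set (Coord g)) ∩ Metric.closedBall 0 R ∩
      {n : Coord g | n ∉ W}, ε < ‖Wᗮ.starProjection n‖ := by
    rw [eventually_all_finite hfin]
    intro n hn
    have : 0 < ‖Wᗮ.starProjection n‖ :=
      norm_pos_iff.2 fun h => hn.2 (mem_of_starProjection_orthogonal_eq_zero h)
    exact mem_nhdsWithin_of_mem_nhds (Iio_mem_nhds this)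
  obtain ⟨ε, ⟨hε, hε1⟩, hε0⟩ := (h1.and
    (mem_nhdsWithin_of_mem_nhds (Iio_mem_nhds one_pos))).and self_mem_nhdsWithin |>.exists
  refine ⟨ε, hε0, fun n hn hlt => ?_⟩
  obtain ⟨c, hc⟩ : ∃ c : Fin _ → ℝ, ∑ j, c j • l j = W.starProjection n := by
    have : W.starProjection n ∈ Submodule.span ℝ (range l) := by
      rw [hspan]; exact W.starProjection_apply_mem n
    exact Submodule.mem_span_range_iff_exists_fun ℝ |>.1 this
  set k : Coord g := ∑ j, ⌊c j⌋ • l j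
  have hkW : k ∈ W := sum_mem fun j _ => zsmul_mem (hlW j) _
  have hk : k ∈ intLattice g := sum_mem fun j _ => zsmul_mem (hl j) _
  have hproj : Wᗮ.starProjection (n - k) = Wᗮ.starProjection n := by
    rw [map_sub, starProjection_orthogonal_of_mem hkW, sub_zero]
  have hnorm : ‖n - k‖ ≤ R := by
    have e1 : n - k = ∑ j, Int.fract (c j) • l j + Wᗮ.starProjection n := by
      have e2 : n = W.starProjection n + Wᗮ.starProjection n := by simp
      conv_lhs => rw [e2, ← hc]
      simp only [k, ← Int.self_sub_floor, sub_smul, Finset.sum_sub_distrib, Int.cast_smul_eq_zsmul]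
      abel
    rw [e1]
    refine (norm_add_le _ _).trans (add_le_add ((norm_sum_le _ _).trans
      (Finset.sum_le_sum fun j _ => ?_)) (hlt.le.trans (le_of_lt hε1)))
    rw [norm_smul, Real.norm_of_nonneg (Int.fract_nonneg _)]
    exact mul_le_of_le_one_left (norm_nonneg _) (Int.fract_lt_one _).le
  by_contra hnW
  have := hε (n - k) ⟨⟨sub_mem hn hk, mem_closedBall_zero_iff.2 hnorm⟩,
    fun h => hnW (by simpa using add_mem h hkW)⟩
  rw [hproj] at this
  linarith

/-- A curve in a translate of `W + ℤ^g`, for rational `W`, stays in a translate of `W`. -/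
theorem IsRational.eventually_mem {W : Submodule ℝ (Coord g)} (hW : IsRational W) {Y : Type*}
    {l : Filter Y} {γ : Y → Coord g} {y : Coord g} (hγ : Tendsto γ l (𝓝 y))
    (h : ∀ᶠ t in l, ∃ n ∈ intLattice g, γ t - y - n ∈ W) : ∀ᶠ t in l, γ t - y ∈ W := by
  obtain ⟨ε, hε, H⟩ := hW.exists_norm_lt_imp_mem
  have h1 : Tendsto (fun t => ‖Wᗮ.starProjection (γ t - y)‖) l (𝓝 0) := by
    have : Tendsto (fun t => ‖Wᗮ.starProjection (γ t - y)‖) l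
        (𝓝 ‖Wᗮ.starProjection (y - y)‖) :=
      ((Wᗮ.starProjection.continuous.tendsto _).comp (hγ.sub_const y)).norm
    simpa using this
  filter_upwards [h, h1.eventually_lt_const hε] with t ⟨n, hn, hnW⟩ ht
  have h2 : Wᗮ.starProjection (γ t - y) = Wᗮ.starProjection n := by
    rw [← sub_eq_zero, ← map_sub]
    exact starProjection_orthogonal_of_mem hnW
  rw [h2] at ht
  simpa using add_mem hnW (H n hn ht)

theorem IsRational.deriv_mem {W : Submodule ℝ (Coord g)} (hW : IsRational W) {γ : ℝ → Coord g}
    {v : Coord g} (hγ : HasDerivAt γ v 0)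
    (h : ∀ᶠ t in 𝓝 (0 : ℝ), ∃ n ∈ intLattice g, γ t - γ 0 - n ∈ W) : v ∈ W := by
  have h1 := hW.eventually_mem hγ.continuousAt h
  have h2 : HasDerivAt (fun t => Wᗮ.starProjection (γ t)) (Wᗮ.starProjection v) 0 :=
    Wᗮ.starProjection.hasFDerivAt.comp_hasDerivAt 0 hγ
  have h3 : (fun t => Wᗮ.starProjection (γ t)) =ᶠ[𝓝 0] fun _ => Wᗮ.starProjection (γ 0) := by
    filter_upwards [h1] with t ht
    rw [← sub_eq_zero, ← map_sub]
    exact starProjection_orthogonal_of_mem ht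
  exact mem_of_starProjection_orthogonal_eq_zero
    (h2.unique ((hasDerivAt_const 0 _).congr_of_eventuallyEq h3))

end Rational

section Parametrization

/-- Local parametrizations of a submanifold. -/
theorem IsSubmanifold.exists_parametrization {V : Type*} [NormedAddCommGroup V] [NormedSpace ℝ V]
    {d : ℕ} {M : Set V} (hM : IsSubmanifold ℝ ∞ d M) {p : V} (hp : p ∈ M) :
    ∃ (F : Submodule ℝ V) (ψ : F → V) (O : Set F) (q₀ : F), Module.finrank ℝ F = d ∧ IsOpen O ∧
      q₀ ∈ O ∧ ψ q₀ = p ∧ ContDiffOn ℝ ∞ ψ O ∧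
      (∀ q ∈ O, ψ q ∈ M ∧ Function.Injective (fderiv ℝ ψ q)) ∧
      ∀ O' ∈ 𝓝 q₀, ∀ᶠ p' in 𝓝 p, p' ∈ M → ∃ q ∈ O', ψ q = p' := by
  obtain ⟨Φ, F, hpΦ, hΦ, hΦs, hF, hMF⟩ := hM p hp
  have hq : Φ p ∈ Φ.target ∩ (F : Set V) := hMF ▸ mem_image_of_mem Φ ⟨hp, hpΦ⟩
  set O : Set F := {q | (q : V) ∈ Φ.target}
  have hO : IsOpen O := Φ.open_target.preimage continuous_subtype_val
  have hψ : ContDiffOn ℝ ∞ (fun q : F => Φ.symm (q : V)) O :=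
    hΦs.comp F.subtypeL.contDiff.contDiffOn fun q hq => hq
  refine ⟨F, fun q => Φ.symm q, O, ⟨Φ p, hq.2⟩, hF, hO, hq.1, Φ.left_inv hpΦ, hψ, ?_, ?_⟩
  · intro q hq
    constructor
    · obtain ⟨p', hp', hpq⟩ : (q : V) ∈ Φ '' (M ∩ Φ.source) := hMF ▸ ⟨hq, q.2⟩
      change Φ.symm q ∈ M
      rw [← hpq, Φ.left_inv hp'.2]
      exact hp'.1
    · have h1 : DifferentiableAt ℝ (fun q : F => Φ.symm (q : V)) q :=
        (hψ.contDiffAt (hO.mem_nhds hq)).differentiableAt (by simp)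
      have h2 : DifferentiableAt ℝ Φ (Φ.symm q) :=
        (hΦ.contDiffAt (Φ.open_source.mem_nhds (Φ.map_target hq))).differentiableAt (by simp)
      have h3 : HasFDerivAt (fun q : F => Φ (Φ.symm (q : V)))
          ((fderiv ℝ Φ (Φ.symm q)).comp (fderiv ℝ (fun q : F => Φ.symm (q : V)) q)) q :=
        h2.hasFDerivAt.comp q h1.hasFDerivAt
      have h4 : HasFDerivAt (fun q : F => Φ (Φ.symm (q : V))) F.subtypeL q := by
        refine F.subtypeL.hasFDerivAt.congr_of_eventuallyEq ?_
        filter_upwards [hO.mem_nhds hq] with q' hq'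
        exact Φ.right_inv hq'
      have h5 := h3.unique h4
      intro u v huv
      have := congrArg (fderiv ℝ Φ (Φ.symm q)) huv
      simp only [← ContinuousLinearMap.comp_apply, h5] at this
      exact Subtype.ext this
  · intro O' hO'
    rw [nhds_subtype_eq_comap, mem_comap] at hO'
    obtain ⟨t, ht, htO⟩ := hO'
    filter_upwards [(Φ.continuousAt hpΦ).preimage_mem_nhds ht, Φ.open_source.mem_nhds hpΦ]
      with p' hp't hp's hp'M
    have : Φ p' ∈ Φ.target ∩ (F : Set V) := hMF ▸ mem_image_of_mem Φ ⟨hp'M, hp's⟩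
    exact ⟨⟨Φ p', this.2⟩, htO hp't, Φ.left_inv hp's⟩

theorem fderiv_mem_tangentVectors {E V : Type*} [NormedAddCommGroup V] [NormedSpace ℝ V]
    [NormedAddCommGroup E] [NormedSpace ℝ E] {M : Set V} {ψ : E → V} {O : Set E} (hO : IsOpen O)
    (hψ : DifferentiableOn ℝ ψ O) (hM : ∀ q ∈ O, ψ q ∈ M) {q : E} (hq : q ∈ O) (u : E) :
    fderiv ℝ ψ q u ∈ tangentVectors M (ψ q) := by
  have h1 : HasDerivAt (fun t : ℝ => q + t • u) u 0 := by
    simpa using ((hasDerivAt_id (0 : ℝ)).smul_const u).const_add q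
  have h0 : q + (0 : ℝ) • u = q := by simp
  refine ⟨fun t => ψ (q + t • u), by simp, ?_, ?_⟩
  · have := h1.continuousAt.preimage_mem_nhds (hO.mem_nhds (by rwa [h0]))
    filter_upwards [this] with t ht
    exact hM _ ht
  · have h2 : HasFDerivAt ψ (fderiv ℝ ψ q) (q + (0 : ℝ) • u) := by
      rw [h0]; exact (hψ.differentiableAt (hO.mem_nhds hq)).hasFDerivAt
    exact h2.comp_hasDerivAt 0 h1

/-- A continuous family of linear maps of constant rank, whose ranges belong to a countable set of
subspaces, has locally constant range. -/
theorem eventually_range_eq {F E : Type*} [NormedAddCommGroup F] [NormedSpace ℝ F]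
    [FiniteDimensional ℝ F] [NormedAddCommGroup E] [InnerProductSpace ℝ E]
    [FiniteDimensional ℝ E] {A : F → F →L[ℝ] E} {O : Set F} (hO : IsOpen O)
    (hA : ContinuousOn A O) {q₀ : F} (hq₀ : q₀ ∈ O) {C : Set (Submodule ℝ E)} (hC : C.Countable)
    (hAC : ∀ q ∈ O, (A q).range ∈ C) {k : ℕ} (hk : ∀ q ∈ O, Module.finrank ℝ (A q).range = k) :
    ∀ᶠ q in 𝓝 q₀, (A q).range = (A q₀).range := by
  set R := (A q₀).range with hR
  obtain ⟨j₀, hj₀⟩ := (A q₀).toLinearMap.rangeRestrict.exists_rightInverse_of_surjective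
    (LinearMap.range_rangeRestrict _)
  let j : R →L[ℝ] F := LinearMap.toContinuousLinearMap j₀
  have hj : ∀ v : R, A q₀ (j v) = v := fun v =>
    congrArg Subtype.val (congrArg (fun f : R →ₗ[ℝ] R => f v) hj₀)
  let H : F → R →L[ℝ] R := fun q => R.orthogonalProjectionOnto ∘L (A q ∘L j)
  have hH : ContinuousOn H O := by
    have : ContinuousOn (fun q => A q ∘L j) O := hA.clm_comp continuousOn_const
    exact continuousOn_const.clm_comp this
  have hH₀ : H q₀ = 1 := by
    ext v
    simp [H, hj]
  have hunit : ∀ᶠ q in 𝓝 q₀, IsUnit (H q) := by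
    have h1 : {x : R →L[ℝ] R | IsUnit x} ∈ 𝓝 (H q₀) :=
      (Units.isOpen (R := R →L[ℝ] R)).mem_nhds (by rw [hH₀]; exact isUnit_one)
    exact (hH.continuousAt (hO.mem_nhds hq₀)).preimage_mem_nhds h1
  obtain ⟨ρ, hρ, hball⟩ := Metric.mem_nhds_iff.1 (hunit.and (hO.mem_nhds hq₀))
  let G : F → R →L[ℝ] E := fun q => (A q ∘L j) ∘L Ring.inverse (H q)
  have hG : ContinuousOn G (Metric.ball q₀ ρ) := by
    refine (hA.mono fun q hq => (hball hq).2).clm_comp continuousOn_const |>.clm_comp ?_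
    intro q hq
    obtain ⟨⟨u, hu⟩, hqO⟩ := hball hq
    have h1 : ContinuousAt Ring.inverse (H q) := by
      rw [← hu]
      exact NormedRing.inverse_continuousAt (R := R →L[ℝ] R) u
    exact (h1.comp (hH.continuousAt (hO.mem_nhds hqO))).continuousWithinAt
  have hπG : ∀ q ∈ Metric.ball q₀ ρ, ∀ v, R.orthogonalProjectionOnto (G q v) = v := by
    intro q hq v
    have h1 := Ring.mul_inverse_cancel _ (hball hq).1
    exact congrArg (fun f : R →L[ℝ] R => f v) h1
  have hrange : ∀ q ∈ Metric.ball q₀ ρ, (G q).range = (A q).range := by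
    intro q hq
    have hle : (G q).range ≤ (A q).range := by
      rintro _ ⟨v, rfl⟩
      exact ⟨j (Ring.inverse (H q) v), rfl⟩
    refine Submodule.eq_of_le_of_finrank_eq hle ?_
    have hinj : Function.Injective (G q).toLinearMap := fun u v huv => by
      rw [← hπG q hq u, ← hπG q hq v]
      exact congrArg _ huv
    rw [hk q (hball hq).2, ← hk q₀ hq₀]
    exact LinearMap.finrank_range_of_inj hinj
  have hdet : ∀ q ∈ Metric.ball q₀ ρ, ∀ q' ∈ Metric.ball q₀ ρ, (A q).range = (A q').range →
      G q = G q' := by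
    intro q hq q' hq' h
    ext v
    have h1 : G q v ∈ (G q').range := by
      rw [hrange q' hq', ← h, ← hrange q hq]
      exact ⟨v, rfl⟩
    obtain ⟨v', hv'⟩ := h1
    have h2 : v' = v := by
      rw [← hπG q' hq' v', ← hπG q hq v]
      exact congrArg _ hv'
    rw [← hv', h2]
    rfl
  have hcount : (G '' Metric.ball q₀ ρ).Countable := by
    refine MapsTo.countable_of_injOn (f := fun f : R →L[ℝ] E => f.range) (t := C) ?_ ?_ hC
    · rintro _ ⟨q, hq, rfl⟩
      change (G q).range ∈ C
      rw [hrange q hq]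
      exact hAC q (hball hq).2
    · rintro _ ⟨q, hq, rfl⟩ _ ⟨q', hq', rfl⟩ h
      refine hdet q hq q' hq' ?_
      rw [← hrange q hq, ← hrange q' hq']
      exact h
  have hsub : (G '' Metric.ball q₀ ρ).Subsingleton :=
    hcount.isTotallyDisconnected _ subset_rfl
      ((convex_ball q₀ ρ).isPreconnected.image G hG)
  filter_upwards [Metric.ball_mem_nhds q₀ hρ] with q hq
  rw [hR, ← hrange q hq, ← hrange q₀ (Metric.mem_ball_self hρ),
    hsub (mem_image_of_mem G hq) (mem_image_of_mem G (Metric.mem_ball_self hρ))]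

end Parametrization

section LocalStructure

variable {g : ℕ} {M : Set (Coord g × Coord g)} {W : Submodule ℝ (Coord g)} {m : ℕ}

/-- The fibre of `M` through `p` is a translate of `W + ℤ^g`. -/
def HasDirection (M : Set (Coord g × Coord g)) (W : Submodule ℝ (Coord g))
    (p : Coord g × Coord g) : Prop :=
  ∀ y, (p.1, y) ∈ M ↔ ∃ n ∈ intLattice g, y - p.2 - n ∈ W

theorem HasDirection.translate {p : Coord g × Coord g} (h : HasDirection M W p) {y : Coord g}
    (hy : (p.1, y) ∈ M) : HasDirection M W (p.1, y) := by
  obtain ⟨n, hn, hnW⟩ := (h y).1 hy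
  intro y'
  rw [h y']
  constructor
  · rintro ⟨k, hk, hkW⟩
    refine ⟨k - n, sub_mem hk hn, ?_⟩
    convert sub_mem hkW hnW using 1
    abel
  · rintro ⟨k, hk, hkW⟩
    refine ⟨k + n, add_mem hk hn, ?_⟩
    convert add_mem hkW hnW using 1
    dsimp only
    abel

theorem HasDirection.mk_mem_tangentVectors {p : Coord g × Coord g} (h : HasDirection M W p)
    {w : Coord g} (hw : w ∈ W) : ((0, w) : Coord g × Coord g) ∈ tangentVectors M p := by
  refine ⟨fun t => (p.1, p.2 + t • w), by simp, Eventually.of_forall fun t => ?_, ?_⟩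
  · exact (h _).2 ⟨0, zero_mem _, by simpa using W.smul_mem t hw⟩
  · refine (hasDerivAt_const (0 : ℝ) p.1).prodMk ?_
    simpa using ((hasDerivAt_id (0 : ℝ)).smul_const w).const_add p.2

theorem HasDirection.snd_mem {p : Coord g × Coord g} (hW : IsRational W) (h : HasDirection M W p)
    {u : Coord g × Coord g} (hu : u ∈ tangentVectors (M ∩ {q | q.1 = p.1}) p) : u.2 ∈ W := by
  obtain ⟨γ, hγ0, hγ, hγ'⟩ := hu
  refine hW.deriv_mem (γ := fun t => (γ t).2) (hγ'.snd) ?_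
  filter_upwards [hγ] with t ht
  rw [hγ0]
  refine (h _).1 ?_
  rw [← ht.2]
  exact ht.1

theorem finrank_orthogonal_eq (hm : Module.finrank ℝ W = m) : Module.finrank ℝ Wᗮ = g - m := by
  have := W.finrank_add_finrank_orthogonal
  rw [hm, finrank_euclideanSpace_fin] at this
  omega

theorem range_fst_comp_eq
    (hiso : ∀ p ∈ M, ∀ u ∈ tangentVectors M p, ∀ v ∈ tangentVectors M p, symplecticForm u v = 0)
    (hclean : ∀ p ∈ M, ∀ u ∈ tangentVectors M p, u.1 = 0 →
      u ∈ tangentVectors (M ∩ {q | q.1 = p.1}) p)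
    {F : Type*} [NormedAddCommGroup F] [NormedSpace ℝ F] [FiniteDimensional ℝ F]
    (hF : Module.finrank ℝ F = g) {p : Coord g × Coord g} (hp : p ∈ M) (hW : IsRational W)
    (hm : Module.finrank ℝ W = m) (h : HasDirection M W p) {T : F →L[ℝ] Coord g × Coord g}
    (hT : Function.Injective T) (hTM : ∀ u, T u ∈ tangentVectors M p) :
    (ContinuousLinearMap.fst ℝ (Coord g) (Coord g) ∘L T).range = Wᗮ := by
  set A := ContinuousLinearMap.fst ℝ (Coord g) (Coord g) ∘L T
  have hle : A.range ≤ Wᗮ := by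
    rintro _ ⟨u, rfl⟩
    rw [Submodule.mem_orthogonal']
    intro w hw
    have := hiso p hp _ (hTM u) _ (h.mk_mem_tangentVectors hw)
    simpa [symplecticForm, A] using this
  have hker : Module.finrank ℝ A.ker ≤ m := by
    have hmem : ∀ u : A.ker, (T u).2 ∈ W := fun u =>
      h.snd_mem hW (hclean p hp _ (hTM u) u.2)
    let f : A.ker →ₗ[ℝ] W :=
      ((LinearMap.snd ℝ (Coord g) (Coord g) ∘ₗ T.toLinearMap) ∘ₗ A.ker.subtype).codRestrict W hmem
    rw [← hm]
    refine LinearMap.finrank_le_finrank_of_injective (f := f) fun u v huv => ?_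
    refine Subtype.ext (hT (Prod.ext ?_ (congrArg Subtype.val huv)))
    have h1 : (T u).1 = 0 := u.2
    have h2 : (T v).1 = 0 := v.2
    rw [h1, h2]
  refine Submodule.eq_of_le_of_finrank_le hle ?_
  have h1 := A.toLinearMap.finrank_range_add_finrank_ker
  rw [finrank_orthogonal_eq hm]
  rw [hF] at h1
  omega

/-- Near each of its points, a clean Lagrangian submanifold with rational fibres lies over an affine
subspace and has fibres of constant direction, and it has a local section over the subspace. -/
theorem local_direction_and_section
    (hsub : IsSubmanifold ℝ ∞ g M)
    (hiso : ∀ p ∈ M, ∀ u ∈ tangentVectors M p, ∀ v ∈ tangentVectors M p, symplecticForm u v = 0)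
    (hclean : ∀ p ∈ M, ∀ u ∈ tangentVectors M p, u.1 = 0 →
      u ∈ tangentVectors (M ∩ {q | q.1 = p.1}) p)
    (hfib : ∀ p ∈ M, ∃ W, IsRational W ∧ Module.finrank ℝ W = m ∧ HasDirection M W p)
    {p : Coord g × Coord g} (hp : p ∈ M) (hW : IsRational W)
    (hm : Module.finrank ℝ W = m) (h : HasDirection M W p) :
    (∀ᶠ p' in 𝓝 p, p' ∈ M → p'.1 - p.1 ∈ Wᗮ ∧ HasDirection M W p') ∧
    ∃ r > 0, ∃ s : Coord g → Coord g, ContDiffOn ℝ ∞ s (Metric.ball 0 r) ∧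
      ∀ v ∈ Wᗮ, ‖v‖ < r → (p.1 + v, s v) ∈ M := by
  obtain ⟨F, ψ, O, q₀, hF, hO, hq₀, hψ₀, hψ, hψM, hψsurj⟩ := hsub.exists_parametrization hp
  have hψd : ∀ q ∈ O, HasFDerivAt ψ (fderiv ℝ ψ q) q := fun q hq =>
    ((hψ.contDiffAt (hO.mem_nhds hq)).differentiableAt (by simp)).hasFDerivAt
  set A : F → F →L[ℝ] Coord g := fun q => ContinuousLinearMap.fst ℝ _ _ ∘L fderiv ℝ ψ q with hAdef
  have hA : ContinuousOn A O :=
    (continuousOn_const (c := ContinuousLinearMap.fst ℝ (Coord g) (Coord g))).clm_comp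
      (hψ.continuousOn_fderiv_of_isOpen hO (by simp))
  have hrange : ∀ q ∈ O, ∀ W', IsRational W' → Module.finrank ℝ W' = m →
      HasDirection M W' (ψ q) → (A q).range = W'ᗮ := fun q hq W' hW' hm' h' =>
    range_fst_comp_eq hiso hclean hF (hψM q hq).1 hW' hm' h' (hψM q hq).2
      (fderiv_mem_tangentVectors hO (hψ.differentiableOn (by simp)) (fun q hq => (hψM q hq).1) hq)
  have hA₀ : (A q₀).range = Wᗮ := hrange q₀ hq₀ W hW hm (hψ₀ ▸ h)
  have hev : ∀ᶠ q in 𝓝 q₀, (A q).range = (A q₀).range := by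
    refine eventually_range_eq hO hA hq₀ (countable_isRational.image fun W' => W'ᗮ) ?_
      (k := g - m) ?_
    · intro q hq
      obtain ⟨W', hW', hm', h'⟩ := hfib _ (hψM q hq).1
      exact ⟨W', hW', (hrange q hq W' hW' hm' h').symm⟩
    · intro q hq
      obtain ⟨W', hW', hm', h'⟩ := hfib _ (hψM q hq).1
      rw [hrange q hq W' hW' hm' h', finrank_orthogonal_eq hm']
  obtain ⟨ρ, hρ, hball⟩ := Metric.mem_nhds_iff.1 (hev.and (hO.mem_nhds hq₀))
  have hx : ∀ q ∈ Metric.ball q₀ ρ, (ψ q).1 - p.1 ∈ Wᗮ := by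
    intro q hq
    have hd : ∀ q ∈ Metric.ball q₀ ρ,
        HasFDerivAt (𝕜 := ℝ) (fun q => W.starProjection (ψ q).1) 0 q := by
      intro q hq
      have h1 : HasFDerivAt (fun q => (ψ q).1) (A q) q := (hψd q (hball hq).2).fst
      have h2 : HasFDerivAt (fun q => W.starProjection (ψ q).1) (W.starProjection ∘L A q) q :=
        W.starProjection.hasFDerivAt.comp q h1
      refine h2.congr_fderiv ?_
      ext1 u
      have h3 : A q u ∈ Wᗮ := by
        rw [← hA₀, ← (hball hq).1]
        exact ⟨u, rfl⟩
      exact ((Submodule.starProjection_apply_eq_zero_iff W).2 h3)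
    have h1 := (convex_ball q₀ ρ).is_const_of_fderivWithin_eq_zero (𝕜 := ℝ)
      (f := fun q => W.starProjection (ψ q).1)
      (fun q hq => (hd q hq).differentiableAt.differentiableWithinAt)
      (fun q hq => by
        rw [fderivWithin_of_isOpen Metric.isOpen_ball hq]
        exact (hd q hq).fderiv)
      hq (Metric.mem_ball_self hρ)
    rw [hψ₀, ← sub_eq_zero, ← map_sub, Submodule.starProjection_apply_eq_zero_iff] at h1
    exact h1
  refine ⟨?_, ?_⟩
  · filter_upwards [hψsurj _ (Metric.ball_mem_nhds q₀ hρ)] with p' hp' hp'M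
    obtain ⟨q, hq, rfl⟩ := hp' hp'M
    refine ⟨hx q hq, ?_⟩
    obtain ⟨W', hW', hm', h'⟩ := hfib _ hp'M
    have : W'ᗮ = Wᗮ := by
      rw [← hrange q (hball hq).2 W' hW' hm' h', (hball hq).1, hA₀]
    have : W' = W := by
      rw [← Submodule.orthogonal_orthogonal W', this, Submodule.orthogonal_orthogonal]
    exact this ▸ h'
  · obtain ⟨j, hj⟩ : ∃ j : Wᗮ →L[ℝ] F, ∀ v : Wᗮ, A q₀ (j v) = v := by
      obtain ⟨j₀, hj₀⟩ := (A q₀).toLinearMap.rangeRestrict.exists_rightInverse_of_surjective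
        (LinearMap.range_rangeRestrict _)
      rw [← hA₀]
      exact ⟨LinearMap.toContinuousLinearMap j₀, fun v =>
        congrArg Subtype.val (congrArg (fun f : _ →ₗ[ℝ] (A q₀).range => f v) hj₀)⟩
    let i : Wᗮ → F := fun v => q₀ + j v
    have hi : ContDiff ℝ ∞ i := contDiff_const.add j.contDiff
    have hi' : ∀ v, HasFDerivAt i j v := fun v => j.hasFDerivAt.const_add q₀
    have hi0 : i 0 = q₀ := by simp [i]
    set O₁ : Set Wᗮ := i ⁻¹' Metric.ball q₀ ρ
    have hO₁ : IsOpen O₁ := Metric.isOpen_ball.preimage hi.continuous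
    have h0O₁ : (0 : Wᗮ) ∈ O₁ := by
      change i 0 ∈ Metric.ball q₀ ρ
      rw [hi0]; exact Metric.mem_ball_self hρ
    let P : Coord g →L[ℝ] Wᗮ := Wᗮ.orthogonalProjectionOnto
    let k : Wᗮ → Wᗮ := fun v => P ((ψ (i v)).1 - p.1)
    have hψi : ContDiffOn ℝ ∞ (fun v => ψ (i v)) O₁ :=
      hψ.comp hi.contDiffOn fun v hv => (hball hv).2
    have hk : ContDiffOn ℝ ∞ k O₁ :=
      P.contDiff.comp_contDiffOn ((contDiff_fst.comp_contDiffOn hψi).sub contDiffOn_const)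
    have hk0 : k 0 = 0 := by simp [k, hi0, hψ₀]
    have hkat : ∀ v ∈ O₁, ContDiffAt ℝ ∞ k v := fun v hv => hk.contDiffAt (hO₁.mem_nhds hv)
    have hk' : HasFDerivAt k (ContinuousLinearMap.id ℝ Wᗮ) 0 := by
      have h1 : HasFDerivAt (fun v => (ψ (i v)).1) (A q₀ ∘L j) 0 := by
        have := (hψd (i 0) (hi0 ▸ hq₀)).fst.comp (0 : Wᗮ) (hi' 0)
        rw [hi0] at this
        exact this
      have h2 := P.hasFDerivAt.comp (0 : Wᗮ) (h1.sub_const p.1)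
      refine HasFDerivAt.congr_fderiv (f' := P ∘L (A q₀ ∘L j)) h2 ?_
      ext1 v
      simp [P, hj]
    have hk'1 : fderiv ℝ k 0 = 1 := hk'.fderiv
    let e := (hkat 0 h0O₁).toOpenPartialHomeomorph k
      (f' := ContinuousLinearEquiv.refl ℝ Wᗮ) hk' (by simp)
    have he0 : (0 : Wᗮ) ∈ e.source :=
      (hkat 0 h0O₁).mem_toOpenPartialHomeomorph_source _ _
    have het : (0 : Wᗮ) ∈ e.target := by
      have := e.map_source he0
      rwa [show e 0 = 0 from hk0] at this
    have hes : e.symm 0 = 0 := by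
      have := e.left_inv he0
      rwa [show e 0 = 0 from hk0] at this
    have hunit : ∀ᶠ v in 𝓝 (0 : Wᗮ), v ∈ O₁ ∧ IsUnit (fderiv ℝ k v) := by
      refine Filter.Eventually.and (hO₁.mem_nhds h0O₁) ?_
      have h1 : {x : Wᗮ →L[ℝ] Wᗮ | IsUnit x} ∈ 𝓝 (fderiv ℝ k 0) :=
        (Units.isOpen (R := Wᗮ →L[ℝ] Wᗮ)).mem_nhds (by rw [hk'1]; exact isUnit_one)
      exact ((hk.continuousOn_fderiv_of_isOpen hO₁ (by simp)).continuousAt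
        (hO₁.mem_nhds h0O₁)).preimage_mem_nhds h1
    have hev2 : ∀ᶠ v in 𝓝 (0 : Wᗮ), v ∈ e.target ∧ (e.symm v ∈ O₁ ∧
        IsUnit (fderiv ℝ k (e.symm v))) := by
      refine Filter.Eventually.and (e.open_target.mem_nhds het) ?_
      have h1 : Tendsto e.symm (𝓝 0) (𝓝 0) := by
        have := (e.continuousAt_symm het).tendsto
        rwa [hes] at this
      exact h1.eventually hunit
    obtain ⟨r, hr, hrball⟩ := Metric.mem_nhds_iff.1 hev2
    have hPr : ∀ v ∈ Metric.ball (0 : Coord g) r, P v ∈ Metric.ball (0 : Wᗮ) r := by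
      intro v hv
      rw [mem_ball_zero_iff] at hv ⊢
      exact (Submodule.norm_orthogonalProjectionOnto_apply_le _ v).trans_lt hv
    refine ⟨r, hr, fun v => (ψ (i (e.symm (P v)))).2, ?_, ?_⟩
    · intro v hv
      obtain ⟨h1, h2, h3⟩ := hrball (hPr v hv)
      obtain ⟨u, hu⟩ := h3
      have h4 : ContDiffAt ℝ ∞ e.symm (P v) := by
        refine e.contDiffAt_symm (f₀' := ContinuousLinearEquiv.unitsEquiv ℝ Wᗮ u) h1 ?_ (hkat _ h2)
        have h5 := ((hkat _ h2).differentiableAt (by simp)).hasFDerivAt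
        rw [← hu] at h5
        exact h5
      have h5 : ContDiffAt ℝ ∞ (fun v => ψ (i v)) (e.symm (P v)) :=
        hψi.contDiffAt (hO₁.mem_nhds h2)
      have h6 : ContDiffAt ℝ ∞ (fun v => ψ (i (e.symm (P v)))) v :=
        ContDiffAt.comp (g := fun v => ψ (i v)) (f := fun v => e.symm (P v)) v h5
          (h4.comp v P.contDiff.contDiffAt)
      exact (contDiff_snd.contDiffAt.comp v h6).contDiffWithinAt
    · intro v hv hvr
      have hPv : P v = ⟨v, hv⟩ :=
        Submodule.orthogonalProjectionOnto_mem_subspace_eq_self (⟨v, hv⟩ : Wᗮ)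
      obtain ⟨h1, h2, -⟩ := hrball (hPr v (mem_ball_zero_iff.2 hvr))
      have h3 : k (e.symm (P v)) = P v := e.right_inv h1
      have h4 := hx _ h2
      have h5 : (ψ (i (e.symm (P v)))).1 - p.1 = v := by
        have h6 : k (e.symm (P v)) = ⟨_, h4⟩ :=
          Submodule.orthogonalProjectionOnto_mem_subspace_eq_self (⟨_, h4⟩ : Wᗮ)
        exact (congrArg Subtype.val (h6.symm.trans (h3.trans hPv)))
      have h7 : (p.1 + v, (ψ (i (e.symm (P v)))).2) = ψ (i (e.symm (P v))) := by
        refine Prod.ext ?_ rfl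
        change p.1 + v = _
        exact (eq_add_of_sub_eq' h5).symm
      rw [h7]
      exact (hψM _ (hball h2).2).1

end LocalStructure

section Compactness

variable {g : ℕ}

/-- A periodic condition that holds near all points of a fibre holds on all nearby fibres. -/
theorem eventually_forall_of_periodic {Q : Coord g × Coord g → Prop} {x₀ : Coord g}
    (hQ : ∀ y, ∀ᶠ p in 𝓝 (x₀, y), Q p)
    (hper : ∀ x y, ∀ n ∈ intLattice g, Q (x, y) → Q (x, y + n)) :
    ∀ᶠ x in 𝓝 x₀, ∀ y, Q (x, y) := by
  have hK : IsCompact ((WithLp.toLp 2 : (Fin g → ℝ) → Coord g) ''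
      Set.pi univ fun _ => Icc (0 : ℝ) 1) :=
    (isCompact_univ_pi fun _ => isCompact_Icc).image (PiLp.continuous_toLp 2 _)
  filter_upwards [hK.eventually_forall_of_forall_eventually (P := fun x y => Q (x, y))
    (x₀ := x₀) fun y _ => hQ y] with x hx y
  set n : Coord g := WithLp.toLp 2 fun j => ((⌊y j⌋ : ℤ) : ℝ)
  have h1 := hper x _ n ⟨_, rfl⟩ (hx (WithLp.toLp 2 fun j => Int.fract (y j))
    ⟨fun j => Int.fract (y j), fun j _ => ⟨Int.fract_nonneg _, (Int.fract_lt_one _).le⟩, rfl⟩)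
  convert h1 using 2
  ext j
  simp [n]

end Compactness

section LocalModel

variable {g : ℕ} {B : Type*} [TopologicalSpace B] [ChartedSpace (Coord g) B]
  {Λ : LagrangianCovering g B}

/-- A description of `S` over a ball around `x₀` in an action chart: `S` lies over the affine
subspace `x₀ + Wᗮ`, and `z ↦ (x₀ + P_{Wᗮ} z, y z)` parametrizes it up to the lattice. -/
structure LocalModel (S : Set (X Λ)) (φ : ActionChart Λ) (m : ℕ) (x₀ : Coord g) where
  /-- the direction of the fibres -/
  W : Submodule ℝ (Coord g)
  /-- the radius of the ball -/
  r : ℝ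
  /-- the angle coordinates of the parametrization -/
  y : Coord g → Coord g
  rational : IsRational W
  finrank_eq : Module.finrank ℝ W = m
  r_pos : 0 < r
  ball_subset : Metric.ball x₀ r ⊆ φ.1.target
  contDiffOn : ContDiffOn ℝ ∞ y {z | ‖Wᗮ.starProjection z‖ < r}
  y_add : ∀ z, ∀ w ∈ W, y (z + w) = y z + w
  mem_iff : ∀ x ∈ Metric.ball x₀ r, ∀ y', X.param φ (x, y') ∈ S ↔
    ∃ z, ∃ n ∈ intLattice g, Wᗮ.starProjection z = x - x₀ ∧ y' = y z + n

variable {S : Set (X Λ)} {m : ℕ}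

theorem isOpen_notMem_chart (hS : IsClosed S) (φ : ActionChart Λ) :
    IsOpen {p : Coord g × Coord g | p.1 ∈ φ.1.target ∧ X.param φ p ∉ S} :=
  X.isOpen_iff.1 hS.isOpen_compl φ

variable [IsManifold (𝓡 g) ∞ B]

theorem param_add_mem_iff (φ : ActionChart Λ) {x y n : Coord g} (hx : x ∈ φ.1.target)
    (hn : n ∈ intLattice g) : X.param φ (x, y + n) = X.param φ (x, y) :=
  (X.param_eq_param φ hx hx).2 ⟨rfl, by simpa using hn⟩

theorem FibresAreSubtori.exists_hasDirection (hm : FibresAreSubtori S m) (φ : ActionChart Λ)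
    {p : Coord g × Coord g} (hp : p ∈ inChart S φ) :
    ∃ W, IsRational W ∧ Module.finrank ℝ W = m ∧ HasDirection (inChart S φ) W p := by
  obtain ⟨x, y⟩ := p
  have hx : x ∈ φ.1.target := hp.1
  set b := φ.1.symm x
  have hb : b ∈ φ.1.source := φ.1.map_target hx
  obtain ⟨α₀, W', hfin, hspan, hT⟩ := hm b ⟨_, hp.2⟩
  have hinj : Function.Injective (ycoordₗ φ.1 b) := fun α α' h => by
    rw [← cot_ycoord φ.2.1 hb α, ← cot_ycoord φ.2.1 hb α']
    exact congrArg _ h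
  have hmem : ∀ y', (x, y') ∈ inChart S φ ↔ ∃ w ∈ W'.map (ycoordₗ φ.1 b),
      y' - ycoord φ.1 b α₀ - w ∈ intLattice g := by
    intro y'
    have h1 : (x, y') ∈ inChart S φ ↔ (QuotientAddGroup.mk (cot φ.1 b y') : Cot g b ⧸ Λ.lattice b) ∈
        {q : Cot g b ⧸ Λ.lattice b | (⟨b, q⟩ : X Λ) ∈ S} :=
      ⟨fun h => h.2, fun h => ⟨hx, h⟩⟩
    rw [h1, hT]
    constructor
    · rintro ⟨a, ha, hay⟩
      refine ⟨ycoord φ.1 b a, ⟨a, ha, rfl⟩, ?_⟩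
      have h2 := QuotientAddGroup.eq.1 hay
      rw [mem_lattice_iff φ hb, ycoord_add, ycoord_cot φ.2.1 hb] at h2
      have h3 : ycoord φ.1 b (-(α₀ + a)) = -(ycoord φ.1 b α₀ + ycoord φ.1 b a) := by
        rw [← ycoord_add]; exact map_neg (ycoordₗ φ.1 b) _
      rw [h3] at h2
      convert h2 using 1
      abel
    · rintro ⟨_, ⟨a, ha, rfl⟩, hw⟩
      refine ⟨a, ha, QuotientAddGroup.eq.2 ?_⟩
      rw [mem_lattice_iff φ hb, ycoord_add, ycoord_cot φ.2.1 hb]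
      have h3 : ycoord φ.1 b (-(α₀ + a)) = -(ycoord φ.1 b α₀ + ycoord φ.1 b a) := by
        rw [← ycoord_add]; exact map_neg (ycoordₗ φ.1 b) _
      rw [h3]
      convert hw using 1
      change _ = y' - ycoord φ.1 b α₀ - ycoord φ.1 b a
      abel
  refine ⟨W'.map (ycoordₗ φ.1 b), ?_, ?_, ?_⟩
  · rw [IsRational]
    conv_rhs => rw [← hspan, Submodule.map_span]
    congr 1
    ext w
    constructor
    · rintro ⟨⟨a, ha, rfl⟩, hw⟩
      exact ⟨a, ⟨ha, (mem_lattice_iff φ hb).2 hw⟩, rfl⟩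
    · rintro ⟨a, ⟨ha, ha'⟩, rfl⟩
      exact ⟨⟨a, ha, rfl⟩, (mem_lattice_iff φ hb).1 ha'⟩
  · rw [← hfin]
    exact (W'.equivMapOfInjective _ hinj).finrank_eq.symm
  · obtain ⟨w, hw, hwn⟩ := (hmem y).1 hp
    intro y'
    rw [hmem y']
    constructor
    · rintro ⟨w', hw', hn⟩
      refine ⟨_, sub_mem hn hwn, ?_⟩
      convert sub_mem hw' hw using 1
      dsimp only
      abel
    · rintro ⟨n, hn, hn'⟩
      refine ⟨_, add_mem hn' hw, ?_⟩
      convert add_mem hn hwn using 1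
      dsimp only
      abel

theorem exists_localModel (hS : IsClosedLagrangian S) (hclean : IsFibrewiseClean S)
    (hm : FibresAreSubtori S m) (φ : ActionChart Λ) {x₀ y₀ : Coord g} (hx₀ : x₀ ∈ φ.1.target)
    (hy₀ : X.param φ (x₀, y₀) ∈ S) : Nonempty (LocalModel S φ m x₀) := by
  set M := inChart S φ
  have hp : (x₀, y₀) ∈ M := ⟨hx₀, hy₀⟩
  have hfib : ∀ p ∈ M, ∃ W, IsRational W ∧ Module.finrank ℝ W = m ∧ HasDirection M W p :=
    fun p hp => hm.exists_hasDirection φ hp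
  obtain ⟨W, hW, hWm, hdir⟩ := hfib _ hp
  have hloc : ∀ y, (x₀, y) ∈ M → _ := fun y hy =>
    local_direction_and_section (hS.isSubmanifold φ) (hS.isotropic φ) (hclean φ) hfib hy hW hWm
      (hdir.translate hy)
  have hev : ∀ᶠ x in 𝓝 x₀, ∀ y, (x, y) ∈ M → x - x₀ ∈ Wᗮ ∧ HasDirection M W (x, y) := by
    refine eventually_forall_of_periodic (Q := fun p => p ∈ M → p.1 - x₀ ∈ Wᗮ ∧ HasDirection M W p)
      ?_ ?_
    · intro y
      by_cases hy : (x₀, y) ∈ M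
      · exact (hloc y hy).1
      · have h1 : (x₀, y) ∈ {p : Coord g × Coord g | p.1 ∈ φ.1.target ∧ X.param φ p ∉ S} :=
          ⟨hx₀, fun h => hy ⟨hx₀, h⟩⟩
        filter_upwards [(isOpen_notMem_chart hS.isClosed φ).mem_nhds h1] with p hp hpM
        exact absurd hpM.2 hp.2
    · intro x y n hn hQ hM
      have h1 : (x, y) ∈ M := ⟨hM.1, param_add_mem_iff φ hM.1 hn ▸ hM.2⟩
      exact ⟨(hQ h1).1, (hQ h1).2.translate hM⟩
  obtain ⟨r₁, hr₁, s, hs, hsM⟩ := (hloc y₀ hp).2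
  obtain ⟨r₂, hr₂, hball⟩ := Metric.mem_nhds_iff.1 (hev.and (φ.1.open_target.mem_nhds hx₀))
  have hproj : ∀ z w, w ∈ W → Wᗮ.starProjection (z + w) = Wᗮ.starProjection z := fun z w hw => by
    rw [map_add, starProjection_orthogonal_of_mem hw, add_zero]
  refine ⟨⟨W, min r₁ r₂, fun z => s (Wᗮ.starProjection z) + W.starProjection z, hW, hWm,
    lt_min hr₁ hr₂, fun x hx => (hball (Metric.ball_subset_ball (min_le_right _ _) hx)).2,
    ?_, ?_, ?_⟩⟩
  · refine (hs.comp Wᗮ.starProjection.contDiff.contDiffOn ?_).add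
      W.starProjection.contDiff.contDiffOn
    intro z hz
    exact mem_ball_zero_iff.2 (lt_of_lt_of_le hz (min_le_left _ _))
  · intro z w hw
    simp only [hproj z w hw, map_add, W.starProjection_eq_self_iff.2 hw, add_assoc]
  · intro x hx y'
    obtain ⟨h1, hxt⟩ := hball (Metric.ball_subset_ball (min_le_right r₁ r₂) hx)
    have hxr : ‖x - x₀‖ < r₁ :=
      (mem_ball_iff_norm.1 hx).trans_le (min_le_left _ _)
    have hsx : x - x₀ ∈ Wᗮ → (x, s (x - x₀)) ∈ M := fun h => by
      simpa using hsM _ h hxr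
    constructor
    · intro hy'
      obtain ⟨h2, h3⟩ := h1 y' ⟨hxt, hy'⟩
      obtain ⟨n, hn, hnW⟩ := ((h1 _ (hsx h2)).2 y').1 ⟨hxt, hy'⟩
      refine ⟨x - x₀ + (y' - s (x - x₀) - n), n, hn, ?_, ?_⟩
      · rw [hproj _ _ hnW, Wᗮ.starProjection_eq_self_iff.2 h2]
      · have h4 : W.starProjection (x - x₀) = 0 :=
          (Submodule.starProjection_apply_eq_zero_iff _).2 h2
        simp only [hproj _ _ hnW, Wᗮ.starProjection_eq_self_iff.2 h2]
        rw [map_add, h4, W.starProjection_eq_self_iff.2 hnW]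
        abel
    · rintro ⟨z, n, hn, hz, rfl⟩
      have h2 : x - x₀ ∈ Wᗮ := hz ▸ Wᗮ.starProjection_apply_mem z
      refine (((h1 _ (hsx h2)).2 _).2 ⟨n, hn, ?_⟩).2
      simp only [hz]
      convert W.starProjection_apply_mem z using 1
      abel

end LocalModel

section Parallel

variable {g : ℕ} {B : Type*} [TopologicalSpace B] [ChartedSpace (Coord g) B]
  {Λ : LagrangianCovering g B} {S : Set (X Λ)} {m : ℕ}

theorem exists_mk_of_mem_proj {b : B} (h : b ∈ X.proj '' S) : ∃ α : Cot g b, X.mk α ∈ S := by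
  obtain ⟨⟨b', q⟩, hq, rfl⟩ := h
  obtain ⟨α, rfl⟩ := QuotientAddGroup.mk_surjective q
  exact ⟨α, hq⟩

theorem LocalModel.y_eq {φ : ActionChart Λ} {x₀ : Coord g} (D : LocalModel S φ m x₀)
    {z z' : Coord g} (h : D.Wᗮ.starProjection z = D.Wᗮ.starProjection z') :
    z - z' ∈ D.W ∧ D.y z = D.y z' + (z - z') := by
  have h1 : z - z' ∈ D.W :=
    mem_of_starProjection_orthogonal_eq_zero (by rw [map_sub, h, sub_self])
  refine ⟨h1, ?_⟩
  rw [← D.y_add _ _ h1, add_sub_cancel]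

theorem LocalModel.mem_iff_of_mem {φ : ActionChart Λ} {x₀ : Coord g} (D : LocalModel S φ m x₀)
    {x y₁ y₂ : Coord g} (hx : x ∈ Metric.ball x₀ D.r) (h : X.param φ (x, y₁) ∈ S) :
    X.param φ (x, y₂) ∈ S ↔ ∃ n ∈ intLattice g, y₂ - y₁ - n ∈ D.W := by
  obtain ⟨z₁, n₁, hn₁, hz₁, rfl⟩ := (D.mem_iff x hx y₁).1 h
  rw [D.mem_iff x hx]
  constructor
  · rintro ⟨z₂, n₂, hn₂, hz₂, rfl⟩
    obtain ⟨h1, h2⟩ := D.y_eq (hz₂.trans hz₁.symm)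
    refine ⟨n₂ - n₁, sub_mem hn₂ hn₁, ?_⟩
    rw [h2]
    convert h1 using 1
    abel
  · rintro ⟨n, hn, hW⟩
    refine ⟨z₁ + (y₂ - (D.y z₁ + n₁) - n), n + n₁, add_mem hn hn₁, ?_, ?_⟩
    · rw [map_add, starProjection_orthogonal_of_mem hW, add_zero, hz₁]
    · rw [D.y_add _ _ hW]
      abel

variable [IsManifold (𝓡 g) ∞ B]

theorem LocalModel.mem_vertTangent_iff {φ : ActionChart Λ} {x₀ : Coord g}
    (D : LocalModel S φ m x₀) {b : B} (hb : b ∈ φ.1.source) (hx : φ.1 b ∈ Metric.ball x₀ D.r)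
    {α : Cot g b} (hα : X.mk α ∈ S) {a : Cot g b} :
    a ∈ vertTangent S α ↔ ycoord φ.1 b a ∈ D.W := by
  have hα' := hα
  rw [X.mk_eq_param φ hb] at hα'
  constructor
  · rintro ⟨γ, hγ0, hγ, hγ'⟩
    refine D.rational.deriv_mem (hasDerivAt_ycoord hγ') ?_
    filter_upwards [hγ] with t ht
    have ht' : X.mk (γ t) ∈ S := ht
    rw [X.mk_eq_param φ hb, D.mem_iff_of_mem hx hα'] at ht'
    rw [hγ0]
    exact ht'
  · intro ha
    refine ⟨fun t => cot φ.1 b (ycoord φ.1 b α + t • ycoord φ.1 b a), ?_,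
      Eventually.of_forall fun t => ?_, ?_⟩
    · simp [cot_ycoord φ.2.1 hb]
    · change X.mk _ ∈ S
      rw [X.mk_eq_param φ hb, D.mem_iff_of_mem hx hα', ycoord_cot φ.2.1 hb]
      exact ⟨0, zero_mem _, by simpa using D.W.smul_mem t ha⟩
    · have h1 : HasDerivAt (fun t : ℝ => ycoord φ.1 b α + t • ycoord φ.1 b a)
          (ycoord φ.1 b a) 0 := by
        simpa using ((hasDerivAt_id (0 : ℝ)).smul_const (ycoord φ.1 b a)).const_add
          (ycoord φ.1 b α)
      have h2 := hasDerivAt_cot (φ := φ.1) (b := b) h1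
      rwa [cot_ycoord φ.2.1 hb a] at h2

theorem verticalTangentsParallel (hS : IsClosedLagrangian S) (hclean : IsFibrewiseClean S)
    (hm : FibresAreSubtori S m) : VerticalTangentsParallel S := by
  intro c hc hcS α hα β₀ hβ₀ β₁ hβ₁ h0
  let good : ℝ → Prop := fun t => ∀ β ∈ fibre S (c t), α t ∈ vertTangent S β
  have key : ∀ t₀ ∈ Icc (0 : ℝ) 1, ∃ (C : Prop), ∀ᶠ t in 𝓝[Icc 0 1] t₀,
      (∀ β ∈ fibre S (c t), α t ∈ vertTangent S β ↔ C) ∧ (good t ↔ C) := by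
    intro t₀ ht₀
    obtain ⟨φ, hφ, hb⟩ := Λ.exists_actionChart (c t₀)
    let φ' : ActionChart Λ := ⟨φ, hφ⟩
    obtain ⟨α₀, hα₀⟩ := exists_mk_of_mem_proj (hcS t₀ ht₀)
    rw [X.mk_eq_param φ' hb] at hα₀
    obtain ⟨D⟩ := exists_localModel hS hclean hm φ' (φ.map_source hb) hα₀
    obtain ⟨y, hy⟩ := hα φ' t₀ ht₀ hb
    refine ⟨y ∈ D.W, ?_⟩
    have hct : ContinuousWithinAt c (Icc 0 1) t₀ := hc.continuousOn t₀ ht₀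
    have h1 : ∀ᶠ t in 𝓝[Icc 0 1] t₀, c t ∈ φ.source := hct (φ.open_source.mem_nhds hb)
    have h2 : ∀ᶠ t in 𝓝[Icc 0 1] t₀, φ (c t) ∈ Metric.ball (φ (c t₀)) D.r :=
      ((φ.continuousAt hb).tendsto.comp hct) (Metric.ball_mem_nhds _ D.r_pos)
    filter_upwards [h1, h2, hy, self_mem_nhdsWithin] with t ht1 ht2 ht3 ht4
    have h3 : ∀ β ∈ fibre S (c t), α t ∈ vertTangent S β ↔ y ∈ D.W := by
      intro β hβ
      rw [D.mem_vertTangent_iff (φ := φ') ht1 ht2 hβ, ht3, ycoord_cot φ'.2.1 ht1]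
    refine ⟨h3, fun h => ?_, fun h β hβ => (h3 β hβ).2 h⟩
    obtain ⟨β, hβ⟩ := exists_mk_of_mem_proj (hcS t ht4)
    exact (h3 β hβ).1 (h β hβ)
  have hI0 : (0 : ℝ) ∈ Icc (0 : ℝ) 1 := ⟨le_rfl, zero_le_one⟩
  have hI1 : (1 : ℝ) ∈ Icc (0 : ℝ) 1 := ⟨zero_le_one, le_rfl⟩
  have hg0 : good 0 := by
    obtain ⟨C, hC⟩ := key 0 hI0
    obtain ⟨h1, h2⟩ := hC.self_of_nhdsWithin hI0
    exact h2.2 ((h1 β₀ hβ₀).1 h0)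
  have hg1 : good 0 ↔ good 1 := by
    refine isPreconnected_Icc.induction₂ (fun s t => good s ↔ good t) ?_ ?_ ?_ hI0 hI1
    · intro t₀ ht₀
      obtain ⟨C, hC⟩ := key t₀ ht₀
      have h1 := hC.self_of_nhdsWithin ht₀
      filter_upwards [hC] with t ht
      exact h1.2.trans ht.2.symm
    · exact fun _ _ _ _ _ _ h h' => h.trans h'
    · exact fun _ _ _ _ h => h.symm
  exact hg1.1 hg0 β₁ hβ₁

end Parallel

section FlatFrame

/-- The circle with the discrete topology. -/
def DiscreteCircle : Type := Circle

instance : TopologicalSpace DiscreteCircle := ⊥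

instance : DiscreteTopology DiscreteCircle := ⟨rfl⟩

variable {Y : Type*} [TopologicalSpace Y] {S : Set Y} (L : LocalSystem S)

theorem LocalSystem.trans_self (i : L.ι) {p : Y} (hp : p ∈ S) (hi : p ∈ L.cover i) :
    L.trans i i p = 1 := by
  have := L.cocycle i i i p ⟨hp, ⟨hi, hi⟩, hi⟩
  simpa using this

theorem LocalSystem.exists_mem_cover {p : Y} (hp : p ∈ S) : ∃ i, p ∈ L.cover i :=
  mem_iUnion.1 (L.subset_cover hp)

/-- The bundle of flat unitary frames of the pull-back of a local system. -/
def LocalSystem.frameBundle {A : Type*} [TopologicalSpace A] (f : C(A, Y)) (hf : ∀ a, f a ∈ S) :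
    FiberBundleCore L.ι A DiscreteCircle where
  baseSet i := f ⁻¹' L.cover i
  isOpen_baseSet i := (L.isOpen_cover i).preimage f.continuous
  indexAt a := (L.exists_mem_cover (hf a)).choose
  mem_baseSet_at a := (L.exists_mem_cover (hf a)).choose_spec
  coordChange i j a v := (L.trans j i (f a) * (show Circle from v) : Circle)
  coordChange_self i a ha v := by
    change (_ * _ : Circle) = _
    rw [L.trans_self i (hf a) ha, one_mul]
  continuousOn_coordChange i j := by
    rintro ⟨a, v⟩ ⟨⟨hi, hj⟩, -⟩
    have h1 : ∀ᶠ a' in 𝓝 a, L.trans j i (f a') = L.trans j i (f a) := by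
      have h2 : Tendsto f (𝓝 a) (𝓝[S] (f a)) :=
        tendsto_nhdsWithin_iff.2 ⟨f.continuous.continuousAt, Eventually.of_forall hf⟩
      exact h2.eventually (L.locallyConstant j i (f a) ⟨hf a, hj, hi⟩)
    refine ContinuousAt.continuousWithinAt ?_
    have h3 : ContinuousAt (fun q : A × DiscreteCircle =>
        (show DiscreteCircle from (L.trans j i (f a) * (show Circle from q.2) : Circle))) (a, v) :=
      (continuous_of_discreteTopology (f := fun v : DiscreteCircle =>
        (show DiscreteCircle from (L.trans j i (f a) *
          (show Circle from v) : Circle)))).continuousAt.comp continuousAt_snd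
    refine h3.congr ?_
    filter_upwards [continuousAt_fst.eventually h1] with q hq
    rw [hq]
  coordChange_comp i j k a ha v := by
    change (_ * (_ * _) : Circle) = (_ * _ : Circle)
    rw [← mul_assoc, L.cocycle k j i (f a) ⟨hf a, ⟨ha.2, ha.1.2⟩, ha.1.1⟩]

/-- A local system has a flat frame on simply connected spaces. -/
theorem LocalSystem.exists_flat_frame {A : Type*} [TopologicalSpace A] [SimplyConnectedSpace A]
    [LocallyPathConnectedSpace A] (f : C(A, Y)) (hf : ∀ a, f a ∈ S) :
    ∃ e : L.ι → A → Circle,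
      (∀ i j a, f a ∈ L.cover i → f a ∈ L.cover j → e i a = L.trans i j (f a) * e j a) ∧
      ∀ i a, f a ∈ L.cover i → ∀ᶠ a' in 𝓝 a, e i a' = e i a := by
  let Z := L.frameBundle f hf
  have hcov : IsCoveringMap (Bundle.TotalSpace.proj : Z.TotalSpace → A) :=
    FiberBundle.isCoveringMap (F := DiscreteCircle) (E := Z.Fiber)
  obtain ⟨a₀⟩ : Nonempty A := inferInstance
  obtain ⟨s, ⟨-, hs⟩, -⟩ := hcov.existsUnique_continuousMap_lifts (ContinuousMap.id A) a₀
    (⟨a₀, (show DiscreteCircle from (1 : Circle))⟩ : Z.TotalSpace) rfl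
  have hs' : ∀ a, (s a).proj = a := fun a => congrFun hs a
  let e : L.ι → A → DiscreteCircle := fun i a => (Z.localTriv i (s a)).2
  let e' : L.ι → A → Circle := e
  have he : ∀ i a, e' i a = L.trans i (Z.indexAt a) (f a) * (show Circle from (s a).2) := by
    intro i a
    have h1 : e' i a = L.trans i (Z.indexAt (s a).proj) (f (s a).proj) *
      (show Circle from (s a).2) := rfl
    rw [hs'] at h1
    exact h1
  refine ⟨e', ?_, ?_⟩
  · intro i j a hi hj
    rw [he, he, ← mul_assoc, L.cocycle i j _ (f a) ⟨hf a, ⟨hi, hj⟩, Z.mem_baseSet_at a⟩]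
  · intro i a hi
    have h1 : ContinuousAt (Z.localTriv i) (s a) := by
      refine (Z.localTriv i).toOpenPartialHomeomorph.continuousAt ?_
      refine (Z.localTriv i).mem_source.2 ?_
      have : (s a).proj ∈ Z.baseSet i := by rw [hs']; exact hi
      exact this
    have h2 : ContinuousAt (e i) a := continuousAt_snd.comp (h1.comp s.continuous.continuousAt)
    have h3 : {e i a} ∈ 𝓝 (e i a) := mem_nhds_discrete.2 rfl
    filter_upwards [h2 h3] with a' ha'
    exact ha'

end FlatFrame

section ModelFrame

variable {g : ℕ} {B : Type*} [TopologicalSpace B] [ChartedSpace (Coord g) B]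
  {Λ : LagrangianCovering g B} {S : Set (X Λ)} {m : ℕ}

namespace LocalModel

variable {φ : ActionChart Λ} {x₀ : Coord g} (D : LocalModel S φ m x₀)

/-- The domain of the parametrization. -/
def dom : Set (Coord g) := {z | ‖D.Wᗮ.starProjection z‖ < D.r}

theorem isOpen_dom : IsOpen D.dom :=
  isOpen_lt D.Wᗮ.starProjection.continuous.norm continuous_const

theorem convex_dom : Convex ℝ D.dom := by
  have : D.dom = D.Wᗮ.starProjection.toLinearMap ⁻¹' Metric.ball 0 D.r := by
    ext z
    exact mem_ball_zero_iff.symm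
  rw [this]
  exact (convex_ball _ _).linear_preimage _

theorem zero_mem_dom : (0 : Coord g) ∈ D.dom := by
  simp [dom, D.r_pos]

theorem add_mem_dom {z w : Coord g} (hz : z ∈ D.dom) (hw : w ∈ D.W) : z + w ∈ D.dom := by
  change ‖D.Wᗮ.starProjection (z + w)‖ < D.r
  rw [map_add, starProjection_orthogonal_of_mem hw, add_zero]
  exact hz

/-- The action-angle coordinates of the parametrization. -/
def coords (z : Coord g) : Coord g × Coord g := (x₀ + D.Wᗮ.starProjection z, D.y z)

/-- The parametrization of `S`. -/
def pt (z : Coord g) : X Λ := X.param φ (D.coords z)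

theorem coords_fst_mem_ball {z : Coord g} (hz : z ∈ D.dom) :
    (D.coords z).1 ∈ Metric.ball x₀ D.r := by
  rw [mem_ball_iff_norm, coords, add_sub_cancel_left]
  exact hz

theorem coords_fst_mem {z : Coord g} (hz : z ∈ D.dom) : (D.coords z).1 ∈ φ.1.target :=
  D.ball_subset (D.coords_fst_mem_ball hz)

theorem pt_mem {z : Coord g} (hz : z ∈ D.dom) : D.pt z ∈ S :=
  (D.mem_iff _ (D.coords_fst_mem_ball hz) _).2 ⟨z, 0, zero_mem _, by simp [coords], by simp⟩

theorem contDiffOn_coords : ContDiffOn ℝ ∞ D.coords D.dom :=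
  (contDiffOn_const.add D.Wᗮ.starProjection.contDiff.contDiffOn).prodMk D.contDiffOn

theorem continuousOn_pt : ContinuousOn D.pt D.dom :=
  (X.continuousOn_param φ).comp D.contDiffOn_coords.continuousOn fun _ hz => D.coords_fst_mem hz

theorem coords_add {z w : Coord g} (hw : w ∈ D.W) :
    D.coords (z + w) = ((D.coords z).1, (D.coords z).2 + w) := by
  rw [coords, D.y_add z w hw, map_add, starProjection_orthogonal_of_mem hw, add_zero]
  rfl

theorem pt_add [IsManifold (𝓡 g) ∞ B] {z l : Coord g} (hz : z ∈ D.dom) (hl : l ∈ D.W)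
    (hl' : l ∈ intLattice g) : D.pt (z + l) = D.pt z := by
  rw [pt, D.coords_add hl, param_add_mem_iff φ (D.coords_fst_mem hz) hl']
  rfl

theorem eventually_mem_cover (L : LocalSystem S) {z : Coord g} (hz : z ∈ D.dom) {i : L.ι}
    (hi : D.pt z ∈ L.cover i) : ∀ᶠ z' in 𝓝 z, z' ∈ D.dom ∧ D.pt z' ∈ L.cover i :=
  Filter.Eventually.and (D.isOpen_dom.mem_nhds hz)
    ((D.continuousOn_pt.continuousAt (D.isOpen_dom.mem_nhds hz))
      ((L.isOpen_cover i).mem_nhds hi))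

end LocalModel

/-- A flat frame of a local system on the parameter space of a local model of `S`, with its
holonomies. -/
structure FlatFrame {φ : ActionChart Λ} {x₀ : Coord g} (D : LocalModel S φ m x₀)
    (L : LocalSystem S) where
  /-- the components of the flat frame in the frames of the local system -/
  e : L.ι → Coord g → Circle
  /-- the holonomies -/
  hol : Coord g → Circle
  glue : ∀ i j, ∀ z ∈ D.dom, D.pt z ∈ L.cover i → D.pt z ∈ L.cover j →
    e i z = L.trans i j (D.pt z) * e j z
  locallyConstant : ∀ i, ∀ z ∈ D.dom, D.pt z ∈ L.cover i → ∀ᶠ z' in 𝓝 z, e i z' = e i z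
  e_add : ∀ i, ∀ z ∈ D.dom, D.pt z ∈ L.cover i → ∀ l ∈ D.W, l ∈ intLattice g →
    e i (z + l) = hol l * e i z

theorem exists_flatFrame [IsManifold (𝓡 g) ∞ B] {φ : ActionChart Λ} {x₀ : Coord g}
    (D : LocalModel S φ m x₀) (L : LocalSystem S) : Nonempty (FlatFrame D L) := by
  classical
  have hne : D.dom.Nonempty := ⟨0, D.zero_mem_dom⟩
  have : ContractibleSpace D.dom := D.convex_dom.contractibleSpace hne
  have : LocallyPathConnectedSpace D.dom := D.isOpen_dom.locallyPathConnectedSpace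
  obtain ⟨e₀, he₀, hc₀⟩ := L.exists_flat_frame
    (⟨D.dom.domRestrict D.pt, D.continuousOn_pt.domRestrict⟩ : C(D.dom, X Λ))
    (fun z => D.pt_mem z.2)
  let e : L.ι → Coord g → Circle := fun i z => if h : z ∈ D.dom then e₀ i ⟨z, h⟩ else 1
  have he : ∀ i (z : D.dom), e i z = e₀ i z := fun i z => by simp [e]
  have glue : ∀ i j, ∀ z ∈ D.dom, D.pt z ∈ L.cover i → D.pt z ∈ L.cover j →
      e i z = L.trans i j (D.pt z) * e j z := by
    intro i j z hz hi hj
    rw [he i ⟨z, hz⟩, he j ⟨z, hz⟩]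
    exact he₀ i j ⟨z, hz⟩ hi hj
  have hlc : ∀ i, ∀ z ∈ D.dom, D.pt z ∈ L.cover i → ∀ᶠ z' in 𝓝 z, e i z' = e i z := by
    intro i z hz hi
    have h1 := hc₀ i ⟨z, hz⟩ hi
    rw [nhds_subtype_eq_comap, eventually_comap] at h1
    filter_upwards [h1, D.isOpen_dom.mem_nhds hz] with z' hz' hz'd
    rw [he i ⟨z, hz⟩, he i ⟨z', hz'd⟩]
    exact hz' ⟨z', hz'd⟩ rfl
  have hidx : ∀ z, ∃ i, z ∈ D.dom → D.pt z ∈ L.cover i := by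
    intro z
    by_cases hz : z ∈ D.dom
    · obtain ⟨i, hi⟩ := L.exists_mem_cover (D.pt_mem hz)
      exact ⟨i, fun _ => hi⟩
    · obtain ⟨i, -⟩ := L.exists_mem_cover (D.pt_mem D.zero_mem_dom)
      exact ⟨i, fun h => absurd h hz⟩
  choose idx hidx using hidx
  let ρ : Coord g → Coord g → Circle := fun l z => e (idx z) (z + l) / e (idx z) z
  have hρ : ∀ i, ∀ z ∈ D.dom, D.pt z ∈ L.cover i → ∀ l ∈ D.W, l ∈ intLattice g →
      e i (z + l) = ρ l z * e i z := by
    intro i z hz hi l hl hl'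
    have h1 := D.pt_add hz hl hl'
    have h2 := hidx z hz
    have h3 := glue i (idx z) (z + l) (D.add_mem_dom hz hl) (h1 ▸ hi) (h1 ▸ h2)
    rw [h3, h1, glue i (idx z) z hz hi h2]
    simp only [ρ]
    rw [mul_left_comm, div_mul_cancel]
  have hρc : ∀ l ∈ D.W, l ∈ intLattice g → ∀ z ∈ D.dom, ρ l z = ρ l 0 := by
    intro l hl hl' z hz
    refine D.convex_dom.isPreconnected.induction₂ (fun z z' => ρ l z = ρ l z') ?_ ?_ ?_ hz
      D.zero_mem_dom
    · intro z hz
      have hi := hidx z hz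
      have h1 := hlc (idx z) z hz hi
      have h2 := hlc (idx z) (z + l) (D.add_mem_dom hz hl) (D.pt_add hz hl hl' ▸ hi)
      have h3 : Tendsto (fun z' => z' + l) (𝓝 z) (𝓝 (z + l)) :=
        (continuous_add_const l).continuousAt
      refine mem_nhdsWithin_of_mem_nhds ?_
      filter_upwards [h1, h3.eventually h2, D.eventually_mem_cover L hz hi] with z' e1 e2 ⟨hd, hci⟩
      have h4 := hρ _ z hz hi l hl hl'
      have h5 := hρ _ z' hd hci l hl hl'
      rw [e1, e2, h4] at h5
      exact mul_right_cancel h5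
    · exact fun _ _ _ _ _ _ h h' => h.trans h'
    · exact fun _ _ _ _ h => h.symm
  refine ⟨⟨e, fun l => ρ l 0, glue, hlc, fun i z hz hi l hl hl' => ?_⟩⟩
  rw [← hρc l hl hl' z hz]
  exact hρ i z hz hi l hl hl'

end ModelFrame

section ModelForms

variable {g : ℕ} {B : Type*} [TopologicalSpace B] [ChartedSpace (Coord g) B]
  {Λ : LagrangianCovering g B} {S : Set (X Λ)} {m : ℕ} {L : LocalSystem S}
  {φ : ActionChart Λ} {x₀ : Coord g} {q : ℕ}

namespace LocalModel

variable (D : LocalModel S φ m x₀)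

/-- The base point of the fibre containing the point with parameter `z`. -/
abbrev base (z : Coord g) : B := φ.1.symm (D.coords z).1

theorem base_mem {z : Coord g} (hz : z ∈ D.dom) : D.base z ∈ φ.1.source :=
  φ.1.map_target (D.coords_fst_mem hz)

theorem chart_base {z : Coord g} (hz : z ∈ D.dom) : φ.1 (D.base z) = (D.coords z).1 :=
  φ.1.right_inv (D.coords_fst_mem hz)

theorem chart_base_mem_ball {z : Coord g} (hz : z ∈ D.dom) :
    φ.1 (D.base z) ∈ Metric.ball x₀ D.r :=
  D.chart_base hz ▸ D.coords_fst_mem_ball hz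

theorem base_add {z w : Coord g} (hw : w ∈ D.W) : D.base (z + w) = D.base z := by
  rw [base, D.coords_add hw, base]

/-- The parameter space of `S ×_B U`. -/
def hatDom (U : Set (XHat Λ)) : Set (Coord g × Coord g) :=
  {p | p.1 ∈ D.dom ∧ XHat.param φ ((D.coords p.1).1, p.2) ∈ U}

theorem isOpen_hatDom {U : Set (XHat Λ)} (hU : IsOpen U) : IsOpen (D.hatDom U) := by
  have h1 : ContinuousOn (fun p : Coord g × Coord g => XHat.param φ ((D.coords p.1).1, p.2))
      {p | p.1 ∈ D.dom} := by
    refine (XHat.continuousOn_param φ).comp ?_ fun p hp => D.coords_fst_mem hp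
    exact ((continuous_fst.comp_continuousOn D.contDiffOn_coords.continuousOn).comp
      continuousOn_fst fun p hp => hp).prodMk continuousOn_snd
  exact h1.isOpen_inter_preimage (D.isOpen_dom.preimage continuous_fst) hU

theorem add_mem_hatDom {U : Set (XHat Λ)} {z w u : Coord g} (h : (z, w) ∈ D.hatDom U)
    (hu : u ∈ D.W) : (z + u, w) ∈ D.hatDom U := by
  refine ⟨D.add_mem_dom h.1 hu, ?_⟩
  rw [D.coords_add hu]
  exact h.2

theorem hatDom_mono {U U' : Set (XHat Λ)} (h : U' ⊆ U) : D.hatDom U' ⊆ D.hatDom U :=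
  fun _ hp => ⟨hp.1, h hp.2⟩

end LocalModel

/-- A relative form, trivialized on the parameter space of a local model of `S` by a flat frame. -/
structure IsModelForm {D : LocalModel S φ m x₀} (E : FlatFrame D L) (U : Set (XHat Λ))
    (T : Coord g → Coord g → Coord g [⋀^Fin q]→ₗ[ℝ] ℂ) : Prop where
  smooth : ∀ u : Fin q → Coord g, (∀ a, u a ∈ D.W) →
    ContDiffOn ℝ ∞ (fun p : Coord g × Coord g => T p.1 p.2 u) (D.hatDom U)
  hol : ∀ z w, (z, w) ∈ D.hatDom U → ∀ l ∈ D.W, l ∈ intLattice g →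
    ∀ u : Fin q → Coord g, (∀ a, u a ∈ D.W) →
      T (z + l) w u = ((E.hol l : ℂ))⁻¹ * T z w u
  automorphy : ∀ z w, (z, w) ∈ D.hatDom U → ∀ μ ∈ intLattice g,
    ∀ u : Fin q → Coord g, (∀ a, u a ∈ D.W) →
      T z (w + μ) u = Complex.exp (-(2 * Real.pi * Complex.I * (inner ℝ (D.y z) μ : ℝ))) * T z w u

/-- `T` is the form `τ`, trivialized by the flat frame. -/
def Represents {D : LocalModel S φ m x₀} (E : FlatFrame D L) (U : Set (XHat Λ))
    (τ : FormData L q) (T : Coord g → Coord g → Coord g [⋀^Fin q]→ₗ[ℝ] ℂ) : Prop :=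
  ∀ i z w, (z, w) ∈ D.hatDom U → D.pt z ∈ L.cover i → ∀ n ∈ intLattice g,
    ∀ u : Fin q → Coord g, (∀ a, u a ∈ D.W) →
      τ i (D.base z) (cot φ.1 (D.base z) (D.y z + n)) (tan φ.1 (D.coords z).1 w)
        (fun a => cot φ.1 (D.base z) (u a)) = E.e i z * T z w u

/-- The differential `∇_r` of a trivialized form. -/
def modelRelD (T : Coord g → Coord g → Coord g [⋀^Fin q]→ₗ[ℝ] ℂ) (z w : Coord g)
    (u : Fin (q + 1) → Coord g) : ℂ :=
  ∑ a : Fin (q + 1), (-1 : ℂ) ^ (a : ℕ) *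
    (deriv (fun t : ℝ => T (z + t • u a) w (fun c => u (a.succAbove c))) 0 +
      2 * Real.pi * Complex.I * (inner ℝ (u a) w : ℝ) * T z w (fun c => u (a.succAbove c)))

theorem tan_add (φ : OpenPartialHomeomorph B (Coord g)) (x w w' : Coord g) :
    tan φ x (w + w') = tan φ x w + tan φ x w' :=
  map_add _ _ _

theorem LocalModel.exists_index (D : LocalModel S φ m x₀) (L : LocalSystem S) :
    ∃ idx : Coord g → L.ι, ∀ z ∈ D.dom, D.pt z ∈ L.cover (idx z) := by
  have hidx : ∀ z, ∃ i, z ∈ D.dom → D.pt z ∈ L.cover i := by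
    intro z
    by_cases hz : z ∈ D.dom
    · obtain ⟨i, hi⟩ := L.exists_mem_cover (D.pt_mem hz)
      exact ⟨i, fun _ => hi⟩
    · obtain ⟨i, -⟩ := L.exists_mem_cover (D.pt_mem D.zero_mem_dom)
      exact ⟨i, fun h => absurd h hz⟩
  choose idx hidx using hidx
  exact ⟨idx, hidx⟩

variable [IsManifold (𝓡 g) ∞ B] {D : LocalModel S φ m x₀} {E : FlatFrame D L}
  {U : Set (XHat Λ)}

theorem LocalModel.mk_eq_pt (D : LocalModel S φ m x₀) {z n : Coord g} (hz : z ∈ D.dom)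
    (hn : n ∈ intLattice g) : X.mk (cot φ.1 (D.base z) (D.y z + n)) = D.pt z :=
  param_add_mem_iff φ (D.coords_fst_mem hz) hn

theorem LocalModel.cot_mem_vertTangent (D : LocalModel S φ m x₀) {z n u : Coord g}
    (hz : z ∈ D.dom) (hn : n ∈ intLattice g) (hu : u ∈ D.W) :
    cot φ.1 (D.base z) u ∈ vertTangent S (cot φ.1 (D.base z) (D.y z + n)) := by
  rw [D.mem_vertTangent_iff (D.base_mem hz) (D.chart_base_mem_ball hz)
    (by rw [D.mk_eq_pt hz hn]; exact D.pt_mem hz), ycoord_cot φ.2.1 (D.base_mem hz)]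
  exact hu

theorem cot_tan (φ : ActionChart Λ) {x : Coord g} (hx : x ∈ φ.1.target) (y w : Coord g) :
    cot φ.1 (φ.1.symm x) y (tan φ.1 x w) = inner ℝ y w := by
  rw [cot_apply, wcoord_tan φ.2.1 hx]

theorem Represents.relD_eq {τ : FormData L q}
    {T : Coord g → Coord g → Coord g [⋀^Fin q]→ₗ[ℝ] ℂ} (h : Represents E U τ T) {i : L.ι}
    {z w n : Coord g} (hzw : (z, w) ∈ D.hatDom U) (hi : D.pt z ∈ L.cover i)
    (hn : n ∈ intLattice g) {u : Fin (q + 1) → Coord g} (hu : ∀ a, u a ∈ D.W) :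
    relD τ i (D.base z) (cot φ.1 (D.base z) (D.y z + n)) (tan φ.1 (D.coords z).1 w)
      (fun a => cot φ.1 (D.base z) (u a)) = E.e i z * modelRelD T z w u := by
  rw [relD, modelRelD, Finset.mul_sum]
  refine Finset.sum_congr rfl fun a _ => ?_
  have h1 : (fun t : ℝ => τ i (D.base z)
      (cot φ.1 (D.base z) (D.y z + n) + t • cot φ.1 (D.base z) (u a)) (tan φ.1 (D.coords z).1 w)
      (fun c => cot φ.1 (D.base z) (u (a.succAbove c)))) =ᶠ[𝓝 0]
      fun t : ℝ => E.e i z * T (z + t • u a) w (fun c => u (a.succAbove c)) := by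
    have hc : Tendsto (fun t : ℝ => z + t • u a) (𝓝 0) (𝓝 z) := by
      have : Continuous fun t : ℝ => z + t • u a := by fun_prop
      simpa using this.tendsto 0
    filter_upwards [hc.eventually (D.eventually_mem_cover L hzw.1 hi),
      hc.eventually (E.locallyConstant i z hzw.1 hi)] with t ⟨_, ht2⟩ ht3
    have hW := D.W.smul_mem t (hu a)
    have h2 := h i (z + t • u a) w (D.add_mem_hatDom hzw hW) ht2 n hn
      (fun c => u (a.succAbove c)) fun c => hu _
    rw [ht3, D.y_add z _ hW, D.base_add hW, D.coords_add hW] at h2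
    rw [← h2, ← cot_smul, ← cot_add, add_right_comm]
  rw [h1.deriv_eq, deriv_const_mul_field, h i z w hzw hi n hn _ fun c => hu _]
  have h3 : cot φ.1 (D.base z) (u a) (tan φ.1 (D.coords z).1 w) = inner ℝ (u a) w :=
    cot_tan φ (D.coords_fst_mem hzw.1) _ _
  rw [h3]
  ring

/-- The trivialization of a form by a flat frame. -/
def trivialize (E : FlatFrame D L) (τ : FormData L q) (idx : Coord g → L.ι) (z w : Coord g) :
    Coord g [⋀^Fin q]→ₗ[ℝ] ℂ :=
  ((E.e (idx z) z : ℂ))⁻¹ • (τ (idx z) (D.base z) (cot φ.1 (D.base z) (D.y z))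
    (tan φ.1 (D.coords z).1 w)).compLinearMap (cotₗ φ.1 (D.base z))

theorem IsRelForm.represents {τ : FormData L q} (hτ : IsRelForm L U τ) (E : FlatFrame D L)
    {idx : Coord g → L.ι} (hidx : ∀ z ∈ D.dom, D.pt z ∈ L.cover (idx z)) :
    Represents E U τ (trivialize E τ idx) := by
  intro i z w hzw hi n hn u hu
  have h0 : cot φ.1 (D.base z) (D.y z) = cot φ.1 (D.base z) (D.y z + 0) := by rw [add_zero]
  have hlat : cot φ.1 (D.base z) n ∈ Λ.lattice (D.base z) :=
    (cot_mem_lattice φ (D.base_mem hzw.1)).2 hn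
  have hpt : X.mk (cot φ.1 (D.base z) (D.y z)) = D.pt z := rfl
  have hU : XHat.mk (tan φ.1 (D.coords z).1 w) ∈ U := hzw.2
  have hvt : ∀ a, cot φ.1 (D.base z) (u a) ∈ vertTangent S (cot φ.1 (D.base z) (D.y z)) :=
    fun a => by rw [h0]; exact D.cot_mem_vertTangent hzw.1 (zero_mem _) (hu a)
  have h1 := hτ.automorphy i (D.base z) (cot φ.1 (D.base z) (D.y z))
    (tan φ.1 (D.coords z).1 w) (by rw [hpt]; exact ⟨D.pt_mem hzw.1, hi⟩) hU _ hlat 0 (zero_mem _)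
    (fun a => cot φ.1 (D.base z) (u a)) hvt
  rw [← cot_add] at h1
  have h2 := hτ.glue i (idx z) (D.base z) (cot φ.1 (D.base z) (D.y z))
    (tan φ.1 (D.coords z).1 w) (by rw [hpt]; exact ⟨D.pt_mem hzw.1, hi, hidx z hzw.1⟩) hU
    (fun a => cot φ.1 (D.base z) (u a)) hvt
  rw [hpt] at h2
  have h3 : (E.e i z : ℂ) = L.trans i (idx z) (D.pt z) * E.e (idx z) z := by
    rw [E.glue i (idx z) z hzw.1 hi (hidx z hzw.1)]
    simp
  have h4 : (E.e (idx z) z : ℂ) ≠ 0 := Circle.coe_ne_zero _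
  simp only [add_zero, map_zero, Complex.ofReal_zero, mul_zero, neg_zero, Complex.exp_zero,
    one_mul] at h1
  rw [h1, h2, h3, trivialize, AlternatingMap.smul_apply, smul_eq_mul,
    AlternatingMap.compLinearMap_apply]
  have h5 : (fun a => cot φ.1 (D.base z) (u a)) = ((cotₗ φ.1 (D.base z) : Coord g → _) ∘ u) := rfl
  rw [h5]
  field_simp
  rfl

theorem IsRelForm.isModelForm {τ : FormData L q} (hτ : IsRelForm L U τ) (hU : IsOpen U)
    {T : Coord g → Coord g → Coord g [⋀^Fin q]→ₗ[ℝ] ℂ} (hT : Represents E U τ T) :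
    IsModelForm E U T := by
  have hval : ∀ i z w, (z, w) ∈ D.hatDom U → D.pt z ∈ L.cover i → ∀ n ∈ intLattice g,
      ∀ u : Fin q → Coord g, (∀ a, u a ∈ D.W) → T z w u = ((E.e i z : ℂ))⁻¹ *
      τ i (D.base z) (cot φ.1 (D.base z) (D.y z + n)) (tan φ.1 (D.coords z).1 w)
        (fun a => cot φ.1 (D.base z) (u a)) := by
    intro i z w hzw hi n hn u hu
    rw [hT i z w hzw hi n hn u hu, inv_mul_cancel_left₀ (Circle.coe_ne_zero _)]
  refine ⟨?_, ?_, ?_⟩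
  · rintro u hu ⟨z₀, w₀⟩ h₀
    obtain ⟨i, hi⟩ := L.exists_mem_cover (D.pt_mem h₀.1)
    have hnear : ∀ᶠ p : Coord g × Coord g in 𝓝 (z₀, w₀), p ∈ D.hatDom U ∧
        D.pt p.1 ∈ L.cover i ∧ E.e i p.1 = E.e i z₀ := by
      refine Filter.Eventually.and ((D.isOpen_hatDom hU).mem_nhds h₀) ?_
      have h1 : Tendsto (Prod.fst : Coord g × Coord g → Coord g) (𝓝 (z₀, w₀)) (𝓝 z₀) :=
        continuous_fst.continuousAt
      exact ((h1.eventually (D.eventually_mem_cover L h₀.1 hi)).and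
        (h1.eventually (E.locallyConstant i z₀ h₀.1 hi))).mono fun p hp => ⟨hp.1.2, hp.2⟩
    let G : Coord g × Coord g → Coord g × Coord g × Coord g :=
      fun p => ((D.coords p.1).1, D.y p.1, p.2)
    have hG : ContDiffAt ℝ ∞ G (z₀, w₀) := by
      have h1 : ContDiffAt ℝ ∞ (fun p : Coord g × Coord g => D.coords p.1) (z₀, w₀) :=
        ContDiffAt.comp (g := D.coords) (z₀, w₀)
          (D.contDiffOn_coords.contDiffAt (D.isOpen_dom.mem_nhds h₀.1)) contDiffAt_fst
      exact (contDiffAt_fst.comp _ h1).prodMk ((contDiffAt_snd.comp _ h1).prodMk contDiffAt_snd)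
    have hs := hτ.smooth i φ u
    obtain ⟨O, hOn, hO⟩ : ∃ O ∈ 𝓝 (z₀, w₀), ∀ p ∈ O, p ∈ D.hatDom U ∧
        D.pt p.1 ∈ L.cover i ∧ E.e i p.1 = E.e i z₀ := ⟨_, hnear, fun p hp => hp⟩
    have hmaps : MapsTo G O {p | p.1 ∈ φ.1.target ∧ X.param φ (p.1, p.2.1) ∈ S ∩ L.cover i ∧
        XHat.param φ (p.1, p.2.2) ∈ U} := by
      intro p hp
      obtain ⟨h1, h2, -⟩ := hO p hp
      exact ⟨D.coords_fst_mem h1.1, ⟨D.pt_mem h1.1, h2⟩, h1.2⟩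
    have h2 := (hs (G (z₀, w₀)) (hmaps (mem_of_mem_nhds hOn))).comp (z₀, w₀)
      hG.contDiffWithinAt hmaps
    have h3 := (contDiffWithinAt_const (c := ((E.e i z₀ : ℂ))⁻¹)).mul h2
    refine ((h3.contDiffAt hOn).congr_of_eventuallyEq ?_).contDiffWithinAt
    filter_upwards [hnear] with p ⟨hp1, hp2, hp3⟩
    rw [hval i p.1 p.2 hp1 hp2 0 (zero_mem _) u hu, hp3, add_zero]
    rfl
  · intro z w hzw l hl hl' u hu
    obtain ⟨i, hi⟩ := L.exists_mem_cover (D.pt_mem hzw.1)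
    have hi' : D.pt (z + l) ∈ L.cover i := by rwa [D.pt_add hzw.1 hl hl']
    have h1 := hval i (z + l) w (D.add_mem_hatDom hzw hl) hi' 0 (zero_mem _) u hu
    rw [D.base_add hl, D.y_add z l hl, D.coords_add hl, add_zero,
      hT i z w hzw hi l hl' u hu, E.e_add i z hzw.1 hi l hl hl'] at h1
    rw [h1]
    have := Circle.coe_ne_zero (E.e i z)
    have := Circle.coe_ne_zero (E.hol l)
    push_cast
    field_simp
  · intro z w hzw μ hμ u hu
    obtain ⟨i, hi⟩ := L.exists_mem_cover (D.pt_mem hzw.1)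
    have hx := D.coords_fst_mem hzw.1
    have hμ' : tan φ.1 (D.coords z).1 μ ∈ dualLattice Λ (D.base z) := by
      rw [mem_dualLattice_iff φ (D.base_mem hzw.1), wcoord_tan φ.2.1 hx]
      exact hμ
    have hzw' : (z, w + μ) ∈ D.hatDom U := by
      refine ⟨hzw.1, ?_⟩
      rw [(XHat.param_eq_param φ (p := ((D.coords z).1, w + μ)) (q := ((D.coords z).1, w)) hx hx).2
        ⟨rfl, by simpa using hμ⟩]
      exact hzw.2
    rw [hval i z w hzw hi 0 (zero_mem _) u hu, hval i z _ hzw' hi 0 (zero_mem _) u hu, tan_add]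
    have h1 := hτ.automorphy i (D.base z) (cot φ.1 (D.base z) (D.y z + 0))
      (tan φ.1 (D.coords z).1 w) (by rw [D.mk_eq_pt hzw.1 (zero_mem _)]; exact ⟨D.pt_mem hzw.1, hi⟩)
      hzw.2 0 (zero_mem _) _ hμ' (fun a => cot φ.1 (D.base z) (u a))
      (fun a => D.cot_mem_vertTangent hzw.1 (zero_mem _) (hu a))
    have h2 : cot φ.1 (D.base z) (D.y z + 0) (tan φ.1 (D.coords z).1 μ) = inner ℝ (D.y z) μ := by
      rw [add_zero]
      exact cot_tan φ hx _ _
    rw [add_zero (cot φ.1 (D.base z) (D.y z + 0)), h2] at h1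
    rw [h1]
    ring

end ModelForms

section BuildForms

variable {g : ℕ} {B : Type*} [TopologicalSpace B] [ChartedSpace (Coord g) B]
  {Λ : LagrangianCovering g B} {S : Set (X Λ)} {m : ℕ} {L : LocalSystem S}
  {φ : ActionChart Λ} {x₀ : Coord g} {q : ℕ}

/-- A parameter of the point with action-angle coordinates `(x, y)`, if there is one. -/
def LocalModel.param (D : LocalModel S φ m x₀) (x y : Coord g) : Coord g :=
  Classical.epsilon fun z => z ∈ D.dom ∧ (D.coords z).1 = x ∧ y - D.y z ∈ intLattice g

theorem LocalModel.param_spec (D : LocalModel S φ m x₀) {z n : Coord g} (hz : z ∈ D.dom)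
    (hn : n ∈ intLattice g) : D.param (D.coords z).1 (D.y z + n) - z ∈ D.W ∧
      D.param (D.coords z).1 (D.y z + n) - z ∈ intLattice g := by
  set z' := D.param (D.coords z).1 (D.y z + n)
  obtain ⟨h1, h2, h3⟩ : z' ∈ D.dom ∧ (D.coords z').1 = (D.coords z).1 ∧
      D.y z + n - D.y z' ∈ intLattice g :=
    Classical.epsilon_spec (p := fun z' => z' ∈ D.dom ∧ (D.coords z').1 = (D.coords z).1 ∧
      D.y z + n - D.y z' ∈ intLattice g) ⟨z, hz, rfl, by simpa using hn⟩
  obtain ⟨h4, h5⟩ := D.y_eq (z := z') (z' := z) (add_left_cancel h2)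
  refine ⟨h4, ?_⟩
  rw [h5] at h3
  have := sub_mem hn h3
  convert this using 1
  abel

/-- The relative form defined by its trivialization. -/
def ofModel {D : LocalModel S φ m x₀} (E : FlatFrame D L)
    (T : Coord g → Coord g → Coord g [⋀^Fin q]→ₗ[ℝ] ℂ) : FormData L q :=
  fun i b α v => (E.e i (D.param (φ.1 b) (ycoord φ.1 b α)) : ℂ) •
    (T (D.param (φ.1 b) (ycoord φ.1 b α)) (wcoord φ.1 b v)).compLinearMap
      (D.W.starProjection.toLinearMap ∘ₗ ycoordₗ φ.1 b)

/-- The part of `X̂` over the domain of a local model. -/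
def LocalModel.hatBall (D : LocalModel S φ m x₀) : Set (XHat Λ) :=
  {ξ | ξ.1 ∈ φ.1.source ∧ φ.1 ξ.1 ∈ Metric.ball x₀ D.r}

/-- Multilinear expansion: a family of alternating maps that is smooth on fixed arguments is smooth
on smooth arguments. -/
theorem contDiffWithinAt_alternatingMap {V : Type*} [NormedAddCommGroup V] [NormedSpace ℝ V]
    {W : Submodule ℝ (Coord g)} {T : V → Coord g [⋀^Fin q]→ₗ[ℝ] ℂ} {Q : Set V} {p₀ : V}
    (hT : ∀ u : Fin q → Coord g, (∀ a, u a ∈ W) → ContDiffWithinAt ℝ ∞ (fun p => T p u) Q p₀)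
    {u : V → Fin q → Coord g} (hu : ∀ a, ContDiffWithinAt ℝ ∞ (fun p => u p a) Q p₀) :
    ContDiffWithinAt ℝ ∞ (fun p => T p fun a => W.starProjection (u p a)) Q p₀ := by
  have key : ∀ p, (T p fun a => W.starProjection (u p a)) =
      ∑ k : Fin q → Fin g, ((∏ a, u p a (k a) : ℝ) : ℂ) *
        T p fun a => W.starProjection (EuclideanSpace.single (k a) 1) := by
    intro p
    have h1 : ∀ a, W.starProjection (u p a) =
        ∑ j, u p a j • W.starProjection (EuclideanSpace.single j 1) := by
      intro a
      conv_lhs => rw [← (EuclideanSpace.basisFun (Fin g) ℝ).sum_repr (u p a)]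
      simp only [map_sum, map_smul]
      simp
    simp only [h1]
    have h2 := (T p).toMultilinearMap.map_sum
      (fun a j => u p a j • W.starProjection (EuclideanSpace.single j (1 : ℝ)))
    refine h2.trans (Finset.sum_congr rfl fun k _ => ?_)
    rw [MultilinearMap.map_smul_univ, Complex.real_smul]
    rfl
  simp only [key]
  refine ContDiffWithinAt.sum fun k _ => ContDiffWithinAt.mul ?_ (hT _ fun a =>
    W.starProjection_apply_mem _)
  refine Complex.ofRealCLM.contDiff.contDiffAt.comp_contDiffWithinAt p₀ ?_
  exact contDiffWithinAt_prod (t := Finset.univ) (f := fun a p => u p a (k a)) fun a _ =>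
    (contDiffWithinAt_euclidean.1 (hu a)) (k a)

variable [IsManifold (𝓡 g) ∞ B] {D : LocalModel S φ m x₀} {E : FlatFrame D L}
  {U : Set (XHat Λ)} {T : Coord g → Coord g → Coord g [⋀^Fin q]→ₗ[ℝ] ℂ}

theorem LocalModel.exists_param (D : LocalModel S φ m x₀) {b : B} (hb : b ∈ φ.1.source)
    (hbr : φ.1 b ∈ Metric.ball x₀ D.r) {α : Cot g b} (hα : X.mk α ∈ S) :
    ∃ z ∈ D.dom, ∃ n ∈ intLattice g, φ.1 b = (D.coords z).1 ∧ ycoord φ.1 b α = D.y z + n ∧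
      X.mk α = D.pt z := by
  have h1 := X.mk_eq_param φ hb α
  rw [h1] at hα
  obtain ⟨z, n, hn, hz, hy⟩ := (D.mem_iff _ hbr _).1 hα
  have hzd : z ∈ D.dom := by
    change ‖_‖ < _
    rw [hz]
    exact mem_ball_iff_norm.1 hbr
  have hx : φ.1 b = (D.coords z).1 := by simp only [coords, hz]; abel
  refine ⟨z, hzd, n, hn, hx, hy, ?_⟩
  rw [h1, hy, hx, param_add_mem_iff φ (D.coords_fst_mem hzd) hn]
  rfl

theorem mem_hatDom_of {b : B} (hb : b ∈ φ.1.source) {v : Tan g b} (hv : XHat.mk v ∈ U)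
    {z : Coord g} (hz : z ∈ D.dom) (hx : φ.1 b = (D.coords z).1) :
    (z, wcoord φ.1 b v) ∈ D.hatDom U := by
  refine ⟨hz, ?_⟩
  change XHat.param φ ((D.coords z).1, wcoord φ.1 b v) ∈ U
  rw [← hx, ← XHat.mk_eq_param φ hb]
  exact hv

theorem ofModel_apply (hT : IsModelForm E U T) {i : L.ι} {b : B} (hb : b ∈ φ.1.source)
    {α : Cot g b} {v : Tan g b} {z n : Coord g} (hz : z ∈ D.dom) (hn : n ∈ intLattice g)
    (hi : D.pt z ∈ L.cover i) (hx : φ.1 b = (D.coords z).1) (hy : ycoord φ.1 b α = D.y z + n)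
    (hv : XHat.mk v ∈ U) (u : Fin q → Cot g b) :
    ofModel E T i b α v u = E.e i z * T z (wcoord φ.1 b v)
      (fun a => D.W.starProjection (ycoord φ.1 b (u a))) := by
  have hzw := mem_hatDom_of hb hv hz hx
  obtain ⟨h1, h2⟩ := D.param_spec hz hn
  set l := D.param (D.coords z).1 (D.y z + n) - z with hl
  have h3 : D.param (D.coords z).1 (D.y z + n) = z + l := by rw [hl]; abel
  have h5 : (E.hol l : ℂ) ≠ 0 := Circle.coe_ne_zero _
  rw [ofModel, hx, hy, h3, AlternatingMap.smul_apply, AlternatingMap.compLinearMap_apply,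
    smul_eq_mul]
  change _ * T (z + l) (wcoord φ.1 b v) (fun a => D.W.starProjection (ycoord φ.1 b (u a))) = _
  rw [hT.hol z _ hzw l h1 h2 _ fun a => D.W.starProjection_apply_mem _, E.e_add i z hz hi l h1 h2]
  push_cast
  field_simp

theorem represents_ofModel (hT : IsModelForm E U T) : Represents E U (ofModel E T) T := by
  intro i z w hzw hi n hn u hu
  have hb := D.base_mem hzw.1
  rw [ofModel_apply hT hb hzw.1 hn hi (D.chart_base hzw.1) (ycoord_cot φ.2.1 hb _) hzw.2,
    wcoord_tan φ.2.1 (D.coords_fst_mem hzw.1)]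
  congr 2
  ext1 a
  rw [ycoord_cot φ.2.1 hb, D.W.starProjection_eq_self_iff.2 (hu a)]

theorem contDiffOn_ofModel (hU : U ⊆ D.hatBall) (hT : IsModelForm E U T) (hUo : IsOpen U)
    (i : L.ι) (ψ : ActionChart Λ) (u : Fin q → Coord g) :
    ContDiffOn ℝ ∞
      (fun p : Coord g × Coord g × Coord g =>
        ofModel E T i (ψ.1.symm p.1) (cot ψ.1 (ψ.1.symm p.1) p.2.1) (tan ψ.1 p.1 p.2.2)
          (fun j => cot ψ.1 (ψ.1.symm p.1) (u j)))
      {p | p.1 ∈ ψ.1.target ∧ X.param ψ (p.1, p.2.1) ∈ S ∩ L.cover i ∧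
        XHat.param ψ (p.1, p.2.2) ∈ U} := by
  set Q := {p : Coord g × Coord g × Coord g | p.1 ∈ ψ.1.target ∧
    X.param ψ (p.1, p.2.1) ∈ S ∩ L.cover i ∧ XHat.param ψ (p.1, p.2.2) ∈ U} with hQ
  intro p₀ hp₀
  let xx : Coord g × Coord g × Coord g → Coord g := fun p => φ.1 (ψ.1.symm p.1)
  let yy : Coord g × Coord g × Coord g → Coord g := fun p =>
    ycoord φ.1 (ψ.1.symm p.1) (cot ψ.1 (ψ.1.symm p.1) p.2.1)
  let ww : Coord g × Coord g × Coord g → Coord g := fun p =>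
    wcoord φ.1 (ψ.1.symm p.1) (tan ψ.1 p.1 p.2.2)
  let uu : Coord g × Coord g × Coord g → Fin q → Coord g := fun p a =>
    ycoord φ.1 (ψ.1.symm p.1) (cot ψ.1 (ψ.1.symm p.1) (u a))
  have hsrc : ∀ p ∈ Q, ψ.1.symm p.1 ∈ φ.1.source ∧ xx p ∈ Metric.ball x₀ D.r :=
    fun p hp => hU hp.2.2
  have hdom : {x | x ∈ ψ.1.target ∧ ψ.1.symm x ∈ φ.1.source} ∈ 𝓝 p₀.1 :=
    (isOpen_transition_domain ψ.1 φ.1).mem_nhds ⟨hp₀.1, (hsrc p₀ hp₀).1⟩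
  have hdom2 : ∀ c : Coord g,
      {p : Coord g × Coord g | p.1 ∈ ψ.1.target ∧ ψ.1.symm p.1 ∈ φ.1.source} ∈ 𝓝 (p₀.1, c) :=
    fun c => ((isOpen_transition_domain ψ.1 φ.1).preimage continuous_fst).mem_nhds
      ⟨hp₀.1, (hsrc p₀ hp₀).1⟩
  have hxx : ContDiffAt ℝ ∞ xx p₀ :=
    ContDiffAt.comp (g := fun x => φ.1 (ψ.1.symm x)) p₀
      ((contDiffOn_transition ψ.2.1 φ.2.1).contDiffAt hdom) contDiffAt_fst
  have hpr : ContDiffAt ℝ ∞ (fun p : Coord g × Coord g × Coord g => (p.1, p.2.1)) p₀ :=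
    contDiffAt_fst.prodMk (contDiffAt_fst.comp p₀ contDiffAt_snd)
  have hpr' : ContDiffAt ℝ ∞ (fun p : Coord g × Coord g × Coord g => (p.1, p.2.2)) p₀ :=
    contDiffAt_fst.prodMk (contDiffAt_snd.comp p₀ contDiffAt_snd)
  have hyy : ContDiffAt ℝ ∞ yy p₀ :=
    ContDiffAt.comp (g := fun p : Coord g × Coord g =>
      ycoord φ.1 (ψ.1.symm p.1) (cot ψ.1 (ψ.1.symm p.1) p.2))
      (f := fun p : Coord g × Coord g × Coord g => (p.1, p.2.1)) p₀
      ((contDiffOn_ycoord_cot ψ.2.1 φ.2.1).contDiffAt (hdom2 _)) hpr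
  have hww : ContDiffAt ℝ ∞ ww p₀ :=
    ContDiffAt.comp (g := fun p : Coord g × Coord g =>
      wcoord φ.1 (ψ.1.symm p.1) (tan ψ.1 p.1 p.2))
      (f := fun p : Coord g × Coord g × Coord g => (p.1, p.2.2)) p₀
      ((contDiffOn_wcoord_tan ψ.2.1 φ.2.1).contDiffAt (hdom2 _)) hpr'
  have huu : ∀ a, ContDiffAt ℝ ∞ (fun p => uu p a) p₀ := fun a =>
    ContDiffAt.comp (g := fun p : Coord g × Coord g =>
      ycoord φ.1 (ψ.1.symm p.1) (cot ψ.1 (ψ.1.symm p.1) p.2))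
      (f := fun p : Coord g × Coord g × Coord g => (p.1, u a)) p₀
      ((contDiffOn_ycoord_cot ψ.2.1 φ.2.1).contDiffAt (hdom2 _))
      (contDiffAt_fst.prodMk contDiffAt_const)
  have hparam : ∀ p ∈ Q, ∃ z ∈ D.dom, ∃ n ∈ intLattice g, xx p = (D.coords z).1 ∧
      yy p = D.y z + n ∧ X.param ψ (p.1, p.2.1) = D.pt z :=
    fun p hp => D.exists_param (hsrc p hp).1 (hsrc p hp).2 hp.2.1.1
  obtain ⟨z₀, hz₀, n₀, hn₀, hxz₀, hyz₀, hpt₀⟩ := hparam p₀ hp₀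
  have hmemdom : ∀ p ∈ Q, xx p - x₀ ∈ D.dom := fun p hp =>
    lt_of_le_of_lt (Submodule.norm_starProjection_apply_le _ _)
      (mem_ball_iff_norm.1 (hsrc p hp).2)
  let y₁ : Coord g × Coord g × Coord g → Coord g := fun p => yy p - D.y (xx p - x₀)
  have hy₁ : ContDiffAt ℝ ∞ y₁ p₀ := by
    refine hyy.sub (ContDiffAt.comp (g := D.y) p₀ ?_ (hxx.sub contDiffAt_const))
    exact D.contDiffOn.contDiffAt (D.isOpen_dom.mem_nhds (hmemdom p₀ hp₀))
  have hy₁W : ∀ p ∈ Q, ∀ z n : Coord g, xx p = (D.coords z).1 → yy p = D.y z + n →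
      D.Wᗮ.starProjection (xx p - x₀) = xx p - x₀ ∧ y₁ p - n ∈ D.W := by
    intro p hp z n hx hy
    have h1 : xx p - x₀ = D.Wᗮ.starProjection z := by
      rw [hx, LocalModel.coords, add_sub_cancel_left]
    have h2 : D.Wᗮ.starProjection (xx p - x₀) = xx p - x₀ := by
      rw [D.Wᗮ.starProjection_eq_self_iff, h1]
      exact D.Wᗮ.starProjection_apply_mem z
    refine ⟨h2, ?_⟩
    obtain ⟨h3, h4⟩ := D.y_eq (z := z) (z' := xx p - x₀) (by rw [h2, h1])
    simp only [y₁]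
    rw [hy, h4]
    convert h3 using 1
    abel
  let ζ : Coord g × Coord g × Coord g → Coord g := fun p =>
    (xx p - x₀) + D.W.starProjection (y₁ p - n₀)
  have hζ : ContDiffAt ℝ ∞ ζ p₀ :=
    (hxx.sub contDiffAt_const).add
      (D.W.starProjection.contDiff.contDiffAt.comp p₀ (hy₁.sub contDiffAt_const))
  have hnear : ∀ᶠ p in 𝓝[Q] p₀, y₁ p - y₁ p₀ ∈ D.W := by
    refine D.rational.eventually_mem (hy₁.continuousAt.tendsto.mono_left nhdsWithin_le_nhds) ?_
    filter_upwards [self_mem_nhdsWithin] with p hp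
    obtain ⟨z, hz, n, hn, hx, hy, -⟩ := hparam p hp
    refine ⟨n - n₀, sub_mem hn hn₀, ?_⟩
    convert sub_mem (hy₁W p hp z n hx hy).2 (hy₁W p₀ hp₀ z₀ n₀ hxz₀ hyz₀).2 using 1
    abel
  have hζspec : ∀ᶠ p in 𝓝[Q] p₀, p ∈ Q ∧ ζ p ∈ D.dom ∧ xx p = (D.coords (ζ p)).1 ∧
      yy p = D.y (ζ p) + n₀ ∧ X.param ψ (p.1, p.2.1) = D.pt (ζ p) := by
    filter_upwards [hnear, self_mem_nhdsWithin] with p h1 hp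
    obtain ⟨z, hz, n, hn, hx, hy, hpt⟩ := hparam p hp
    have h2 : y₁ p - n₀ ∈ D.W := by
      have := add_mem h1 (hy₁W p₀ hp₀ z₀ n₀ hxz₀ hyz₀).2
      convert this using 1
      abel
    have h3 : ζ p = (xx p - x₀) + (y₁ p - n₀) := by
      simp only [ζ]
      rw [D.W.starProjection_eq_self_iff.2 h2]
    have h4 : xx p = (D.coords (ζ p)).1 := by
      rw [h3, LocalModel.coords, map_add, starProjection_orthogonal_of_mem h2,
        (hy₁W p hp z n hx hy).1]
      simp
    have h5 : yy p = D.y (ζ p) + n₀ := by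
      rw [h3, D.y_add _ _ h2]
      simp only [y₁]
      abel
    have h6 : ζ p ∈ D.dom := by
      rw [h3]
      exact D.add_mem_dom (hmemdom p hp) h2
    refine ⟨hp, h6, h4, h5, ?_⟩
    have h7 : X.param ψ (p.1, p.2.1) = X.param φ (xx p, yy p) :=
      X.mk_eq_param φ (hsrc p hp).1 _
    rw [h7, h4, h5, param_add_mem_iff φ (D.coords_fst_mem h6) hn₀]
    rfl
  have hζ₀ := hζspec.self_of_nhdsWithin hp₀
  have hcov₀ : D.pt (ζ p₀) ∈ L.cover i := hζ₀.2.2.2.2 ▸ hp₀.2.1.2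
  have hconst : ∀ᶠ p in 𝓝[Q] p₀, E.e i (ζ p) = E.e i (ζ p₀) :=
    (hζ.continuousAt.tendsto.mono_left nhdsWithin_le_nhds).eventually
      (E.locallyConstant i _ hζ₀.2.1 hcov₀)
  have hzw₀ : (ζ p₀, ww p₀) ∈ D.hatDom U :=
    mem_hatDom_of (hsrc p₀ hp₀).1 hp₀.2.2 hζ₀.2.1 hζ₀.2.2.1
  have hTs : ContDiffWithinAt ℝ ∞ (fun p => T (ζ p) (ww p)
      fun a => D.W.starProjection (uu p a)) Q p₀ := by
    refine contDiffWithinAt_alternatingMap (T := fun p => T (ζ p) (ww p)) (fun u hu => ?_)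
      fun a => (huu a).contDiffWithinAt
    exact (ContDiffAt.comp (g := fun p : Coord g × Coord g => T p.1 p.2 u)
      (f := fun p => (ζ p, ww p)) p₀
      ((hT.smooth u hu).contDiffAt ((D.isOpen_hatDom hUo).mem_nhds hzw₀))
      (hζ.prodMk hww)).contDiffWithinAt
  refine ((contDiffWithinAt_const (c := (E.e i (ζ p₀) : ℂ))).mul hTs).congr_of_eventuallyEq_of_mem
    ?_ hp₀
  filter_upwards [hζspec, hconst] with p ⟨hp, h1, h2, h3, h4⟩ h5
  rw [ofModel_apply hT (hsrc p hp).1 h1 hn₀ (h4 ▸ hp.2.1.2) h2 h3 hp.2.2, h5]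

theorem isRelForm_ofModel (hU : U ⊆ D.hatBall) (hT : IsModelForm E U T) (hUo : IsOpen U) :
    IsRelForm L U (ofModel E T) := by
  refine ⟨contDiffOn_ofModel hU hT hUo, ?_, ?_⟩
  · intro i j b α v hα hv u _
    obtain ⟨hb, hbr⟩ : b ∈ φ.1.source ∧ φ.1 b ∈ Metric.ball x₀ D.r := hU hv
    obtain ⟨z, hz, n, hn, hx, hy, hpt⟩ := D.exists_param hb hbr hα.1
    have hi : D.pt z ∈ L.cover i := hpt ▸ hα.2.1
    have hj : D.pt z ∈ L.cover j := hpt ▸ hα.2.2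
    rw [ofModel_apply hT hb hz hn hi hx hy hv, ofModel_apply hT hb hz hn hj hx hy hv, hpt,
      E.glue i j z hz hi hj]
    push_cast
    ring
  · intro i b α v hα hv l hl μ hμ u _
    obtain ⟨hb, hbr⟩ : b ∈ φ.1.source ∧ φ.1 b ∈ Metric.ball x₀ D.r := hU hv
    obtain ⟨z, hz, n, hn, hx, hy, hpt⟩ := D.exists_param hb hbr hα.1
    have hi : D.pt z ∈ L.cover i := hpt ▸ hα.2
    have hl' := (mem_lattice_iff φ hb).1 hl
    have hμ' := (mem_dualLattice_iff φ hb).1 hμ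
    have hv' : (XHat.mk (v + μ) : XHat Λ) ∈ U := by
      have : (XHat.mk v : XHat Λ) = XHat.mk (v + μ) := XHat.mk_eq_mk.2 (by simpa using hμ)
      rw [← this]
      exact hv
    have hy' : ycoord φ.1 b (α + l) = D.y z + (n + ycoord φ.1 b l) := by
      rw [ycoord_add, hy, add_assoc]
    rw [ofModel_apply hT hb hz hn hi hx hy hv,
      ofModel_apply hT hb hz (add_mem hn hl') hi hx hy' hv', wcoord_add,
      hT.automorphy z _ (mem_hatDom_of hb hv hz hx) _ hμ' _ fun a => D.W.starProjection_apply_mem _]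
    have h1 : α μ = inner ℝ (D.y z) (wcoord φ.1 b μ) + inner ℝ n (wcoord φ.1 b μ) := by
      rw [← inner_ycoord φ.2.1 hb, hy, inner_add_left]
    obtain ⟨k, hk⟩ := exists_int_inner_eq hn hμ'
    rw [h1, hk]
    have h2 : Complex.exp (-(2 * Real.pi * Complex.I *
        ((inner ℝ (D.y z) (wcoord φ.1 b μ) + k : ℝ) : ℂ))) =
        Complex.exp (-(2 * Real.pi * Complex.I * (inner ℝ (D.y z) (wcoord φ.1 b μ) : ℝ))) := by
      rw [Complex.exp_eq_exp_iff_exists_int]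
      exact ⟨-k, by push_cast; ring⟩
    rw [h2]
    ring

end BuildForms

section ParametricIntegral

open MeasureTheory

universe v

variable {V H : Type v} [NormedAddCommGroup V] [NormedAddCommGroup H] {P : Set V} {F : V → ℝ → H}

theorem eventually_norm_le_of_continuousOn (hP : IsOpen P)
    (hF : ContinuousOn (Function.uncurry F) (P ×ˢ univ)) {p₀ : V} (hp₀ : p₀ ∈ P) :
    ∃ C, ∀ᶠ p in 𝓝 p₀, ∀ s ∈ Icc (0 : ℝ) 1, ‖F p s‖ ≤ C := by
  have hat : ∀ s, ContinuousAt (Function.uncurry F) (p₀, s) := fun s =>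
    hF.continuousAt ((hP.prod isOpen_univ).mem_nhds ⟨hp₀, trivial⟩)
  have h0 : Continuous fun s => F p₀ s := continuous_iff_continuousAt.2 fun s =>
    (hat s).comp (f := fun s => (p₀, s)) (by fun_prop)
  obtain ⟨C, hC⟩ := (isCompact_Icc (a := (0 : ℝ)) (b := 1)).exists_bound_of_continuousOn
    h0.continuousOn
  refine ⟨C + 1, isCompact_Icc.eventually_forall_of_forall_eventually fun s hs => ?_⟩
  have h1 : ‖Function.uncurry F (p₀, s)‖ < C + 1 := lt_of_le_of_lt (hC s hs) (lt_add_one C)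
  exact ((hat s).norm.tendsto.eventually_lt_const h1).mono fun z hz => le_of_lt hz

theorem continuous_section (hP : IsOpen P) (hF : ContinuousOn (Function.uncurry F) (P ×ˢ univ))
    {p : V} (hp : p ∈ P) : Continuous fun s => F p s :=
  continuous_iff_continuousAt.2 fun s =>
    (hF.continuousAt ((hP.prod isOpen_univ).mem_nhds ⟨hp, trivial⟩)).comp
      (f := fun s => (p, s)) (by fun_prop)

variable [NormedSpace ℝ H]

theorem continuousOn_parametric_integral (hP : IsOpen P)
    (hF : ContinuousOn (Function.uncurry F) (P ×ˢ univ)) :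
    ContinuousOn (fun p => ∫ s in (0 : ℝ)..1, F p s) P := by
  intro p₀ hp₀
  obtain ⟨C, hC⟩ := eventually_norm_le_of_continuousOn hP hF hp₀
  refine (intervalIntegral.continuousAt_of_dominated_interval (bound := fun _ => C) ?_ ?_
    intervalIntegrable_const ?_).continuousWithinAt
  · filter_upwards [hP.mem_nhds hp₀] with p hp
    exact (continuous_section hP hF hp).aestronglyMeasurable
  · filter_upwards [hC] with p hp
    refine Eventually.of_forall fun s hs => hp s ?_
    rw [uIoc_of_le zero_le_one] at hs
    exact Ioc_subset_Icc_self hs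
  · refine Eventually.of_forall fun s _ => ?_
    exact (hF.continuousAt ((hP.prod isOpen_univ).mem_nhds ⟨hp₀, trivial⟩)).comp
      (f := fun p => (p, s)) (by fun_prop)

variable [NormedSpace ℝ V]

theorem hasFDerivAt_parametric_integral (hP : IsOpen P)
    (hF : ContDiffOn ℝ 1 (Function.uncurry F) (P ×ˢ univ)) {p₀ : V} (hp₀ : p₀ ∈ P) :
    HasFDerivAt (fun p => ∫ s in (0 : ℝ)..1, F p s)
      (∫ s in (0 : ℝ)..1, (fderiv ℝ (Function.uncurry F) (p₀, s)).comp
        (ContinuousLinearMap.inl ℝ V ℝ)) p₀ := by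
  have hPo : IsOpen (P ×ˢ (univ : Set ℝ)) := hP.prod isOpen_univ
  have hF' : ContinuousOn (Function.uncurry fun p s =>
      (fderiv ℝ (Function.uncurry F) (p, s)).comp (ContinuousLinearMap.inl ℝ V ℝ)) (P ×ˢ univ) :=
    (hF.continuousOn_fderiv_of_isOpen hPo le_rfl).clm_comp continuousOn_const
  obtain ⟨C, hC⟩ := eventually_norm_le_of_continuousOn hP hF' hp₀
  refine intervalIntegral.hasFDerivAt_integral_of_dominated_of_fderiv_le
    (s := {p | p ∈ P ∧ ∀ s ∈ Icc (0 : ℝ) 1, ‖(fderiv ℝ (Function.uncurry F) (p, s)).comp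
      (ContinuousLinearMap.inl ℝ V ℝ)‖ ≤ C}) (bound := fun _ => C)
    (F' := fun p s => (fderiv ℝ (Function.uncurry F) (p, s)).comp (ContinuousLinearMap.inl ℝ V ℝ))
    (Filter.Eventually.and (hP.mem_nhds hp₀) hC) ?_ ?_ ?_ ?_ intervalIntegrable_const ?_
  · filter_upwards [hP.mem_nhds hp₀] with p hp
    exact (continuous_section hP hF.continuousOn hp).aestronglyMeasurable
  · exact (continuous_section hP hF.continuousOn hp₀).intervalIntegrable _ _
  · exact (continuous_section hP hF' hp₀).aestronglyMeasurable
  · refine Eventually.of_forall fun s hs p hp => hp.2 s ?_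
    rw [uIoc_of_le zero_le_one] at hs
    exact Ioc_subset_Icc_self hs
  · refine Eventually.of_forall fun s _ p hp => ?_
    have h1 : HasFDerivAt (Function.uncurry F) (fderiv ℝ (Function.uncurry F) (p, s)) (p, s) :=
      ((hF.contDiffAt (hPo.mem_nhds ⟨hp.1, trivial⟩)).differentiableAt one_ne_zero).hasFDerivAt
    exact HasFDerivAt.comp (f := fun p => (p, s)) p h1 (hasFDerivAt_prodMk_left p s)

theorem contDiffOn_parametric_integral_nat (n : ℕ) : ∀ {H : Type v} [NormedAddCommGroup H]
    [NormedSpace ℝ H] {F : V → ℝ → H}, IsOpen P →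
    ContDiffOn ℝ n (Function.uncurry F) (P ×ˢ univ) →
    ContDiffOn ℝ n (fun p => ∫ s in (0 : ℝ)..1, F p s) P := by
  induction n with
  | zero =>
    intro H _ _ F hP hF
    exact contDiffOn_zero.2 (continuousOn_parametric_integral hP hF.continuousOn)
  | succ n ih =>
    intro H _ _ F hP hF
    have hPo : IsOpen (P ×ˢ (univ : Set ℝ)) := hP.prod isOpen_univ
    have hd : ∀ p ∈ P, HasFDerivAt (fun p => ∫ s in (0 : ℝ)..1, F p s) _ p := fun p hp =>
      hasFDerivAt_parametric_integral hP (hF.of_le (by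
        norm_cast
        omega)) hp
    rw [Nat.cast_add, Nat.cast_one, contDiffOn_succ_iff_fderiv_of_isOpen hP]
    refine ⟨fun p hp => (hd p hp).differentiableAt.differentiableWithinAt, by simp, ?_⟩
    have h1 : ContDiffOn ℝ n (Function.uncurry fun p s =>
        (fderiv ℝ (Function.uncurry F) (p, s)).comp (ContinuousLinearMap.inl ℝ V ℝ))
        (P ×ˢ univ) :=
      (hF.fderiv_of_isOpen hPo (by norm_cast)).clm_comp contDiffOn_const
    exact (ih hP h1).congr fun p hp => (hd p hp).fderiv

theorem contDiffOn_parametric_integral (hP : IsOpen P)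
    (hF : ContDiffOn ℝ ∞ (Function.uncurry F) (P ×ˢ univ)) :
    ContDiffOn ℝ ∞ (fun p => ∫ s in (0 : ℝ)..1, F p s) P :=
  contDiffOn_infty.2 fun n => contDiffOn_parametric_integral_nat n hP
    (hF.of_le (by exact_mod_cast le_top))

theorem hasDerivAt_parametric_integral {F : ℝ → ℝ → ℂ}
    (hF : ContDiff ℝ ∞ (Function.uncurry F)) (t : ℝ) :
    HasDerivAt (fun t => ∫ s in (0 : ℝ)..1, F t s)
      (∫ s in (0 : ℝ)..1, deriv (fun t => F t s) t) t ∧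
    Continuous fun s => deriv (fun t => F t s) t := by
  have h1 : ∀ s, deriv (fun t => F t s) t = fderiv ℝ (Function.uncurry F) (t, s) (1, 0) := by
    intro s
    have h2 : HasFDerivAt (Function.uncurry F) (fderiv ℝ (Function.uncurry F) (t, s)) (t, s) :=
      (hF.differentiable (by simp) _).hasFDerivAt
    have h3 : HasDerivAt (fun t : ℝ => (t, s)) (1, 0) t :=
      (hasDerivAt_id t).prodMk (hasDerivAt_const t s)
    exact (h2.comp_hasDerivAt t h3).deriv
  have hc : Continuous (fderiv ℝ (Function.uncurry F)) := hF.continuous_fderiv (by simp)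
  have hc' : Continuous fun s => (fderiv ℝ (Function.uncurry F) (t, s)).comp
      (ContinuousLinearMap.inl ℝ ℝ ℝ) :=
    (hc.comp (by fun_prop : Continuous fun s : ℝ => (t, s))).clm_comp continuous_const
  constructor
  · have h2 := (hasFDerivAt_parametric_integral isOpen_univ
      ((hF.of_le (by simp)).contDiffOn (s := univ ×ˢ univ)) (mem_univ t)).hasDerivAt
    refine h2.congr_deriv ?_
    rw [ContinuousLinearMap.intervalIntegral_apply (hc'.intervalIntegrable _ _)]
    simp only [h1]
    rfl
  · simp only [h1]
    exact (hc.comp (by fun_prop : Continuous fun s : ℝ => (t, s))).clm_apply continuous_const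

open Classical in
/-- The integral over `[0, 1]` of a family of alternating maps. -/
def integralAlternating {E : Type*} [AddCommGroup E] [Module ℝ E] {q : ℕ}
    (A : ℝ → E [⋀^Fin q]→ₗ[ℝ] ℂ) : E [⋀^Fin q]→ₗ[ℝ] ℂ :=
  if h : ∀ u, IntervalIntegrable (fun s => A s u) volume 0 1 then
    { toFun := fun u => ∫ s in (0 : ℝ)..1, A s u
      map_update_add' := fun u i x y => by
        simp only [AlternatingMap.map_update_add]
        exact intervalIntegral.integral_add (h _) (h _)
      map_update_smul' := fun u i c x => by
        simp only [AlternatingMap.map_update_smul]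
        exact intervalIntegral.integral_smul _ _
      map_eq_zero_of_eq' := fun u i j hij hne => by
        simp [fun s => (A s).map_eq_zero_of_eq u hij hne] }
  else 0

theorem integralAlternating_apply {E : Type*} [AddCommGroup E] [Module ℝ E] {q : ℕ}
    {A : ℝ → E [⋀^Fin q]→ₗ[ℝ] ℂ}
    (h : ∀ u, IntervalIntegrable (fun s => A s u) volume 0 1) (u : Fin q → E) :
    integralAlternating A u = ∫ s in (0 : ℝ)..1, A s u := by
  rw [integralAlternating, dif_pos h]
  rfl

end ParametricIntegral

section Phase

/-- The character `r ↦ exp(2πi r)`. -/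
def phase (r : ℝ) : ℂ := Complex.exp (2 * Real.pi * Complex.I * r)

theorem phase_add (r s : ℝ) : phase (r + s) = phase r * phase s := by
  rw [phase, phase, phase, ← Complex.exp_add]
  push_cast
  ring_nf

theorem phase_int (n : ℤ) : phase n = 1 := by
  rw [phase, Complex.exp_eq_one_iff]
  exact ⟨n, by push_cast; ring⟩

theorem phase_eq_one_iff {r : ℝ} : phase r = 1 ↔ ∃ n : ℤ, r = n := by
  constructor
  · intro h
    rw [phase, Complex.exp_eq_one_iff] at h
    obtain ⟨n, hn⟩ := h
    refine ⟨n, ?_⟩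
    have h1 : (2 * Real.pi * Complex.I : ℂ) ≠ 0 := Complex.two_pi_I_ne_zero
    have h2 : (r : ℂ) = n := mul_left_cancel₀ h1 (by rw [hn]; ring)
    exact_mod_cast h2
  · rintro ⟨n, rfl⟩
    exact phase_int n

theorem phase_zero : phase 0 = 1 := by simp [phase]

theorem phase_ne_zero (r : ℝ) : phase r ≠ 0 := Complex.exp_ne_zero _

theorem phase_neg (r : ℝ) : phase (-r) = (phase r)⁻¹ := by
  rw [phase, phase, ← Complex.exp_neg]
  push_cast
  ring_nf

theorem exp_neg_eq_phase (r : ℝ) :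
    Complex.exp (-(2 * Real.pi * Complex.I * (r : ℂ))) = phase (-r) := by
  rw [phase]
  push_cast
  ring_nf

theorem contDiff_phase : ContDiff ℝ ∞ phase :=
  (contDiff_const.mul Complex.ofRealCLM.contDiff).cexp

theorem hasDerivAt_phase (r : ℝ) :
    HasDerivAt phase (2 * Real.pi * Complex.I * phase r) r := by
  have h1 : HasDerivAt (fun r : ℝ => 2 * Real.pi * Complex.I * (r : ℂ))
      (2 * Real.pi * Complex.I * 1) r :=
    (Complex.ofRealCLM.hasDerivAt (x := r)).const_mul _
  refine h1.cexp.congr_deriv ?_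
  rw [phase]
  ring

end Phase

section Exactness

variable {g : ℕ} {B : Type*} [TopologicalSpace B] [ChartedSpace (Coord g) B]
  {Λ : LagrangianCovering g B} {S : Set (X Λ)} {m : ℕ} {L : LocalSystem S}
  {φ : ActionChart Λ} {x₀ : Coord g} {q : ℕ} {D : LocalModel S φ m x₀} {E : FlatFrame D L}
  {U : Set (XHat Λ)}

/-- The holonomy along `l` of the restriction of `L ⊗ P` to a fibre. -/
def holonomy (E : FlatFrame D L) (l w : Coord g) : ℂ := phase (inner ℝ l w) * (E.hol l : ℂ)⁻¹

/-- A primitive of a closed trivialized form, defined by averaging along a loop with nontrivial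
holonomy. -/
def averagedForm (E : FlatFrame D L) (l : Coord g)
    (T : Coord g → Coord g → Coord g [⋀^Fin (q + 1)]→ₗ[ℝ] ℂ) (z w : Coord g) :
    Coord g [⋀^Fin q]→ₗ[ℝ] ℂ :=
  (holonomy E l w - 1)⁻¹ • integralAlternating fun s =>
    (phase (s * inner ℝ l w) • (T (z + s • l) w).curryLeft l).compLinearMap
      D.W.starProjection.toLinearMap

theorem vecCons_mem {W : Submodule ℝ (Coord g)} {l : Coord g} (hl : l ∈ W) {u : Fin q → Coord g}
    (hu : ∀ a, u a ∈ W) (a : Fin (q + 1)) : (Matrix.vecCons l u : Fin (q + 1) → Coord g) a ∈ W := by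
  refine Fin.cases ?_ (fun a => ?_) a
  · exact hl
  · exact hu a

/-- Smoothness of a trivialized form along planes in the fibres. -/
theorem IsModelForm.contDiff_line {T : Coord g → Coord g → Coord g [⋀^Fin q]→ₗ[ℝ] ℂ}
    (hT : IsModelForm E U T) (hU : IsOpen U) {z w : Coord g} (hzw : (z, w) ∈ D.hatDom U)
    {V : Type*} [NormedAddCommGroup V] [NormedSpace ℝ V] {f : V → Coord g} (hf : ContDiff ℝ ∞ f)
    (hfW : ∀ p, f p ∈ D.W) {u : Fin q → Coord g} (hu : ∀ a, u a ∈ D.W) :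
    ContDiff ℝ ∞ fun p => T (z + f p) w u := by
  refine contDiff_iff_contDiffAt.2 fun p => ?_
  exact ContDiffAt.comp (g := fun p : Coord g × Coord g => T p.1 p.2 u)
    (f := fun p => (z + f p, w)) p
    ((hT.smooth u hu).contDiffAt ((D.isOpen_hatDom hU).mem_nhds (D.add_mem_hatDom hzw (hfW p))))
    ((contDiffAt_const.add hf.contDiffAt).prodMk contDiffAt_const)

theorem averagedForm_apply {T : Coord g → Coord g → Coord g [⋀^Fin (q + 1)]→ₗ[ℝ] ℂ}
    (hT : IsModelForm E U T) (hU : IsOpen U) {z w l : Coord g} (hzw : (z, w) ∈ D.hatDom U)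
    (hl : l ∈ D.W) {u : Fin q → Coord g} (hu : ∀ a, u a ∈ D.W) :
    averagedForm E l T z w u = (holonomy E l w - 1)⁻¹ *
      ∫ s in (0 : ℝ)..1, phase (s * inner ℝ l w) * T (z + s • l) w (Matrix.vecCons l u) := by
  have hcont : ∀ u : Fin q → Coord g, (∀ a, u a ∈ D.W) → Continuous fun s : ℝ =>
      phase (s * inner ℝ l w) * T (z + s • l) w (Matrix.vecCons l u) := fun u hu =>
    (contDiff_phase.continuous.comp (by fun_prop)).mul
      (hT.contDiff_line hU hzw (f := fun s : ℝ => s • l) (by fun_prop)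
        (fun s => D.W.smul_mem s hl) (vecCons_mem hl hu)).continuous
  rw [averagedForm, AlternatingMap.smul_apply, smul_eq_mul, integralAlternating_apply]
  · congr 1
    refine intervalIntegral.integral_congr fun s _ => ?_
    have h1 : (fun a => D.W.starProjection (u a)) = u :=
      funext fun a => D.W.starProjection_eq_self_iff.2 (hu a)
    change phase (s * inner ℝ l w) * T (z + s • l) w
      (Matrix.vecCons l (fun a => D.W.starProjection (u a))) = _
    rw [h1]
  · intro u
    exact (hcont (fun a => D.W.starProjection (u a))
      fun a => D.W.starProjection_apply_mem _).intervalIntegrable _ _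

theorem holonomy_add_int (E : FlatFrame D L) {l μ : Coord g} (hl : l ∈ intLattice g)
    (hμ : μ ∈ intLattice g) (w : Coord g) : holonomy E l (w + μ) = holonomy E l w := by
  obtain ⟨k, hk⟩ := exists_int_inner_eq hl hμ
  rw [holonomy, holonomy, inner_add_right, hk, phase_add, phase_int, mul_one]

theorem contDiff_holonomy (E : FlatFrame D L) (l : Coord g) : ContDiff ℝ ∞ (holonomy E l) :=
  (contDiff_phase.comp (contDiff_const.inner ℝ contDiff_id)).mul contDiff_const

theorem contDiffOn_integral_zero_one {V : Type} [NormedAddCommGroup V] [NormedSpace ℝ V]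
    {P : Set V} {F : V × ℝ → ℂ} (hP : IsOpen P) (hF : ContDiffOn ℝ ∞ F (P ×ˢ univ)) :
    ContDiffOn ℝ ∞ (fun p => ∫ s in (0 : ℝ)..1, F (p, s)) P :=
  contDiffOn_parametric_integral (F := fun p s => F (p, s)) hP hF

theorem contDiffOn_averagedForm {T : Coord g → Coord g → Coord g [⋀^Fin (q + 1)]→ₗ[ℝ] ℂ}
    (hT : IsModelForm E U T) (hU : IsOpen U) {l : Coord g} (hl : l ∈ D.W)
    (hne : ∀ z w, (z, w) ∈ D.hatDom U → holonomy E l w ≠ 1) {u : Fin q → Coord g}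
    (hu : ∀ a, u a ∈ D.W) :
    ContDiffOn ℝ ∞ (fun p : Coord g × Coord g => averagedForm E l T p.1 p.2 u) (D.hatDom U) := by
  have h1 : ContDiffOn ℝ ∞ (fun p : Coord g × Coord g => (holonomy E l p.2 - 1)⁻¹)
      (D.hatDom U) := by
    have h2 : ContDiff ℝ ∞ fun p : Coord g × Coord g => holonomy E l p.2 :=
      ContDiff.comp (g := holonomy E l) (f := fun p : Coord g × Coord g => p.2)
        (contDiff_holonomy E l) contDiff_snd
    exact ContDiffOn.inv (h2.sub contDiff_const).contDiffOn
      fun p hp => sub_ne_zero.2 (hne p.1 p.2 hp)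
  have h2 : ContDiff ℝ ∞ fun p : (Coord g × Coord g) × ℝ => phase (p.2 * inner ℝ l p.1.2) := by
    have h3 : ContDiff ℝ ∞ fun p : (Coord g × Coord g) × ℝ => p.2 * innerSL ℝ l p.1.2 := by
      fun_prop
    exact ContDiff.comp (g := phase) (f := fun p : (Coord g × Coord g) × ℝ =>
      p.2 * inner ℝ l p.1.2) contDiff_phase h3
  have h4 : ContDiffOn ℝ ∞ (fun p : (Coord g × Coord g) × ℝ =>
      T (p.1.1 + p.2 • l) p.1.2 (Matrix.vecCons l u)) (D.hatDom U ×ˢ univ) := by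
    refine ContDiffOn.comp (g := fun p : Coord g × Coord g => T p.1 p.2 (Matrix.vecCons l u))
      (f := fun p : (Coord g × Coord g) × ℝ => (p.1.1 + p.2 • l, p.1.2))
      (hT.smooth _ (vecCons_mem hl hu)) ?_ ?_
    · have h5 : ContDiff ℝ ∞ fun p : (Coord g × Coord g) × ℝ => (p.1.1 + p.2 • l, p.1.2) := by
        fun_prop
      exact h5.contDiffOn
    · rintro ⟨⟨z, w⟩, s⟩ ⟨hp, -⟩
      exact D.add_mem_hatDom hp (D.W.smul_mem s hl)
  have h6 := contDiffOn_integral_zero_one (D.isOpen_hatDom hU) (h2.contDiffOn.mul h4)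
  refine (h1.mul h6).congr fun p hp => averagedForm_apply hT hU hp hl hu

theorem isModelForm_averagedForm {T : Coord g → Coord g → Coord g [⋀^Fin (q + 1)]→ₗ[ℝ] ℂ}
    (hT : IsModelForm E U T) (hU : IsOpen U) {l : Coord g} (hl : l ∈ D.W)
    (hl' : l ∈ intLattice g) (hne : ∀ z w, (z, w) ∈ D.hatDom U → holonomy E l w ≠ 1)
    (hper : ∀ z w, (z, w) ∈ D.hatDom U → ∀ μ ∈ intLattice g, (z, w + μ) ∈ D.hatDom U) :
    IsModelForm E U (averagedForm E l T) := by
  refine ⟨fun u hu => ?_, ?_, ?_⟩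
  · exact contDiffOn_averagedForm hT hU hl hne hu
  · intro z w hzw k hk hk' u hu
    rw [averagedForm_apply hT hU (D.add_mem_hatDom hzw hk) hl hu,
      averagedForm_apply hT hU hzw hl hu, mul_left_comm]
    congr 1
    rw [← intervalIntegral.integral_const_mul]
    refine intervalIntegral.integral_congr fun s _ => ?_
    rw [add_right_comm, hT.hol (z + s • l) w (D.add_mem_hatDom hzw (D.W.smul_mem s hl)) k hk hk' _
      (vecCons_mem hl hu)]
    ring
  · intro z w hzw μ hμ u hu
    rw [averagedForm_apply hT hU (hper z w hzw μ hμ) hl hu, averagedForm_apply hT hU hzw hl hu,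
      holonomy_add_int E hl' hμ, mul_left_comm]
    congr 1
    rw [← intervalIntegral.integral_const_mul]
    refine intervalIntegral.integral_congr fun s _ => ?_
    rw [hT.automorphy (z + s • l) w (D.add_mem_hatDom hzw (D.W.smul_mem s hl)) μ hμ _
      (vecCons_mem hl hu), D.y_add z _ (D.W.smul_mem s hl), exp_neg_eq_phase, exp_neg_eq_phase,
      inner_add_left, inner_add_right, inner_smul_left, neg_add, mul_add, phase_add, phase_add]
    have h1 : phase (s * inner ℝ l μ) * phase (-((starRingEnd ℝ) s * inner ℝ l μ)) = 1 := by
      rw [← phase_add]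
      simp [phase_zero]
    linear_combination (phase (s * inner ℝ l w) * phase (-inner ℝ (D.y z) μ) *
      T (z + s • l) w (Matrix.vecCons l u)) * h1

theorem vecCons_comp_succ_succAbove (l : Coord g) (u : Fin (q + 1) → Coord g) (b : Fin (q + 1)) :
    (fun c => (Matrix.vecCons l u : Fin (q + 2) → Coord g) (b.succ.succAbove c)) =
      Matrix.vecCons l fun c => u (b.succAbove c) := by
  ext1 c
  refine Fin.cases ?_ (fun c => ?_) c
  · simp
  · simp [Fin.succ_succAbove_succ]

theorem modelRelD_averagedForm {T : Coord g → Coord g → Coord g [⋀^Fin (q + 1)]→ₗ[ℝ] ℂ}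
    (hT : IsModelForm E U T) (hU : IsOpen U) {l : Coord g} (hl : l ∈ D.W)
    (hl' : l ∈ intLattice g)
    (hclosed : ∀ z w, (z, w) ∈ D.hatDom U → ∀ u : Fin (q + 2) → Coord g, (∀ a, u a ∈ D.W) →
      modelRelD T z w u = 0)
    {z w : Coord g} (hzw : (z, w) ∈ D.hatDom U) (hne : holonomy E l w ≠ 1)
    {u : Fin (q + 1) → Coord g} (hu : ∀ a, u a ∈ D.W) :
    modelRelD (averagedForm E l T) z w u = T z w u := by
  set c := (holonomy E l w - 1)⁻¹ with hc
  have hc0 : holonomy E l w - 1 ≠ 0 := sub_ne_zero.2 hne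
  let F : Fin (q + 1) → ℝ → ℝ → ℂ := fun a t s => phase (s * inner ℝ l w) *
    T ((z + s • l) + t • u a) w (Matrix.vecCons l fun c => u (a.succAbove c))
  have hF : ∀ a, ContDiff ℝ ∞ (Function.uncurry (F a)) := by
    intro a
    refine ContDiff.mul (contDiff_phase.comp (contDiff_snd.mul contDiff_const)) ?_
    have := hT.contDiff_line hU hzw (f := fun p : ℝ × ℝ => p.2 • l + p.1 • u a) (by fun_prop)
      (fun p => add_mem (D.W.smul_mem _ hl) (D.W.smul_mem _ (hu a)))
      (u := Matrix.vecCons l fun c => u (a.succAbove c)) (vecCons_mem hl fun c => hu _)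
    simp only [← add_assoc] at this
    exact this
  have hG : ContDiff ℝ ∞ fun s : ℝ => T (z + s • l) w u :=
    hT.contDiff_line hU hzw (f := fun s : ℝ => s • l) (by fun_prop)
      (fun s => D.W.smul_mem s hl) hu
  have hval : ∀ a : Fin (q + 1),
      deriv (fun t : ℝ => averagedForm E l T (z + t • u a) w (fun c => u (a.succAbove c))) 0 +
      2 * Real.pi * Complex.I * (inner ℝ (u a) w : ℝ) *
        averagedForm E l T z w (fun c => u (a.succAbove c)) =
      c * ∫ s in (0 : ℝ)..1, (deriv (fun t => F a t s) 0 +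
        2 * Real.pi * Complex.I * (inner ℝ (u a) w : ℝ) * F a 0 s) := by
    intro a
    obtain ⟨h1, h2⟩ := hasDerivAt_parametric_integral (hF a) 0
    have h3 : (fun t : ℝ => averagedForm E l T (z + t • u a) w (fun c => u (a.succAbove c))) =
        fun t => c * ∫ s in (0 : ℝ)..1, F a t s := by
      ext1 t
      rw [averagedForm_apply hT hU (D.add_mem_hatDom hzw (D.W.smul_mem t (hu a))) hl fun c => hu _]
      simp only [F, hc, add_right_comm]
    have h4 : averagedForm E l T z w (fun c => u (a.succAbove c)) =
        c * ∫ s in (0 : ℝ)..1, F a 0 s := by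
      rw [averagedForm_apply hT hU hzw hl fun c => hu _]
      simp [F, hc]
    have h5 : Continuous fun s => F a 0 s :=
      (hF a).continuous.comp (by fun_prop : Continuous fun s : ℝ => ((0 : ℝ), s))
    have h6 : Continuous fun s => 2 * Real.pi * Complex.I * (inner ℝ (u a) w : ℝ) * F a 0 s :=
      continuous_const.mul h5
    rw [h3, (h1.const_mul c).deriv, h4, intervalIntegral.integral_add (h2.intervalIntegrable _ _)
      (h6.intervalIntegrable _ _), intervalIntegral.integral_const_mul]
    ring
  have hcont : ∀ a : Fin (q + 1), Continuous fun s => (deriv (fun t => F a t s) 0 +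
        2 * Real.pi * Complex.I * (inner ℝ (u a) w : ℝ) * F a 0 s) := fun a =>
    (hasDerivAt_parametric_integral (hF a) 0).2.add (continuous_const.mul
      ((hF a).continuous.comp (by fun_prop : Continuous fun s : ℝ => ((0 : ℝ), s))))
  have hcont' : ∀ a : Fin (q + 1), Continuous fun s => (-1 : ℂ) ^ (a : ℕ) *
      (deriv (fun t => F a t s) 0 + 2 * Real.pi * Complex.I * (inner ℝ (u a) w : ℝ) * F a 0 s) :=
    fun a => continuous_const.mul (hcont a)
  have hsum : modelRelD (averagedForm E l T) z w u = c * ∫ s in (0 : ℝ)..1,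
      ∑ a : Fin (q + 1), (-1 : ℂ) ^ (a : ℕ) * (deriv (fun t => F a t s) 0 +
        2 * Real.pi * Complex.I * (inner ℝ (u a) w : ℝ) * F a 0 s) := by
    rw [modelRelD, intervalIntegral.integral_finsetSum fun a _ =>
      (hcont' a).intervalIntegrable _ _, Finset.mul_sum]
    refine Finset.sum_congr rfl fun a _ => ?_
    rw [hval a, intervalIntegral.integral_const_mul]
    ring
  have hder : ∀ s : ℝ, HasDerivAt (fun s => phase (s * inner ℝ l w) * T (z + s • l) w u)
      (∑ a : Fin (q + 1), (-1 : ℂ) ^ (a : ℕ) * (deriv (fun t => F a t s) 0 +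
        2 * Real.pi * Complex.I * (inner ℝ (u a) w : ℝ) * F a 0 s)) s := by
    intro s
    have h1 := hclosed (z + s • l) w (D.add_mem_hatDom hzw (D.W.smul_mem s hl))
      (Matrix.vecCons l u) (vecCons_mem hl hu)
    rw [modelRelD, Fin.sum_univ_succ] at h1
    simp only [vecCons_comp_succ_succAbove, Fin.val_succ, Matrix.cons_val_succ,
      Matrix.cons_val_zero, Fin.val_zero, pow_zero, one_mul, Fin.succAbove_zero] at h1
    have h2 : HasDerivAt (fun s => T (z + s • l) w u)
        (deriv (fun t : ℝ => T (z + s • l + t • l) w u) 0) s := by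
      have h3 : HasDerivAt (fun s => T (z + s • l) w u) (deriv (fun s => T (z + s • l) w u) s) s :=
        (hG.differentiable (by simp) s).hasDerivAt
      have h4 : (fun t : ℝ => T (z + s • l + t • l) w u) =
          fun t => (fun s => T (z + s • l) w u) (s + t) := by
        ext1 t
        dsimp only
        rw [add_smul, add_assoc]
      rw [h4, deriv_comp_const_add (f := fun s => T (z + s • l) w u), add_zero]
      exact h3
    have h5 : HasDerivAt (fun s : ℝ => phase (s * inner ℝ l w))
        (2 * Real.pi * Complex.I * phase (s * inner ℝ l w) * (inner ℝ l w : ℝ)) s := by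
      have h6 : HasDerivAt (fun s : ℝ => s * inner ℝ l w) (inner ℝ l w) s := by
        simpa using (hasDerivAt_id s).mul_const (inner ℝ l w)
      have := (hasDerivAt_phase (s * inner ℝ l w)).scomp s h6
      refine this.congr_deriv ?_
      rw [Complex.real_smul]
      ring
    refine (h5.mul h2).congr_deriv ?_
    have h6 : ∀ a : Fin (q + 1), (-1 : ℂ) ^ (a : ℕ) * (deriv (fun t => F a t s) 0 +
        2 * Real.pi * Complex.I * (inner ℝ (u a) w : ℝ) * F a 0 s) =
        phase (s * inner ℝ l w) * -((-1 : ℂ) ^ ((a : ℕ) + 1) *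
        (deriv (fun t : ℝ => T (z + s • l + t • u a) w
          (Matrix.vecCons l fun c => u (a.succAbove c))) 0 +
        2 * Real.pi * Complex.I * (inner ℝ (u a) w : ℝ) *
          T (z + s • l) w (Matrix.vecCons l fun c => u (a.succAbove c)))) := by
      intro a
      simp only [F, deriv_const_mul_field, zero_smul, add_zero]
      ring
    rw [Finset.sum_congr rfl fun a _ => h6 a, ← Finset.mul_sum, Finset.sum_neg_distrib]
    have h7 : (fun c => (Matrix.vecCons l u : Fin (q + 2) → Coord g) c.succ) = u := by
      ext1 c
      simp
    linear_combination (phase (s * inner ℝ l w)) * h1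
  rw [hsum, intervalIntegral.integral_eq_sub_of_hasDerivAt (fun s _ => hder s)
    ((continuous_finsetSum _ fun a _ => hcont' a).intervalIntegrable _ _)]
  have h1 := hT.hol z w hzw l hl hl' u hu
  simp only [one_smul, zero_smul, add_zero, zero_mul, one_mul, phase_zero, h1]
  have h2 : phase (inner ℝ l w) * ((E.hol l : ℂ)⁻¹ * T z w u) - T z w u =
      (holonomy E l w - 1) * T z w u := by
    rw [holonomy]
    ring
  rw [h2, hc, inv_mul_cancel_left₀ hc0]

end Exactness

section Vanishing

variable {g : ℕ} {B : Type*} [TopologicalSpace B] [ChartedSpace (Coord g) B]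
  {Λ : LagrangianCovering g B} {S : Set (X Λ)} {m : ℕ} {L : LocalSystem S}
  {φ : ActionChart Λ} {x₀ : Coord g} {q : ℕ} {U : Set (XHat Λ)}

theorem isRelForm_zero (L : LocalSystem S) (U : Set (XHat Λ)) :
    IsRelForm L U (0 : FormData L q) := by
  refine ⟨fun i φ u => contDiffOn_const (c := (0 : ℂ)), ?_, ?_⟩
  · intro i j b α v _ _ u _
    simp
  · intro i b α v _ _ l _ μ _ u _
    simp

theorem isRelExact_of_fibre_eq_empty {τ : FormData L q}
    (h : ∀ (b : B) (v : Tan g b), XHat.mk v ∈ U → ∀ α : Cot g b, X.mk α ∉ S) :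
    IsRelExact U τ := by
  cases q with
  | zero => exact fun i b α v hα hv => absurd hα.1 (h b v hv α)
  | succ q =>
    exact ⟨0, isRelForm_zero L U, fun i b α v hα hv => absurd hα.1 (h b v hv α)⟩

theorem IsRelForm.mono {U' : Set (XHat Λ)} (hU : U' ⊆ U) {τ : FormData L q}
    (hτ : IsRelForm L U τ) : IsRelForm L U' τ where
  smooth i φ u := (hτ.smooth i φ u).mono fun _ hp => ⟨hp.1, hp.2.1, hU hp.2.2⟩
  glue i j b α v hα hv := hτ.glue i j b α v hα (hU hv)
  automorphy i b α v hα hv := hτ.automorphy i b α v hα (hU hv)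

theorem hol_zero {D : LocalModel S φ m x₀} (E : FlatFrame D L) : E.hol 0 = 1 := by
  obtain ⟨i, hi⟩ := L.exists_mem_cover (D.pt_mem D.zero_mem_dom)
  have := E.e_add i 0 D.zero_mem_dom hi 0 (zero_mem _) (zero_mem _)
  simpa using this

variable [IsManifold (𝓡 g) ∞ B]

theorem fst_mem_of_mem_transformSupport (hS : IsClosed S) {ξ : XHat Λ}
    (hξ : ξ ∈ transformSupport L q) : ξ.1 ∈ X.proj '' S := by
  by_contra hne
  obtain ⟨U, hU, hξU, τ, -, -, hex⟩ := hξ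
  obtain ⟨φ, hφ, hb⟩ := Λ.exists_actionChart ξ.1
  let φ' : ActionChart Λ := ⟨φ, hφ⟩
  have hx : φ ξ.1 ∈ φ.target := φ.map_source hb
  have hev : ∀ᶠ x in 𝓝 (φ ξ.1), ∀ y, x ∈ φ.target ∧ X.param φ' (x, y) ∉ S := by
    refine eventually_forall_of_periodic (Q := fun p => p.1 ∈ φ.target ∧ X.param φ' p ∉ S) ?_ ?_
    · intro y
      refine (isOpen_notMem_chart hS φ').mem_nhds ⟨hx, fun hy => hne ⟨_, hy, ?_⟩⟩
      exact φ.left_inv hb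
    · rintro x y n hn ⟨hx, hy⟩
      refine ⟨hx, ?_⟩
      rwa [param_add_mem_iff φ' hx hn]
  obtain ⟨N, hN, hNo, hxN⟩ := eventually_nhds_iff.1 hev
  have hV : IsOpen {η : XHat Λ | η.1 ∈ φ.source ∧ φ η.1 ∈ N} :=
    (φ.continuousOn.isOpen_inter_preimage φ.open_source hNo).preimage XHat.continuous_proj
  refine hex (U ∩ {η : XHat Λ | η.1 ∈ φ.source ∧ φ η.1 ∈ N}) inter_subset_left (hU.inter hV)
    ⟨hξU, hb, hxN⟩ (isRelExact_of_fibre_eq_empty ?_)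
  intro b v hv α
  have h1 : X.mk α = X.param φ' (φ b, ycoord φ b α) := X.mk_eq_param φ' hv.2.1 α
  rw [h1]
  exact (hN _ hv.2.2 _).2

variable {D : LocalModel S φ m x₀} {E : FlatFrame D L}

theorem LocalModel.hatDom_add_int (D : LocalModel S φ m x₀) {z w μ : Coord g}
    (hzw : (z, w) ∈ D.hatDom U) (hμ : μ ∈ intLattice g) : (z, w + μ) ∈ D.hatDom U := by
  have hx := D.coords_fst_mem hzw.1
  refine ⟨hzw.1, ?_⟩
  rw [(XHat.param_eq_param φ (p := ((D.coords z).1, w + μ)) (q := ((D.coords z).1, w)) hx hx).2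
    ⟨rfl, by simpa using hμ⟩]
  exact hzw.2

/-- The points of `S ×_B U` and the vectors tangent to the fibres of `S` are given by the
parametrization. -/
theorem LocalModel.forall_of_params (D : LocalModel S φ m x₀) (hU : U ⊆ D.hatBall) {i : L.ι}
    (P : ∀ b : B, Cot g b → Tan g b → (Fin q → Cot g b) → Prop)
    (h : ∀ z w n, (z, w) ∈ D.hatDom U → D.pt z ∈ L.cover i → n ∈ intLattice g →
      ∀ u : Fin q → Coord g, (∀ a, u a ∈ D.W) →
      P (D.base z) (cot φ.1 (D.base z) (D.y z + n)) (tan φ.1 (D.coords z).1 w)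
        fun a => cot φ.1 (D.base z) (u a))
    (b : B) (α : Cot g b) (v : Tan g b) (hα : X.mk α ∈ S ∩ L.cover i) (hv : XHat.mk v ∈ U)
    (u : Fin q → Cot g b) (hu : ∀ a, u a ∈ vertTangent S α) : P b α v u := by
  obtain ⟨hb, hbr⟩ : b ∈ φ.1.source ∧ φ.1 b ∈ Metric.ball x₀ D.r := hU hv
  obtain ⟨z, hz, n, hn, hx, hy, hpt⟩ := D.exists_param hb hbr hα.1
  have hzw := mem_hatDom_of hb hv hz hx
  have hu' : ∀ a, ycoord φ.1 b (u a) ∈ D.W := fun a =>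
    (D.mem_vertTangent_iff hb hbr hα.1).1 (hu a)
  obtain rfl : b = D.base z := by rw [LocalModel.base, ← hx, φ.1.left_inv hb]
  have h1 := h z _ n hzw (hpt ▸ hα.2) hn _ hu'
  rw [← hy, cot_ycoord φ.2.1 hb, tan_wcoord φ.2.1 (D.coords_fst_mem hz)] at h1
  simpa only [cot_ycoord φ.2.1 hb] using h1

theorem modelRelD_eq_zero {τ : FormData L q} {T : Coord g → Coord g → Coord g [⋀^Fin q]→ₗ[ℝ] ℂ}
    (hT : Represents E U τ T) (hclosed : IsRelClosed U τ) {z w : Coord g}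
    (hzw : (z, w) ∈ D.hatDom U) {u : Fin (q + 1) → Coord g} (hu : ∀ a, u a ∈ D.W) :
    modelRelD T z w u = 0 := by
  obtain ⟨i, hi⟩ := L.exists_mem_cover (D.pt_mem hzw.1)
  have h0 : (0 : Coord g) ∈ intLattice g := zero_mem _
  have h1 := hT.relD_eq hzw hi h0 hu
  rw [hclosed i _ _ _ (by rw [D.mk_eq_pt hzw.1 h0]; exact ⟨D.pt_mem hzw.1, hi⟩) hzw.2 _
    fun a => D.cot_mem_vertTangent hzw.1 h0 (hu a)] at h1
  exact (mul_eq_zero.1 h1.symm).resolve_left (Circle.coe_ne_zero _)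

theorem notMem_transformSupport_of_holonomy_ne_one (E : FlatFrame D L) {l : Coord g}
    (hl : l ∈ D.W) (hl' : l ∈ intLattice g) {x w : Coord g} (hx : x ∈ Metric.ball x₀ D.r)
    (hw : holonomy E l w ≠ 1) : XHat.param φ (x, w) ∉ transformSupport L (q + 1) := by
  rintro ⟨U, hU, hξU, τ, hτ, hclosed, hex⟩
  let O : Set (Coord g × Coord g) := {p | p.1 ∈ Metric.ball x₀ D.r ∧ holonomy E l p.2 ≠ 1}
  have hO : IsOpen O := (Metric.isOpen_ball.preimage continuous_fst).inter
    (isOpen_ne.preimage ((contDiff_holonomy E l).continuous.comp continuous_snd))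
  set V := XHat.param φ '' O
  have hV : IsOpen V := XHat.isOpen_image_param φ hO fun p hp => D.ball_subset hp.1
  have hVball : V ⊆ D.hatBall := by
    rintro _ ⟨p, hp, rfl⟩
    have h1 := D.ball_subset hp.1
    refine ⟨φ.1.map_target h1, ?_⟩
    have h2 : φ.1 (φ.1.symm p.1) = p.1 := φ.1.right_inv h1
    exact h2.symm ▸ hp.1
  have hUV : IsOpen (U ∩ V) := hU.inter hV
  have hne : ∀ z w, (z, w) ∈ D.hatDom (U ∩ V) → holonomy E l w ≠ 1 := by
    rintro z w ⟨hz, -, ⟨⟨x', w'⟩, hp, heq⟩⟩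
    obtain ⟨-, h1⟩ := (XHat.param_eq_param φ (q := ((D.coords z).1, w))
      (D.ball_subset hp.1) (D.coords_fst_mem hz)).1 heq
    have h2 := holonomy_add_int E hl' h1 w'
    have h3 : w' + (w - w') = w := by abel
    simp only [h3] at h2
    rw [h2]
    exact hp.2
  obtain ⟨idx, hidx⟩ := D.exists_index L
  have hτ' := hτ.mono (inter_subset_left (t := V))
  have hrep := hτ'.represents E hidx
  have hT := hτ'.isModelForm hUV hrep
  have hcl : IsRelClosed (U ∩ V) τ := fun i b α v hα hv => hclosed i b α v hα hv.1
  have hA := isModelForm_averagedForm hT hUV hl hl' hne fun z w hzw μ hμ => D.hatDom_add_int hzw hμ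
  have hball : U ∩ V ⊆ D.hatBall := inter_subset_right.trans hVball
  refine hex (U ∩ V) inter_subset_left hUV ⟨hξU, ⟨(x, w), ⟨hx, hw⟩, rfl⟩⟩
    ⟨ofModel E (averagedForm E l (trivialize E τ idx)), isRelForm_ofModel hball hA hUV, ?_⟩
  intro i
  refine D.forall_of_params hball (fun b α v u => τ i b α v u = relD _ i b α v u) ?_
  intro z w n hzw hi hn u hu
  rw [(represents_ofModel hA).relD_eq hzw hi hn hu, hrep i z w hzw hi n hn u hu,
    modelRelD_averagedForm hT hUV hl hl'
      (fun z w hzw u hu => modelRelD_eq_zero hrep hcl hzw hu) hzw (hne z w hzw) hu]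

end Vanishing

section Rounding

variable {g : ℕ}

/-- The nearest integral vector. -/
def roundVec (w : Coord g) : Coord g := WithLp.toLp 2 fun j => (round (w j) : ℝ)

theorem roundVec_mem (w : Coord g) : roundVec w ∈ intLattice g := ⟨fun j => round (w j), rfl⟩

theorem roundVec_add {n : Coord g} (hn : n ∈ intLattice g) (w : Coord g) :
    roundVec (w + n) = roundVec w + n := by
  obtain ⟨k, rfl⟩ := hn
  ext j
  simp [roundVec, round_add_intCast]

theorem roundVec_eq_zero {w : Coord g} (hw : ‖w‖ < 1 / 2) : roundVec w = 0 := by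
  ext j
  have h1 : |w j| < 1 / 2 := lt_of_le_of_lt (PiLp.norm_apply_le w j) hw
  have h2 : round (w j) = 0 := by
    rw [round_eq_zero_iff]
    exact ⟨(abs_lt.1 h1).1.le, (abs_lt.1 h1).2⟩
  simp [roundVec, h2]

theorem roundVec_eq {w n : Coord g} (hn : n ∈ intLattice g) (h : ‖w - n‖ < 1 / 2) :
    roundVec w = n := by
  have := roundVec_add hn (w - n)
  rwa [sub_add_cancel, roundVec_eq_zero h, zero_add] at this

end Rounding

section Periodic

open MeasureTheory

theorem integral_divergence_eq_zero_of_periodic {q : ℕ} {G : Fin (q + 1) → (Fin (q + 1) → ℝ) → ℂ}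
    (hG : ∀ a, ContDiff ℝ ∞ (G a)) (hper : ∀ a t, G a (t + Pi.single a 1) = G a t) :
    ∫ t in Icc (0 : Fin (q + 1) → ℝ) 1, ∑ a, fderiv ℝ (G a) t (Pi.single a 1) = 0 := by
  have hc : Continuous fun t => ∑ a, fderiv ℝ (G a) t (Pi.single a 1) :=
    continuous_finsetSum _ fun a _ =>
      ((hG a).continuous_fderiv (by simp)).clm_apply continuous_const
  rw [integral_divergence_of_hasFDerivAt_off_countable' 0 1 zero_le_one G
    (fun a => fderiv ℝ (G a)) ∅ countable_empty (fun a => (hG a).continuous.continuousOn)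
    (fun t _ a => ((hG a).differentiable (by simp) t).hasFDerivAt)
    (hc.continuousOn.integrableOn_compact isCompact_Icc)]
  refine Finset.sum_eq_zero fun a _ => sub_eq_zero.2 ?_
  congr 1
  ext1 t
  refine Eq.trans ?_ (hper a _)
  congr 1
  ext j
  refine Fin.succAboveCases a ?_ (fun j => ?_) j
  · simp
  · simp

end Periodic

section TopForms

variable {g m : ℕ} {W : Submodule ℝ (Coord g)}

theorem exists_topForm (hm : Module.finrank ℝ W = m) {l : Fin m → Coord g} (hl : ∀ j, l j ∈ W)
    (hli : LinearIndependent ℝ l) : ∃ vol : Coord g [⋀^Fin m]→ₗ[ℝ] ℂ, vol l = 1 := by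
  let l' : Fin m → W := fun j => ⟨l j, hl j⟩
  have hli' : LinearIndependent ℝ l' := LinearIndependent.of_comp W.subtype hli
  let b := basisOfLinearIndependentOfCardEqFinrank' l' hli' (by simp [hm])
  have hb : ⇑b = l' := coe_basisOfLinearIndependentOfCardEqFinrank' _ _ _
  refine ⟨Complex.ofRealCLM.toLinearMap.compAlternatingMap
    (b.det.compLinearMap W.orthogonalProjectionOnto.toLinearMap), ?_⟩
  have h1 : (fun j => W.orthogonalProjectionOnto (l j)) = l' := funext fun j =>
    W.orthogonalProjectionOnto_mem_subspace_eq_self (l' j)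
  change ((b.det fun j => W.orthogonalProjectionOnto (l j) : ℝ) : ℂ) = 1
  rw [h1, ← hb, b.det_self, Complex.ofReal_one]

theorem sum_inner_mul_topForm (hm : Module.finrank ℝ W = m) (vol : Coord g [⋀^Fin m]→ₗ[ℝ] ℂ)
    (c : Coord g) {u : Fin (m + 1) → Coord g} (hu : ∀ a, u a ∈ W) :
    ∑ a : Fin (m + 1), (-1 : ℂ) ^ (a : ℕ) * ((inner ℝ (u a) c : ℝ) *
      vol fun j => u (a.succAbove j)) = 0 := by
  let f : Coord g →ₗ[ℝ] Coord g [⋀^Fin m]→ₗ[ℝ] ℂ := ((innerSL ℝ c).toLinearMap).smulRight vol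
  have hdep : ¬ LinearIndependent ℝ u := by
    intro h
    have h1 : LinearIndependent ℝ (fun a => (⟨u a, hu a⟩ : W)) :=
      LinearIndependent.of_comp W.subtype h
    have := h1.fintype_card_le_finrank
    rw [hm, Fintype.card_fin] at this
    omega
  have h2 := (AlternatingMap.alternatizeUncurryFin f).map_linearDependent u hdep
  rw [AlternatingMap.alternatizeUncurryFin_apply] at h2
  rw [← h2]
  refine Finset.sum_congr rfl fun a _ => ?_
  have h3 : f (u a) (a.removeNth u) = (inner ℝ (u a) c : ℝ) * vol fun j => u (a.succAbove j) := by
    change (inner ℝ c (u a) : ℝ) • vol (a.removeNth u) = _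
    rw [real_inner_comm, Complex.real_smul]
    rfl
  rw [h3, zsmul_eq_mul]
  push_cast
  rfl

end TopForms

section Nonvanishing

variable {g : ℕ} {B : Type*} [TopologicalSpace B] [ChartedSpace (Coord g) B]
  {Λ : LagrangianCovering g B} {S : Set (X Λ)} {m : ℕ} {L : LocalSystem S}
  {φ : ActionChart Λ} {x₀ : Coord g} {q : ℕ} {U : Set (XHat Λ)}

/-- A form of constant coefficients along the fibres, which is parallel at `w = w₀`. -/
def constantForm (D : LocalModel S φ m x₀) (vol : Coord g [⋀^Fin q]→ₗ[ℝ] ℂ) (w₀ z w : Coord g) :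
    Coord g [⋀^Fin q]→ₗ[ℝ] ℂ :=
  phase (-inner ℝ (D.y z) (w₀ + roundVec (w - w₀))) • vol

/-- The points over the domain of a local model near the translates of `w₀`. -/
def LocalModel.nearHat (D : LocalModel S φ m x₀) (w₀ : Coord g) : Set (XHat Λ) :=
  XHat.param φ '' {p | p.1 ∈ Metric.ball x₀ D.r ∧
    ∃ n ∈ intLattice g, ‖p.2 - w₀ - n‖ < 1 / 2}

variable {D : LocalModel S φ m x₀} {E : FlatFrame D L} {w₀ : Coord g}

theorem LocalModel.nearHat_subset (D : LocalModel S φ m x₀) (w₀ : Coord g) :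
    D.nearHat w₀ ⊆ D.hatBall := by
  rintro _ ⟨p, hp, rfl⟩
  have h1 := D.ball_subset hp.1
  refine ⟨φ.1.map_target h1, ?_⟩
  have h2 : φ.1 (φ.1.symm p.1) = p.1 := φ.1.right_inv h1
  exact h2.symm ▸ hp.1

theorem modelRelD_constantForm (vol : Coord g [⋀^Fin m]→ₗ[ℝ] ℂ) (z w : Coord g)
    {u : Fin (m + 1) → Coord g} (hu : ∀ a, u a ∈ D.W) :
    modelRelD (constantForm D vol w₀) z w u = 0 := by
  set ρ := w₀ + roundVec (w - w₀) with hρ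
  have h1 : ∀ a, deriv (fun t : ℝ => constantForm D vol w₀ (z + t • u a) w
      (fun c => u (a.succAbove c))) 0 = -(2 * Real.pi * Complex.I * (inner ℝ (u a) ρ : ℝ)) *
      constantForm D vol w₀ z w (fun c => u (a.succAbove c)) := by
    intro a
    have h2 : ∀ t : ℝ, constantForm D vol w₀ (z + t • u a) w (fun c => u (a.succAbove c)) =
        phase (-(inner ℝ (D.y z) ρ) + t * -(inner ℝ (u a) ρ)) *
          vol fun c => u (a.succAbove c) := by
      intro t
      rw [constantForm, D.y_add z _ (D.W.smul_mem t (hu a)), ← hρ, inner_add_left,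
        real_inner_smul_left, AlternatingMap.smul_apply, smul_eq_mul]
      congr 2
      ring
    have h3 : HasDerivAt (fun t : ℝ => -(inner ℝ (D.y z) ρ) + t * -(inner ℝ (u a) ρ))
        (-(inner ℝ (u a) ρ)) 0 := by
      simpa using ((hasDerivAt_id (0 : ℝ)).mul_const (-(inner ℝ (u a) ρ))).const_add
        (-(inner ℝ (D.y z) ρ))
    have h4 := ((hasDerivAt_phase _).scomp (0 : ℝ) h3).mul_const
      (vol fun c => u (a.succAbove c))
    simp only [h2]
    refine h4.deriv.trans ?_
    rw [constantForm, ← hρ, AlternatingMap.smul_apply, smul_eq_mul, Complex.real_smul]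
    simp only [zero_mul, add_zero]
    push_cast
    ring
  have h5 := sum_inner_mul_topForm D.finrank_eq vol (w - ρ) hu
  rw [modelRelD]
  have h6 : (2 * Real.pi * Complex.I * phase (-inner ℝ (D.y z) ρ)) *
      ∑ a : Fin (m + 1), (-1 : ℂ) ^ (a : ℕ) * ((inner ℝ (u a) (w - ρ) : ℝ) *
        vol fun j => u (a.succAbove j)) = 0 := by rw [h5, mul_zero]
  rw [← h6, Finset.mul_sum]
  refine Finset.sum_congr rfl fun a _ => ?_
  rw [h1, constantForm, ← hρ, AlternatingMap.smul_apply, smul_eq_mul, inner_sub_right]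
  push_cast
  ring

/-- The form `constantForm D vol w₀` is not exact along a fibre at `w₀`: its integral over the
fibre, in a parallel frame, does not vanish. -/
theorem modelRelD_ne_constantForm {l : Fin (q + 1) → Coord g} (hl : ∀ j, l j ∈ D.W)
    (hl' : ∀ j, l j ∈ intLattice g) {vol : Coord g [⋀^Fin (q + 1)]→ₗ[ℝ] ℂ} (hvol : vol l = 1)
    (hw₀ : ∀ l ∈ D.W, l ∈ intLattice g → holonomy E l w₀ = 1)
    {T : Coord g → Coord g → Coord g [⋀^Fin q]→ₗ[ℝ] ℂ} (hU : IsOpen U) (hT : IsModelForm E U T)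
    {z₀ : Coord g} (hz₀ : (z₀, w₀) ∈ D.hatDom U)
    (h : ∀ z, (z, w₀) ∈ D.hatDom U → constantForm D vol w₀ z w₀ l = modelRelD T z w₀ l) :
    False := by
  let H : (Fin (q + 1) → ℝ) → Coord g := fun t => ∑ j, t j • l j
  have hH : ContDiff ℝ ∞ H := by fun_prop
  have hHW : ∀ t, H t ∈ D.W := fun t => sum_mem fun j _ => D.W.smul_mem _ (hl j)
  have hHadd : ∀ t a (s : ℝ), H (t + s • Pi.single a 1) = H t + s • l a := by
    intro t a s
    simp [H, add_smul, Finset.sum_add_distrib, Pi.single_apply]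
  let G : Fin (q + 1) → (Fin (q + 1) → ℝ) → ℂ := fun a t =>
    (-1 : ℂ) ^ (a : ℕ) * (phase (inner ℝ (D.y z₀ + H t) w₀) *
      T (z₀ + H t) w₀ fun c => l (a.succAbove c))
  have hph : ContDiff ℝ ∞ fun t => phase (inner ℝ (D.y z₀ + H t) w₀) :=
    ContDiff.comp (g := phase) (f := fun t => inner ℝ (D.y z₀ + H t) w₀) contDiff_phase
      ((contDiff_const.add hH).inner ℝ contDiff_const)
  have hG : ∀ a, ContDiff ℝ ∞ (G a) := fun a => contDiff_const.mul
    (hph.mul (hT.contDiff_line hU hz₀ hH hHW fun c => hl _))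
  have hhol : ∀ j, phase (inner ℝ (l j) w₀) = E.hol (l j) := by
    intro j
    have h1 := hw₀ (l j) (hl j) (hl' j)
    rw [holonomy] at h1
    exact (mul_inv_eq_one₀ (Circle.coe_ne_zero _)).1 h1
  have hper : ∀ a t, G a (t + Pi.single a 1) = G a t := by
    intro a t
    have h1 := hHadd t a 1
    rw [one_smul, one_smul] at h1
    simp only [G, h1]
    rw [← add_assoc, ← add_assoc, hT.hol _ w₀ (D.add_mem_hatDom hz₀ (hHW t)) (l a) (hl a) (hl' a) _
      fun c => hl _, inner_add_left, phase_add, hhol]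
    have := Circle.coe_ne_zero (E.hol (l a))
    field_simp
  have hsum : ∀ t, ∑ a, fderiv ℝ (G a) t (Pi.single a 1) = 1 := by
    intro t
    have hmem := D.add_mem_hatDom hz₀ (hHW t)
    have h1 : ∀ a, fderiv ℝ (G a) t (Pi.single a 1) = phase (inner ℝ (D.y z₀ + H t) w₀) *
        ((-1 : ℂ) ^ (a : ℕ) *
        (deriv (fun s : ℝ => T (z₀ + H t + s • l a) w₀ (fun c => l (a.succAbove c))) 0 +
        2 * Real.pi * Complex.I * (inner ℝ (l a) w₀ : ℝ) *
          T (z₀ + H t) w₀ (fun c => l (a.succAbove c)))) := by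
      intro a
      rw [← ((hG a).differentiable (by simp) t).lineDeriv_eq_fderiv, lineDeriv]
      have h2 : ∀ s : ℝ, G a (t + s • Pi.single a 1) = (-1 : ℂ) ^ (a : ℕ) *
          (phase (inner ℝ (D.y z₀ + H t) w₀ + s * inner ℝ (l a) w₀) *
          T (z₀ + H t + s • l a) w₀ fun c => l (a.succAbove c)) := by
        intro s
        simp only [G, hHadd]
        rw [← add_assoc, ← add_assoc, inner_add_left _ (s • l a), real_inner_smul_left]
      simp only [h2]
      have h3 : HasDerivAt (fun s : ℝ => inner ℝ (D.y z₀ + H t) w₀ + s * inner ℝ (l a) w₀)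
          (inner ℝ (l a) w₀) 0 := by
        simpa using ((hasDerivAt_id (0 : ℝ)).mul_const (inner ℝ (l a) w₀)).const_add
          (inner ℝ (D.y z₀ + H t) w₀)
      have h4 : ContDiff ℝ ∞ fun s : ℝ => T (z₀ + H t + s • l a) w₀ fun c => l (a.succAbove c) :=
        hT.contDiff_line hU hmem (f := fun s : ℝ => s • l a) (by fun_prop)
          (fun s => D.W.smul_mem s (hl a)) fun c => hl _
      have h5 := ((((hasDerivAt_phase _).scomp (0 : ℝ) h3).mul
        (h4.differentiable (by simp) 0).hasDerivAt).const_mul ((-1 : ℂ) ^ (a : ℕ))).deriv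
      refine h5.trans ?_
      simp only [Function.comp_apply, zero_mul, add_zero, zero_smul, Complex.real_smul]
      ring
    have h6 := h _ hmem
    rw [modelRelD] at h6
    rw [Finset.sum_congr rfl fun a _ => h1 a, ← Finset.mul_sum, ← h6, constantForm, sub_self,
      roundVec_eq_zero (by simp), add_zero, D.y_add z₀ _ (hHW t), AlternatingMap.smul_apply, hvol,
      smul_eq_mul, mul_one, ← phase_add, add_neg_cancel, phase_zero]
  have hint := integral_divergence_eq_zero_of_periodic hG hper
  simp only [hsum] at hint
  rw [MeasureTheory.setIntegral_const, MeasureTheory.measureReal_def, Real.volume_Icc_pi] at hint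
  simp at hint

variable [IsManifold (𝓡 g) ∞ B]

theorem LocalModel.isOpen_nearHat (D : LocalModel S φ m x₀) (w₀ : Coord g) :
    IsOpen (D.nearHat w₀) := by
  refine XHat.isOpen_image_param φ ?_ fun p hp => D.ball_subset hp.1
  refine (Metric.isOpen_ball.preimage continuous_fst).inter ?_
  have : {p : Coord g × Coord g | ∃ n ∈ intLattice g, ‖p.2 - w₀ - n‖ < 1 / 2} =
      ⋃ n ∈ intLattice g, {p : Coord g × Coord g | ‖p.2 - w₀ - n‖ < 1 / 2} := by
    ext p
    simp
  change IsOpen {p : Coord g × Coord g | ∃ n ∈ intLattice g, ‖p.2 - w₀ - n‖ < 1 / 2}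
  rw [this]
  exact isOpen_biUnion fun n _ => isOpen_lt (by fun_prop) continuous_const

theorem LocalModel.exists_norm_lt_of_mem_hatDom (D : LocalModel S φ m x₀) {z w : Coord g}
    (h : (z, w) ∈ D.hatDom (D.nearHat w₀)) : ∃ n ∈ intLattice g, ‖w - w₀ - n‖ < 1 / 2 := by
  obtain ⟨hz, ⟨x', w'⟩, ⟨hx', n, hn, hw'⟩, heq⟩ := h
  obtain ⟨-, h1⟩ := (XHat.param_eq_param φ (q := ((D.coords z).1, w)) (D.ball_subset hx')
    (D.coords_fst_mem hz)).1 heq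
  refine ⟨n + (w - w'), add_mem hn h1, ?_⟩
  convert hw' using 2
  change w - w₀ - (n + (w - w')) = w' - w₀ - n
  abel

theorem isModelForm_constantForm (E : FlatFrame D L) (vol : Coord g [⋀^Fin q]→ₗ[ℝ] ℂ)
    (hw₀ : ∀ l ∈ D.W, l ∈ intLattice g → holonomy E l w₀ = 1) :
    IsModelForm E (D.nearHat w₀) (constantForm D vol w₀) := by
  refine ⟨?_, ?_, ?_⟩
  · rintro u - ⟨z, w⟩ hzw
    obtain ⟨n, hn, hw⟩ := D.exists_norm_lt_of_mem_hatDom hzw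
    have h1 : ∀ᶠ p : Coord g × Coord g in 𝓝 (z, w), ‖p.2 - w₀ - n‖ < 1 / 2 :=
      (isOpen_lt (by fun_prop : Continuous fun p : Coord g × Coord g => ‖p.2 - w₀ - n‖)
        continuous_const).mem_nhds hw
    have h2 : ContDiffAt ℝ ∞ (fun p : Coord g × Coord g => D.y p.1) (z, w) :=
      ContDiffAt.comp (g := D.y) (f := fun p : Coord g × Coord g => p.1) (z, w)
        (D.contDiffOn.contDiffAt (D.isOpen_dom.mem_nhds hzw.1)) contDiffAt_fst
    have h3 : ContDiffAt ℝ ∞ (fun p : Coord g × Coord g => phase (-inner ℝ (D.y p.1) (w₀ + n)))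
        (z, w) :=
      ContDiffAt.comp (g := phase) (f := fun p : Coord g × Coord g => -inner ℝ (D.y p.1) (w₀ + n))
        (z, w) contDiff_phase.contDiffAt (h2.inner ℝ contDiffAt_const).neg
    refine ContDiffAt.contDiffWithinAt
      ((h3.mul (contDiffAt_const (c := vol u))).congr_of_eventuallyEq ?_)
    filter_upwards [h1] with p hp
    rw [constantForm, roundVec_eq hn hp]
    rfl
  · intro z w hzw l hl hl' u _
    obtain ⟨k, hk⟩ := exists_int_inner_eq hl' (roundVec_mem (w - w₀))
    have h1 := hw₀ l hl hl'
    have h2 : phase (inner ℝ l w₀) = E.hol l := by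
      rw [holonomy] at h1
      exact (mul_inv_eq_one₀ (Circle.coe_ne_zero _)).1 h1
    have h3 : -inner ℝ (D.y z + l) (w₀ + roundVec (w - w₀)) =
        -inner ℝ (D.y z) (w₀ + roundVec (w - w₀)) + (-inner ℝ l w₀ + ((-k : ℤ) : ℝ)) := by
      rw [inner_add_left, inner_add_right l, hk]
      push_cast
      ring
    rw [constantForm, constantForm, D.y_add z l hl, h3, phase_add, phase_add, phase_int,
      phase_neg (inner ℝ l w₀), h2, AlternatingMap.smul_apply, AlternatingMap.smul_apply,
      smul_eq_mul, smul_eq_mul]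
    ring
  · intro z w hzw μ hμ u _
    have h1 : w + μ - w₀ = w - w₀ + μ := by abel
    rw [constantForm, constantForm, h1, roundVec_add hμ, ← add_assoc, inner_add_right _ _ μ,
      neg_add, phase_add, exp_neg_eq_phase, AlternatingMap.smul_apply, AlternatingMap.smul_apply,
      smul_eq_mul, smul_eq_mul]
    ring

theorem mem_transformSupport_of_holonomy_eq_one (E : FlatFrame D L)
    (hw₀ : ∀ l ∈ D.W, l ∈ intLattice g → holonomy E l w₀ = 1) {z₀ : Coord g} (hz₀ : z₀ ∈ D.dom) :
    XHat.param φ ((D.coords z₀).1, w₀) ∈ transformSupport L m := by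
  obtain ⟨l, hl, hl', hli, -⟩ := D.rational.exists_basis D.finrank_eq
  obtain ⟨vol, hvol⟩ := exists_topForm D.finrank_eq hl hli
  have hT := isModelForm_constantForm E vol hw₀
  have hrep := represents_ofModel hT
  refine ⟨D.nearHat w₀, D.isOpen_nearHat w₀, ⟨((D.coords z₀).1, w₀), ⟨D.coords_fst_mem_ball hz₀, 0,
    zero_mem _, by simp⟩, rfl⟩, ofModel E (constantForm D vol w₀),
    isRelForm_ofModel (D.nearHat_subset w₀) hT (D.isOpen_nearHat w₀), ?_, ?_⟩
  · intro i
    refine D.forall_of_params (D.nearHat_subset w₀) (fun b α v u => relD _ i b α v u = 0) ?_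
    intro z w n hzw hi hn u hu
    rw [hrep.relD_eq hzw hi hn hu, modelRelD_constantForm vol z w hu, mul_zero]
  · intro U' hU' hU'o hξ hex
    have hmem : (z₀, w₀) ∈ D.hatDom U' := ⟨hz₀, hξ⟩
    have h0 : (0 : Coord g) ∈ intLattice g := zero_mem _
    have hS : ∀ z ∈ D.dom, ∀ i, D.pt z ∈ L.cover i →
        X.mk (cot φ.1 (D.base z) (D.y z + 0)) ∈ S ∩ L.cover i := by
      intro z hz i hi
      rw [D.mk_eq_pt hz h0]
      exact ⟨D.pt_mem hz, hi⟩
    cases m with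
    | zero =>
      obtain ⟨i, hi⟩ := L.exists_mem_cover (D.pt_mem hz₀)
      have h1 := hex i (D.base z₀) _ _ (hS z₀ hz₀ i hi) hξ fun a => cot φ.1 (D.base z₀) (l a)
      have h2 := hrep i z₀ w₀ (D.hatDom_mono hU' hmem) hi 0 h0 l hl
      rw [h1] at h2
      have h3 := (mul_eq_zero.1 h2.symm).resolve_left (Circle.coe_ne_zero _)
      rw [constantForm, AlternatingMap.smul_apply, hvol, smul_eq_mul, mul_one] at h3
      exact phase_ne_zero _ h3
    | succ q =>
      obtain ⟨σ, hσ, hσeq⟩ := hex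
      obtain ⟨idx, hidx⟩ := D.exists_index L
      have hσrep := hσ.represents E hidx
      refine modelRelD_ne_constantForm hl hl' hvol hw₀ hU'o (hσ.isModelForm hU'o hσrep) hmem ?_
      intro z hz
      obtain ⟨i, hi⟩ := L.exists_mem_cover (D.pt_mem hz.1)
      have h1 := hσeq i (D.base z) _ _ (hS z hz.1 i hi) hz.2 (fun a => cot φ.1 (D.base z) (l a))
        fun a => D.cot_mem_vertTangent hz.1 h0 (hl a)
      have h2 := hrep i z w₀ (D.hatDom_mono hU' hz) hi 0 h0 l hl
      have h3 := hσrep.relD_eq hz hi h0 hl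
      exact mul_left_cancel₀ (Circle.coe_ne_zero (E.e i z)) (h2.symm.trans (h1.trans h3))

end Nonvanishing

section ComplexSubspace

variable {g : ℕ}

/-- The real part of a complex vector. -/
def reVec (z : Fin g → ℂ) : Coord g := WithLp.toLp 2 fun j => (z j).re

/-- The imaginary part of a complex vector. -/
def imVec (z : Fin g → ℂ) : Coord g := WithLp.toLp 2 fun j => (z j).im

theorem reVec_sub (z z' : Fin g → ℂ) : reVec (z - z') = reVec z - reVec z' := by
  ext j
  simp [reVec]

theorem imVec_sub (z z' : Fin g → ℂ) : imVec (z - z') = imVec z - imVec z' := by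
  ext j
  simp [imVec]

theorem reVec_add (z z' : Fin g → ℂ) : reVec (z + z') = reVec z + reVec z' := by
  ext j
  simp [reVec]

theorem imVec_add (z z' : Fin g → ℂ) : imVec (z + z') = imVec z + imVec z' := by
  ext j
  simp [imVec]

theorem reVec_smul (c : ℂ) (z : Fin g → ℂ) : reVec (c • z) = c.re • reVec z - c.im • imVec z := by
  ext j
  simp [reVec, imVec]

theorem imVec_smul (c : ℂ) (z : Fin g → ℂ) : imVec (c • z) = c.re • imVec z + c.im • reVec z := by
  ext j
  simp [reVec, imVec]

theorem continuous_reVec : Continuous (reVec : (Fin g → ℂ) → Coord g) :=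
  (PiLp.continuous_toLp 2 _).comp (by fun_prop)

theorem continuous_imVec : Continuous (imVec : (Fin g → ℂ) → Coord g) :=
  (PiLp.continuous_toLp 2 _).comp (by fun_prop)

/-- The complexification of a subspace of `ℝ^g`. -/
def complexify (W : Submodule ℝ (Coord g)) : Submodule ℂ (Fin g → ℂ) where
  carrier := {z | reVec z ∈ W ∧ imVec z ∈ W}
  zero_mem' := by
    have h1 : reVec (0 : Fin g → ℂ) = 0 := by ext j; simp [reVec]
    have h2 : imVec (0 : Fin g → ℂ) = 0 := by ext j; simp [imVec]
    exact ⟨h1 ▸ zero_mem _, h2 ▸ zero_mem _⟩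
  add_mem' := by
    rintro z z' ⟨h1, h2⟩ ⟨h3, h4⟩
    exact ⟨reVec_add z z' ▸ add_mem h1 h3, imVec_add z z' ▸ add_mem h2 h4⟩
  smul_mem' := by
    rintro c z ⟨h1, h2⟩
    exact ⟨reVec_smul c z ▸ sub_mem (W.smul_mem _ h1) (W.smul_mem _ h2),
      imVec_smul c z ▸ add_mem (W.smul_mem _ h2) (W.smul_mem _ h1)⟩

theorem mem_complexify {W : Submodule ℝ (Coord g)} {z : Fin g → ℂ} :
    z ∈ complexify W ↔ reVec z ∈ W ∧ imVec z ∈ W := Iff.rfl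

/-- The real and imaginary parts of the vectors of a complexified subspace. -/
def complexifyEquiv (W : Submodule ℝ (Coord g)) : complexify W ≃ₗ[ℝ] W × W where
  toFun z := (⟨reVec z.1, z.2.1⟩, ⟨imVec z.1, z.2.2⟩)
  invFun p := ⟨fun j => ⟨p.1.1 j, p.2.1 j⟩, p.1.2, p.2.2⟩
  map_add' z z' := by
    ext j
    · simp [reVec]
    · simp [imVec]
  map_smul' c z := by
    ext j
    · simp [reVec]
    · simp [imVec]
  left_inv z := rfl
  right_inv p := rfl

theorem finrank_complexify (W : Submodule ℝ (Coord g)) :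
    Module.finrank ℂ (complexify W) = Module.finrank ℝ W := by
  have h1 := (complexifyEquiv W).finrank_eq
  rw [Module.finrank_prod, ← Module.finrank_mul_finrank ℝ ℂ, Complex.finrank_real_complex] at h1
  omega

end ComplexSubspace

section Support

variable {g : ℕ} {B : Type*} [TopologicalSpace B] [ChartedSpace (Coord g) B]
  [IsManifold (𝓡 g) ∞ B] {Λ : LagrangianCovering g B} {S : Set (X Λ)} {m : ℕ} {L : LocalSystem S}
  {φ : ActionChart Λ} {x₀ : Coord g} {D : LocalModel S φ m x₀}

theorem exists_param_mem_of_mem_transformSupport (hS : IsClosed S) {x w : Coord g}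
    (hx : x ∈ φ.1.target) (h : XHat.param φ (x, w) ∈ transformSupport L m) :
    ∃ y, X.param φ (x, y) ∈ S := by
  obtain ⟨α, hα⟩ := exists_mk_of_mem_proj (fst_mem_of_mem_transformSupport hS h)
  have hb : φ.1.symm x ∈ φ.1.source := φ.1.map_target hx
  have h1 := X.mk_eq_param φ hb α
  rw [φ.1.right_inv hx] at h1
  exact ⟨_, h1 ▸ hα⟩

theorem holonomy_eq_one_of_mem_transformSupport (E : FlatFrame D L) {x w l : Coord g}
    (hx : x ∈ Metric.ball x₀ D.r) (h : XHat.param φ (x, w) ∈ transformSupport L m)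
    (hl : l ∈ D.W) (hl' : l ∈ intLattice g) : holonomy E l w = 1 := by
  by_contra hne
  cases m with
  | zero =>
    have h1 : l = 0 := by
      have := Submodule.finrank_eq_zero.1 D.finrank_eq
      rwa [this, Submodule.mem_bot] at hl
    rw [h1] at hne
    exact hne (by simp [holonomy, hol_zero, phase_zero])
  | succ q => exact notMem_transformSupport_of_holonomy_ne_one E hl hl' hx hne h

theorem mem_transformSupport_iff (hS : IsClosed S) (E : FlatFrame D L) {w₀ : Coord g}
    (hw₀ : ∀ l ∈ D.W, l ∈ intLattice g → holonomy E l w₀ = 1) {l : Fin m → Coord g}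
    (hl : ∀ j, l j ∈ D.W) (hl' : ∀ j, l j ∈ intLattice g)
    (hspan : Submodule.span ℝ (range l) = D.W) {x w : Coord g} (hx : x ∈ Metric.ball x₀ D.r)
    (hw : ∀ j, |inner ℝ (l j) (w - w₀)| < 1) :
    XHat.param φ (x, w) ∈ transformSupport L m ↔ x - x₀ ∈ D.Wᗮ ∧ w - w₀ ∈ D.Wᗮ := by
  have hshift : ∀ l, holonomy E l w = phase (inner ℝ l (w - w₀)) * holonomy E l w₀ := by
    intro l
    rw [holonomy, holonomy, ← mul_assoc, ← phase_add, ← inner_add_right, sub_add_cancel]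
  constructor
  · intro h
    constructor
    · obtain ⟨y, hy⟩ := exists_param_mem_of_mem_transformSupport hS (D.ball_subset hx) h
      obtain ⟨z, n, -, hz, -⟩ := (D.mem_iff x hx y).1 hy
      rw [← hz]
      exact D.Wᗮ.starProjection_apply_mem z
    · rw [← hspan, Submodule.mem_orthogonal]
      intro u hu
      have h0 : ∀ j, inner ℝ (l j) (w - w₀) = 0 := by
        intro j
        have h1 := holonomy_eq_one_of_mem_transformSupport E hx h (hl j) (hl' j)
        rw [hshift, hw₀ _ (hl j) (hl' j), mul_one, phase_eq_one_iff] at h1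
        obtain ⟨n, hn⟩ := h1
        have h2 := hw j
        rw [hn] at h2 ⊢
        have h3 : |n| < 1 := by exact_mod_cast h2
        rw [Int.abs_lt_one_iff.1 h3, Int.cast_zero]
      refine Submodule.span_induction ?_ ?_ ?_ ?_ hu
      · rintro _ ⟨j, rfl⟩
        exact h0 j
      · exact inner_zero_left _
      · intro a b _ _ ha hb
        rw [inner_add_left, ha, hb, add_zero]
      · intro c a _ ha
        rw [inner_smul_left, ha, mul_zero]
  · rintro ⟨h1, h2⟩
    have h3 : D.Wᗮ.starProjection (x - x₀) = x - x₀ := D.Wᗮ.starProjection_eq_self_iff.2 h1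
    have h4 : x - x₀ ∈ D.dom := by
      change ‖_‖ < _
      rw [h3]
      exact mem_ball_iff_norm.1 hx
    have h5 : (D.coords (x - x₀)).1 = x := by
      rw [LocalModel.coords, h3]
      exact add_sub_cancel _ _
    have h6 := mem_transformSupport_of_holonomy_eq_one (w₀ := w) E (fun l hl hl' => by
      rw [hshift, hw₀ l hl hl', Submodule.inner_right_of_mem_orthogonal hl h2, phase_zero,
        mul_one]) h4
    rwa [h5] at h6

/-- The support of the transform is a complex submanifold. -/
theorem isComplexSubmanifold_transformSupport (hS : IsClosedLagrangian S)
    (hclean : IsFibrewiseClean S) (hm : FibresAreSubtori S m) (L : LocalSystem S) :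
    IsComplexSubmanifold (transformSupport L m) := by
  refine ⟨g - m, fun φ p hp => ?_⟩
  obtain ⟨hx₀, hp⟩ : reVec p ∈ φ.1.target ∧
    XHat.param φ (reVec p, imVec p) ∈ transformSupport L m := hp
  obtain ⟨y₀, hy₀⟩ := exists_param_mem_of_mem_transformSupport hS.isClosed hx₀ hp
  obtain ⟨D⟩ := exists_localModel hS hclean hm φ hx₀ hy₀
  obtain ⟨E⟩ := exists_flatFrame D L
  obtain ⟨l, hl, hl', -, hspan⟩ := D.rational.exists_basis D.finrank_eq
  have hw₀ : ∀ l ∈ D.W, l ∈ intLattice g → holonomy E l (imVec p) = 1 := fun l hl hl' =>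
    holonomy_eq_one_of_mem_transformSupport E (Metric.mem_ball_self D.r_pos) hp hl hl'
  let O : Set (Fin g → ℂ) := {z | reVec z ∈ Metric.ball (reVec p) D.r ∧
    ∀ j, |inner ℝ (l j) (imVec z - imVec p)| < 1}
  have hO : IsOpen O := by
    refine (Metric.isOpen_ball.preimage continuous_reVec).inter ?_
    change IsOpen {z : Fin g → ℂ | ∀ j, |inner ℝ (l j) (imVec z - imVec p)| < 1}
    simp only [ofPred_forall]
    refine isOpen_iInter_of_finite fun j => isOpen_lt (Continuous.abs ?_) continuous_const
    exact continuous_const.inner (continuous_imVec.sub continuous_const)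
  have hpO : p ∈ O := ⟨Metric.mem_ball_self D.r_pos, fun j => by simp⟩
  let Φ := ((Homeomorph.addRight (-p)).toOpenPartialHomeomorph).restrOpen O hO
  have hsource : Φ.source = O := by
    change univ ∩ O = O
    exact univ_inter O
  have htarget : ∀ z, z ∈ Φ.target ↔ z + p ∈ O := by
    intro z
    have h1 : Φ.symm z = z + p := by
      change z + - -p = z + p
      rw [neg_neg]
    constructor
    · intro h
      rw [← h1, ← hsource]
      exact Φ.map_target h
    · intro h
      have h2 : Φ (z + p) = z := by
        change z + p + -p = z
        abel
      rw [← h2]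
      exact Φ.map_source (hsource.symm ▸ h)
  have hmem : ∀ z ∈ O, z ∈ inComplexChart (transformSupport L m) φ ↔ z - p ∈ complexify D.Wᗮ := by
    intro z hz
    rw [mem_complexify, reVec_sub, imVec_sub,
      ← mem_transformSupport_iff hS.isClosed E hw₀ hl hl' hspan hz.1 hz.2]
    exact ⟨fun h => h.2, fun h => ⟨D.ball_subset hz.1, h⟩⟩
  refine ⟨Φ, complexify D.Wᗮ, hsource.symm ▸ hpO, ?_, ?_, ?_, ?_⟩
  · have : ContDiff ℂ ω fun z : Fin g → ℂ => z + -p := contDiff_id.add contDiff_const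
    exact this.contDiffOn
  · have : ContDiff ℂ ω fun z : Fin g → ℂ => z + - -p := contDiff_id.add contDiff_const
    exact this.contDiffOn
  · rw [finrank_complexify, finrank_orthogonal_eq D.finrank_eq]
  · rw [hsource]
    ext z
    constructor
    · rintro ⟨z, ⟨hz, hzO⟩, rfl⟩
      have h1 : Φ z = z - p := (sub_eq_add_neg z p).symm
      rw [h1]
      exact ⟨(htarget _).2 (by rwa [sub_add_cancel]), (hmem z hzO).1 hz⟩
    · rintro ⟨hz, hzF⟩
      have hzO := (htarget z).1 hz
      refine ⟨z + p, ⟨(hmem _ hzO).2 (by rwa [add_sub_cancel_right]), hzO⟩, ?_⟩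
      change z + p + -p = z
      abel

end Support

end TorusFibration

end

theorem mainTheorem2 {g : ℕ} {B : Type*} [TopologicalSpace B] [T2Space B]
    [SecondCountableTopology B] [ConnectedSpace B] [ChartedSpace (Coord g) B]
    [IsManifold (𝓡 g) ∞ B] (Λ : LagrangianCovering g B) (S : Set (X Λ)) (m : ℕ)
    (hS : IsClosedLagrangian S) (hclean : IsFibrewiseClean S) (hm : FibresAreSubtori S m)
    (L : LocalSystem S) :
    VerticalTangentsParallel S ↔ IsComplexSubmanifold (transformSupport L m) := by
  exact ⟨fun _ => isComplexSubmanifold_transformSupport hS hclean hm L,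
    fun _ => verticalTangentsParallel hS hclean hm⟩
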